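/- Let $M$ be a complex manifold (Hausdorff, second countable) of complex dimension $n$, $d=2n$, with complex structure $J$, and let $g$ be a smooth Riemannian metric on $M$ that is the real part of a Kähler metric, i.e. $g(JX,JY)=g(X,Y)$ and the two-form $g(\cdot,J\cdot)$ is closed. Extend $g$ sesquilinearly (conjugate linear in the first argument) to the complexified tangent bundle, and let $m$ be the Riemannian volume measure. Let $\mathcal L\to M$ be a holomorphic line bundle with a smooth Hermitian metric $h$ (conjugate linear in the first argument), and let $\nabla$ be a connection on $\mathcal L$, extended complex linearly to complex vector fields, which is compatible with $h$ ($X\,h(\sigma,\tau)=h(\nabla_X\sigma,\tau)+h(\sigma,\nabla_X\tau)$ for real $X$) and with the holomorphic structure ($\nabla_{\bar Z}\sigma=0$ for local holomorphic sections $\sigma$ and $\bar Z\in T^{(0,1)}M$). Let $R_{X,Y}=\nabla_X\nabla_Y-\nabla_Y\nabla_X-\nabla_{[X,Y]}$ be its curvature. Let $C^\infty_{c}(M,\mathcal L)$ be the space of smooth compactly supported sections, and on it consider the forms $$\mathcal E^{\mathcal L}(\varphi,\psi)=\int_M\sum_{k=1}^{d}h(\nabla_{E_k}\varphi,\nabla_{E_k}\psi)\,dm,\qquad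 \mathcal E^{(0,\bullet)}(\varphi,\psi)=\int_M\sum_{k=1}^{n}h(\nabla_{\bar Z_k}\varphi,\nabla_{\bar Z_k}\psi)\,dm,$$ where at each point $\{E_k\}$ is an orthonormal basis of the real tangent space and $\{\bar Z_k\}$ an orthonormal basis of the space $T^{(0,1)}M$ of antiholomorphic tangent vectors. The Bochner Laplacian $\Delta^{\mathcal L}$ and the holomorphic Laplacian $\Delta^{(0,\bullet)}$ are the operators on $L^2(hm)$ such that $-\Delta^{\mathcal L}$ and $-\Delta^{(0,\bullet)}$ are the self-adjoint operators associated with the closures of $\mathcal E^{\mathcal L}$ and $\mathcal E^{(0,\bullet)}$. Then there is a smooth function $\rho:M\to\mathbb R$ such that, for every smooth orthonormal frame $\{\bar Z_k\}_{k=1}^{n}$ of $T^{(0,1)}M$ over an open set $U$ and every section $\psi$ that is smooth on $U$, $$\rho(x)\psi(x)=\sum_{k=1}^{n}(R_{\bar Z_k,Z_k}\psi)(x)\qquad(x\in U),$$ and $$\Delta^{(0,\bullet)}=\tfrac12\bigl(\Delta^{\mathcal L}-\rho\bigr)$$ in the following sense. 1. Each $\psi\in C^\infty_c(M,\mathcal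 L)$ is in the domains of both Laplacians, $\Delta^{\mathcal L}\psi\in C^\infty_c(M,\mathcal L)$, and $\Delta^{(0,\bullet)}\psi=\tfrac12(\Delta^{\mathcal L}\psi-\rho\psi)$. 2. As self-adjoint operators, $-\Delta^{(0,\bullet)}$ is equal to the operator $\tfrac12(-\Delta^{\mathcal L}+\rho)$ defined as a form sum, i.e. the operator associated with the closure of the form $\tfrac12\bigl(\mathcal E^{\mathcal L}(\varphi,\psi)+\int_M h(\varphi,\rho\psi)\,dm\bigr)$ on $C^\infty_c(M,\mathcal L)$. 3. If $\psi$ is in the domain of $\Delta^{\mathcal L}$ and $\rho\psi\in L^2(hm)$, then $\psi$ is in the domain of $\Delta^{(0,\bullet)}$ and $\Delta^{(0,\bullet)}\psi=\tfrac12(\Delta^{\mathcal L}\psi-\rho\psi)$. -/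

import Mathlib

open Bundle MeasureTheory Filter Topology VectorField
open scoped Manifold ContDiff

noncomputable section

namespace KahlerBundle

/-! ### The real structure underlying a complex manifold -/

section RealStructure

variable {E : Type*} [NormedAddCommGroup E] [NormedSpace ℂ E]
  {M : Type*} [TopologicalSpace M] [ChartedSpace E M]

/-- A complex manifold is a smooth real manifold, with the same charts. -/
instance realManifold [IsManifold 𝓘(ℂ, E) ω M] : IsManifold 𝓘(ℝ, E) ∞ M := by
  refine isManifold_of_contDiffOn 𝓘(ℝ, E) ∞ M fun e e' he he' => ?_
  have h := (contDiffGroupoid ω 𝓘(ℂ, E)).compatible he he'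
  rw [contDiffGroupoid, mem_groupoid_of_pregroupoid] at h
  have h1 := h.1
  simp only [contDiffPregroupoid] at h1
  exact (ContDiffOn.restrict_scalars ℝ h1).of_le le_top

/-- The real tangent space of a complex manifold. -/
abbrev RTangent (x : M) : Type _ := TangentSpace 𝓘(ℝ, E) x

instance (x : M) [FiniteDimensional ℂ E] : FiniteDimensional ℝ (TangentSpace 𝓘(ℝ, E) x) :=
  inferInstanceAs (FiniteDimensional ℝ E)

/-- The almost complex structure `J`: multiplication by `i` in holomorphic coordinates. -/
def J (x : M) : TangentSpace 𝓘(ℝ, E) x → TangentSpace 𝓘(ℝ, E) x :=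
  fun v : E => (Complex.I • v : E)

/-- A vector `re + i im` of the complexified tangent space at `x`. -/
structure CTangent (E : Type*) [NormedAddCommGroup E] [NormedSpace ℂ E]
    {M : Type*} [TopologicalSpace M] [ChartedSpace E M] (x : M) where
  re : TangentSpace 𝓘(ℝ, E) x
  im : TangentSpace 𝓘(ℝ, E) x

instance (x : M) : Nonempty (CTangent E x) := ⟨⟨0, 0⟩⟩

/-- Complex conjugation of complexified tangent vectors. -/
def CTangent.conj {x : M} (V : CTangent E x) : CTangent E x := ⟨V.re, -V.im⟩

/-- `V` is of type `(0,1)`: `J V = - i V`. -/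
def CTangent.IsAntiholomorphic {x : M} (V : CTangent E x) : Prop :=
  J x V.re = V.im ∧ J x V.im = -V.re

/-- The complex bilinear extension of the Lie bracket. -/
def cLie (V W : Π x : M, CTangent E x) (x : M) : CTangent E x where
  re := mlieBracket 𝓘(ℝ, E) (fun y => (V y).re) (fun y => (W y).re) x
    - mlieBracket 𝓘(ℝ, E) (fun y => (V y).im) (fun y => (W y).im) x
  im := mlieBracket 𝓘(ℝ, E) (fun y => (V y).re) (fun y => (W y).im) x
    + mlieBracket 𝓘(ℝ, E) (fun y => (V y).im) (fun y => (W y).re) x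

/-- Smoothness of a real vector field at a point. -/
def SmoothFieldAt [IsManifold 𝓘(ℂ, E) ω M] (X : Π x : M, TangentSpace 𝓘(ℝ, E) x) (x : M) : Prop :=
  ContMDiffAt 𝓘(ℝ, E) (𝓘(ℝ, E).prod 𝓘(ℝ, E)) ∞
    (fun y => (TotalSpace.mk' E y (X y) : TangentBundle 𝓘(ℝ, E) M)) x

end RealStructure

/-! ### Riemannian and Kähler metrics -/

section Metric

variable {E : Type*} [NormedAddCommGroup E] [NormedSpace ℂ E]
  {M : Type*} [TopologicalSpace M] [ChartedSpace E M]
  [RiemannianBundle (fun x : M => TangentSpace 𝓘(ℝ, E) x)]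

/-- The sesquilinear extension of the Riemannian metric, conjugate linear in the first argument. -/
def cMetric {x : M} (V W : CTangent E x) : ℂ :=
  ((inner ℝ V.re W.re + inner ℝ V.im W.im : ℝ) : ℂ)
    + Complex.I * ((inner ℝ V.re W.im - inner ℝ V.im W.re : ℝ) : ℂ)

/-- `Z` is an orthonormal basis of the space of tangent vectors of type `(0,1)` at `x`. -/
def IsAntiholomorphicONB (x : M) (Z : Fin (Module.finrank ℂ E) → CTangent E x) : Prop :=
  (∀ k, (Z k).IsAntiholomorphic) ∧ ∀ k l, cMetric (Z k) (Z l) = if k = l then 1 else 0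

/-- The fundamental two-form `g(X, J Y)` (up to a constant factor). -/
def fundamentalForm (X Y : Π x : M, TangentSpace 𝓘(ℝ, E) x) (x : M) : ℝ :=
  inner ℝ (X x) (J x (Y x))

variable (E M) in
/-- The Riemannian metric is the real part of a Kähler metric: it is `J`-invariant and its
fundamental two-form is closed. -/
structure IsKahler [IsManifold 𝓘(ℂ, E) ω M] : Prop where
  hermitian : ∀ (x : M) (v w : TangentSpace 𝓘(ℝ, E) x), inner ℝ (J x v) (J x w) = inner ℝ v w
  closed : ∀ (x : M) (X Y Z : Π x : M, TangentSpace 𝓘(ℝ, E) x),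
    SmoothFieldAt X x → SmoothFieldAt Y x → SmoothFieldAt Z x →
    mvfderiv 𝓘(ℝ, E) (fundamentalForm Y Z) x (X x)
      + mvfderiv 𝓘(ℝ, E) (fundamentalForm Z X) x (Y x)
      + mvfderiv 𝓘(ℝ, E) (fundamentalForm X Y) x (Z x)
      - fundamentalForm (mlieBracket 𝓘(ℝ, E) X Y) Z x
      - fundamentalForm (mlieBracket 𝓘(ℝ, E) Y Z) X x
      - fundamentalForm (mlieBracket 𝓘(ℝ, E) Z X) Y x = 0

variable [FiniteDimensional ℂ E] [MeasurableSpace E] [BorelSpace E] [MeasurableSpace M]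

/-- The density `√det (g_ij)` in the chart `e`, with respect to the Lebesgue measure normalized by
the basis `Module.finBasis ℝ E` of the model space. -/
def volumeDensity (e : OpenPartialHomeomorph M E) (y : E) : ENNReal :=
  ENNReal.ofReal (Real.sqrt (Matrix.det (Matrix.of fun i j =>
    (inner ℝ
      ((mfderiv 𝓘(ℝ, E) 𝓘(ℝ, E) e.symm y (Module.finBasis ℝ E i) :
        TangentSpace 𝓘(ℝ, E) (e.symm y)))
      ((mfderiv 𝓘(ℝ, E) 𝓘(ℝ, E) e.symm y (Module.finBasis ℝ E j) :
        TangentSpace 𝓘(ℝ, E) (e.symm y))) : ℝ))))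

/-- The Riemannian volume of the domain of the chart `e`, as a measure on `M`. -/
def chartVolume (e : OpenPartialHomeomorph M E) : Measure M :=
  ((((Module.finBasis ℝ E).addHaar).restrict e.target).withDensity (volumeDensity e)).map e.symm

variable (E M) in
/-- The Riemannian volume measure. The measures `chartVolume e` agree on overlaps of charts, so
that their supremum is the measure which restricts to `chartVolume e` on the domain of every
chart `e`. -/
def vol : Measure M := ⨆ e ∈ atlas E M, chartVolume e

end Metric

/-! ### Hermitian holomorphic line bundles and connections -/

section LineBundle

variable {E : Type*} [NormedAddCommGroup E] [NormedSpace ℂ E]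
  {M : Type*} [TopologicalSpace M] [ChartedSpace E M]
  {L : M → Type*} [TopologicalSpace (TotalSpace ℂ L)]
  [∀ x, NormedAddCommGroup (L x)] [∀ x, InnerProductSpace ℂ (L x)]
  [FiberBundle ℂ L]

/-- Smoothness (in the real sense) of a section at a point. -/
def SmoothSectionAt (E : Type*) [NormedAddCommGroup E] [NormedSpace ℂ E]
    {M : Type*} [TopologicalSpace M] [ChartedSpace E M]
    {L : M → Type*} [TopologicalSpace (TotalSpace ℂ L)]
    [∀ x, NormedAddCommGroup (L x)] [FiberBundle ℂ L] (ψ : Π x, L x) (x : M) : Prop :=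
  ContMDiffAt 𝓘(ℝ, E) (𝓘(ℝ, E).prod 𝓘(ℝ, ℂ)) ∞ (fun y => TotalSpace.mk' ℂ y (ψ y)) x

/-- The section is holomorphic near `x`. -/
def HolomorphicSectionAt (E : Type*) [NormedAddCommGroup E] [NormedSpace ℂ E]
    {M : Type*} [TopologicalSpace M] [ChartedSpace E M]
    {L : M → Type*} [TopologicalSpace (TotalSpace ℂ L)]
    [∀ x, NormedAddCommGroup (L x)] [FiberBundle ℂ L] (ψ : Π x, L x) (x : M) : Prop :=
  ContMDiffAt 𝓘(ℂ, E) (𝓘(ℂ, E).prod 𝓘(ℂ, ℂ)) ω (fun y => TotalSpace.mk' ℂ y (ψ y)) x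

/-- The space of smooth sections with compact support. -/
def IsTestSection (E : Type*) [NormedAddCommGroup E] [NormedSpace ℂ E]
    {M : Type*} [TopologicalSpace M] [ChartedSpace E M]
    {L : M → Type*} [TopologicalSpace (TotalSpace ℂ L)]
    [∀ x, NormedAddCommGroup (L x)] [FiberBundle ℂ L] (ψ : Π x, L x) : Prop :=
  (∀ x, SmoothSectionAt E ψ x) ∧ IsCompact (closure {x | ψ x ≠ 0})

/-- The Hermitian metric of the line bundle is smooth: in every trivialization of the bundle
atlas, the squared length of the reference section is a smooth function. -/
def IsSmoothHermitian (E : Type*) [NormedAddCommGroup E] [NormedSpace ℂ E]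
    {M : Type*} [TopologicalSpace M] [ChartedSpace E M]
    (L : M → Type*) [TopologicalSpace (TotalSpace ℂ L)]
    [∀ x, NormedAddCommGroup (L x)] [∀ x, InnerProductSpace ℂ (L x)] [FiberBundle ℂ L] : Prop :=
  ∀ (e : Trivialization ℂ (TotalSpace.proj : TotalSpace ℂ L → M)) [MemTrivializationAtlas e],
    ContMDiffOn 𝓘(ℝ, E) 𝓘(ℝ, ℝ) ∞ (fun x => ‖e.symm x (1 : ℂ)‖ ^ 2) e.baseSet

/-- The covariant derivative along a complexified vector field, extended complex linearly. -/
def cCov (D : CovariantDerivative 𝓘(ℝ, E) ℂ L) (V : Π x : M, CTangent E x) (ψ : Π x, L x) (x : M) :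
    L x :=
  D ψ x (V x).re + Complex.I • D ψ x (V x).im

/-- The curvature `R_{V,W} = ∇_V ∇_W - ∇_W ∇_V - ∇_{[V,W]}` for complexified vector fields. -/
def curvature (D : CovariantDerivative 𝓘(ℝ, E) ℂ L) (V W : Π x : M, CTangent E x)
    (ψ : Π x, L x) (x : M) : L x :=
  cCov D V (cCov D W ψ) x - cCov D W (cCov D V ψ) x - cCov D (cLie V W) ψ x

/-- The connection is complex linear, and compatible with the Hermitian metric and with the
holomorphic structure: `X h(σ, τ) = h(∇_X σ, τ) + h(σ, ∇_X τ)` for real `X`, and `∇_V σ = 0` if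
`V` is of type `(0,1)` and `σ` is a local holomorphic section. -/
structure IsCompatible (D : CovariantDerivative 𝓘(ℝ, E) ℂ L) : Prop where
  smul : ∀ (x : M) (σ : Π x, L x), SmoothSectionAt E σ x → ∀ (c : ℂ) (v : TangentSpace 𝓘(ℝ, E) x),
    D (fun y => c • σ y) x v = c • D σ x v
  metric : ∀ (x : M) (σ τ : Π x, L x), SmoothSectionAt E σ x → SmoothSectionAt E τ x →
    ∀ v : TangentSpace 𝓘(ℝ, E) x,
      mvfderiv 𝓘(ℝ, E) (fun y => inner ℂ (σ y) (τ y)) x v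
        = inner ℂ (D σ x v) (τ x) + inner ℂ (σ x) (D τ x v)
  holomorphic : ∀ (x : M) (σ : Π x, L x), HolomorphicSectionAt E σ x →
    ∀ V : CTangent E x, V.IsAntiholomorphic → D σ x V.re + Complex.I • D σ x V.im = 0

end LineBundle

/-! ### Square-integrable sections, quadratic forms and their Laplacians -/

section Laplacians

variable {E : Type*} [NormedAddCommGroup E] [NormedSpace ℂ E] [FiniteDimensional ℂ E]
  [MeasurableSpace E] [BorelSpace E]
  {M : Type*} [TopologicalSpace M] [ChartedSpace E M] [MeasurableSpace M]
  [RiemannianBundle (fun x : M => TangentSpace 𝓘(ℝ, E) x)]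
  {L : M → Type*} [TopologicalSpace (TotalSpace ℂ L)]
  [∀ x, NormedAddCommGroup (L x)] [∀ x, InnerProductSpace ℂ (L x)]
  [FiberBundle ℂ L]

/-- The inner product of `L²(h m)`, conjugate linear in the first argument. -/
def l2Inner (E : Type*) [NormedAddCommGroup E] [NormedSpace ℂ E] [FiniteDimensional ℂ E]
    [MeasurableSpace E] [BorelSpace E]
    {M : Type*} [TopologicalSpace M] [ChartedSpace E M] [MeasurableSpace M]
    [RiemannianBundle (fun x : M => TangentSpace 𝓘(ℝ, E) x)]
    {L : M → Type*} [∀ x, NormedAddCommGroup (L x)] [∀ x, InnerProductSpace ℂ (L x)]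
    (φ ψ : Π x, L x) : ℂ :=
  ∫ x, inner ℂ (φ x) (ψ x) ∂(vol E M)

/-- The section represents an element of `L²(h m)`: it is measurable in the trivializations of the
bundle atlas (up to null sets) and square integrable. -/
def IsL2 (E : Type*) [NormedAddCommGroup E] [NormedSpace ℂ E] [FiniteDimensional ℂ E]
    [MeasurableSpace E] [BorelSpace E]
    {M : Type*} [TopologicalSpace M] [ChartedSpace E M] [MeasurableSpace M]
    [RiemannianBundle (fun x : M => TangentSpace 𝓘(ℝ, E) x)]
    {L : M → Type*} [TopologicalSpace (TotalSpace ℂ L)]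
    [∀ x, NormedAddCommGroup (L x)] [FiberBundle ℂ L] (ψ : Π x, L x) : Prop :=
  (∀ (e : Trivialization ℂ (TotalSpace.proj : TotalSpace ℂ L → M)) [MemTrivializationAtlas e],
    AEStronglyMeasurable (fun x => (e (TotalSpace.mk' ℂ x (ψ x))).2)
      ((vol E M).restrict e.baseSet)) ∧
  ∫⁻ x, ‖ψ x‖ₑ ^ 2 ∂(vol E M) < ⊤

/-- The form `∫ Tr h(∇φ, ∇ψ) dm`, the trace being taken in an orthonormal basis of the real tangent
space. -/
def bochnerForm (D : CovariantDerivative 𝓘(ℝ, E) ℂ L) (φ ψ : Π x, L x) : ℂ :=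
  ∫ x, ∑ k, inner ℂ (D φ x (stdOrthonormalBasis ℝ (TangentSpace 𝓘(ℝ, E) x) k))
    (D ψ x (stdOrthonormalBasis ℝ (TangentSpace 𝓘(ℝ, E) x) k)) ∂(vol E M)

/-- Some orthonormal basis of the space of tangent vectors of type `(0,1)` at each point. -/
def antiholomorphicBasis (E : Type*) [NormedAddCommGroup E] [NormedSpace ℂ E]
    {M : Type*} [TopologicalSpace M] [ChartedSpace E M]
    [RiemannianBundle (fun x : M => TangentSpace 𝓘(ℝ, E) x)]
    (k : Fin (Module.finrank ℂ E)) (x : M) : CTangent E x :=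
  Classical.epsilon (IsAntiholomorphicONB x) k

/-- The form `∫ Tr^(0,1) h(∇φ, ∇ψ) dm`, the trace being taken in an orthonormal basis of the space
of tangent vectors of type `(0,1)`. -/
def holomorphicForm (D : CovariantDerivative 𝓘(ℝ, E) ℂ L) (φ ψ : Π x, L x) : ℂ :=
  ∫ x, ∑ k, inner ℂ (cCov D (antiholomorphicBasis E k) φ x)
    (cCov D (antiholomorphicBasis E k) ψ x) ∂(vol E M)

/-- `Δ ψ = η`, where `-Δ` is the self-adjoint operator in `L²(h m)` associated (Friedrichs
construction) with the closure of the form `Q`, initially defined on smooth sections with compact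
support: `ψ` is the limit in `L²` of a `Q`-Cauchy sequence `u` of such sections, that is,
`ψ` is in the domain of the closure of `Q`, and `Q(φ, ψ) = lim Q(φ, u n)` is equal to `(φ, -η)` for
all `φ` in the form core. -/
def IsFormLaplacian (Q : (Π x, L x) → (Π x, L x) → ℂ) (ψ η : Π x, L x) : Prop :=
  IsL2 E ψ ∧ IsL2 E η ∧ ∃ u : ℕ → Π x, L x, (∀ n, IsTestSection E (u n)) ∧
    Tendsto (fun n => ∫⁻ x, ‖u n x - ψ x‖ₑ ^ 2 ∂(vol E M)) atTop (𝓝 0) ∧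
    Tendsto (fun p : ℕ × ℕ => Q (u p.1 - u p.2) (u p.1 - u p.2)) atTop (𝓝 0) ∧
    ∀ φ : Π x, L x, IsTestSection E φ →
      Tendsto (fun n => Q φ (u n)) atTop (𝓝 (-l2Inner E φ η))

/-- `Δ^L ψ = η` for the Bochner Laplacian `Δ^L`. -/
def IsBochnerLaplacian (D : CovariantDerivative 𝓘(ℝ, E) ℂ L) (ψ η : Π x, L x) : Prop :=
  IsFormLaplacian (E := E) (bochnerForm D) ψ η

/-- `Δ^(0,•) ψ = η` for the holomorphic Laplacian `Δ^(0,•)`. -/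
def IsHolomorphicLaplacian (D : CovariantDerivative 𝓘(ℝ, E) ℂ L) (ψ η : Π x, L x) : Prop :=
  IsFormLaplacian (E := E) (holomorphicForm D) ψ η

/-- The form of `-½ (Δ^L - ρ)`, for a real-valued function `ρ`. -/
def shiftedForm (D : CovariantDerivative 𝓘(ℝ, E) ℂ L) (ρ : M → ℝ) (φ ψ : Π x, L x) : ℂ :=
  (1 / 2 : ℂ) * (bochnerForm D φ ψ + l2Inner E φ (fun x => (ρ x : ℂ) • ψ x))

end Laplacians

end KahlerBundle

end

/-!
On test sections the holomorphic form and half the Bochner form differ by a multiplication operator: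
pointwise they differ by a twisted term, and integrating it by parts leaves nothing but curvature.

*Pointwise.* An orthonormal basis of `T^(0,1)` has the form `Z̄_k = (E_k + i J E_k) / √2`, where
the `E_k` and `J E_k` together form a real orthonormal basis. Hence the trace over `T^(0,1)` is
half the Riemannian trace plus `i/2` times the twisted trace `∑ h(∇_e φ, ∇_{J e} ψ)`
(`holomorphicDensity_eq`).

*Integration by parts.* In a chart the twisted term has the coefficients `√det g · A`, where the
bivector `A = ∑ e ⊗ J e` is the inverse of the fundamental two-form. They are antisymmetric, and
they are divergence free because the two-form is closed and `√det g` is its Liouville density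
(`sum_fderiv_density_mul_inverse_eq_zero`, `sum_fderiv_chartDensity_mul_chartBivector`). For such
coefficients `∑ ∇_j (a_jk ∇_k u)` contains no derivatives of `u`: the symmetric second derivatives
cancel, and what remains is the contraction of `a` with the curvature (`divGrad_of_antisymm`). So
the twisted term is the multiplication by `ρ = -(i/2) ∑ K(e, J e)`
(`integral_twistedDensity_local`), which is the trace of the curvature over `T^(0,1)`
(`curvTrace_smul`). Here the connection enters through its expression `d + ∂ log ‖s‖²` in a
holomorphic frame `s`, to which compatibility with the metric and the holomorphic structure force
it (`cov_frame`); its curvature form `K` is purely imaginary and independent of the chart and the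
frame (`curvForm_re`, `curvForm_eq`).

*Globalization.* A partition of unity (`IsTestSection.induction`) reduces statements on test
sections to those with support in one chart and one trivialization. This gives the identity of the
forms on test sections (`holomorphicForm_eq_shiftedForm`), so the two forms have the same closure
and the same associated operator. It also gives that the Bochner form is `-⟨φ, η⟩` for a test
section `η` (`exists_bochnerForm_eq`).

*The domain of the Bochner Laplacian.* The holomorphic energy lies between zero and the Bochner
energy (`norm_holomorphicForm_self_le`). So if test sections `u_n` approximate `ψ` for the Bochner
form, they do so for the holomorphic form, and `∫ h(φ, ρ u_n) = ∫ h(ρ φ, u_n)` converges because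
`ρ φ` is square-integrable; passing to the limit in the identity of the forms gives the identity of
the Laplacians (`isHolomorphicLaplacian_of_isBochnerLaplacian`).
-/

set_option linter.unusedSectionVars false

noncomputable section

namespace KahlerBundle

/-! ### Traces and determinants -/

section LinearAlgebra

/-- The trace of a bilinear map over an orthonormal basis, computed in an arbitrary basis: the
metric contraction with the inverse of the Gram matrix. -/
lemma sum_orthonormalBasis_eq_sum_gram_inv {V F κ ι : Type*} [NormedAddCommGroup V]
    [InnerProductSpace ℝ V] [AddCommGroup F] [Module ℝ F] [Fintype κ] [Fintype ι] [DecidableEq ι]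
    (e : OrthonormalBasis κ ℝ V) (b : Module.Basis ι ℝ V) (B : V →ₗ[ℝ] V →ₗ[ℝ] F) :
    ∑ i, B (e i) (e i) = ∑ j, ∑ k, (Matrix.gram ℝ b)⁻¹ j k • B (b j) (b k) := by
  classical
  -- `P` is the matrix of the change of basis; the Gram matrix is `Pᵀ P`
  set P : Matrix κ ι ℝ := Matrix.of fun i j => inner ℝ (e i) (b j)
  have hG : P.transpose * P = Matrix.gram ℝ b := by
    ext j k
    simp only [Matrix.mul_apply, Matrix.transpose_apply, Matrix.gram_apply, P, Matrix.of_apply]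
    rw [← e.sum_inner_mul_inner (b j) (b k)]
    exact Finset.sum_congr rfl fun i _ => by rw [real_inner_comm]
  have hdet : IsUnit (Matrix.gram ℝ b).det :=
    (Matrix.posDef_gram_of_linearIndependent b.linearIndependent).det_pos.ne'.isUnit
  have hcard : Fintype.card ι = Fintype.card κ := by
    rw [← Module.finrank_eq_card_basis b, ← Module.finrank_eq_card_basis e.toBasis]
  have h1 : P * ((Matrix.gram ℝ b)⁻¹ * P.transpose) = 1 := by
    rw [← Matrix.mul_eq_one_comm_of_card_eq ι κ ℝ hcard, Matrix.mul_assoc, hG,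
      Matrix.nonsing_inv_mul _ hdet]
  have hb : ∀ j, b j = ∑ i, P i j • e i := fun j => (e.sum_repr' (b j)).symm
  have h2 : ∀ i l, ∑ j, ∑ k, P i j * ((Matrix.gram ℝ b)⁻¹ j k * P l k)
      = if i = l then 1 else 0 := by
    intro i l
    have := congrFun (congrFun h1 i) l
    simpa [Matrix.mul_apply, Finset.mul_sum, Matrix.one_apply] using this
  calc ∑ i, B (e i) (e i)
      = ∑ i, ∑ l, (∑ j, ∑ k, P i j * ((Matrix.gram ℝ b)⁻¹ j k * P l k)) • B (e i) (e l) := by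
        simp [h2]
    _ = ∑ j, ∑ k, ∑ i, ∑ l, (P i j * ((Matrix.gram ℝ b)⁻¹ j k * P l k)) • B (e i) (e l) := by
        simp only [Finset.sum_smul]
        rw [Finset.sum_congr rfl fun i _ => Finset.sum_comm, Finset.sum_comm]
        refine Finset.sum_congr rfl fun j _ => ?_
        rw [Finset.sum_congr rfl fun i _ => Finset.sum_comm, Finset.sum_comm]
    _ = _ := by
        refine Finset.sum_congr rfl fun j _ => Finset.sum_congr rfl fun k _ => ?_
        conv_rhs => rw [hb j, hb k]
        simp only [map_sum, LinearMap.sum_apply, map_smul, LinearMap.smul_apply, Finset.smul_sum,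
          smul_smul]
        rw [Finset.sum_comm]
        refine Finset.sum_congr rfl fun l _ => Finset.sum_congr rfl fun i _ => ?_
        congr 1; ring

/-- The trace of a bilinear map does not depend on the orthonormal basis. -/
lemma sum_orthonormalBasis_eq {V F κ ι : Type*} [NormedAddCommGroup V]
    [InnerProductSpace ℝ V] [AddCommGroup F] [Module ℝ F] [Fintype κ] [Fintype ι]
    (e : OrthonormalBasis κ ℝ V) (e' : OrthonormalBasis ι ℝ V) (B : V →ₗ[ℝ] V →ₗ[ℝ] F) :
    ∑ i, B (e i) (e i) = ∑ i, B (e' i) (e' i) := by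
  classical
  rw [sum_orthonormalBasis_eq_sum_gram_inv e e'.toBasis,
      sum_orthonormalBasis_eq_sum_gram_inv e' e'.toBasis]

variable {E : Type*} [NormedAddCommGroup E] [NormedSpace ℝ E] {ι : Type*} [Fintype ι]
    [DecidableEq ι]

/-- Jacobi's formula for the derivative of a determinant. -/
lemma hasFDerivAt_det {M : E → Matrix ι ι ℝ} {y : E}
    (hM : ∀ i j, DifferentiableAt ℝ (fun z => M z i j) y) :
    ∃ D : E →L[ℝ] ℝ, HasFDerivAt (fun z => (M z).det) D y ∧
      ∀ v, D v = ∑ i, ∑ j, (M y).adjugate j i * fderiv ℝ (fun z => M z i j) y v := by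
  let m : ContinuousMultilinearMap ℝ (fun _ : ι => ι → ℝ) ℝ :=
    { (Matrix.detRowAlternating : (ι → ℝ) [⋀^ι]→ₗ[ℝ] ℝ).toMultilinearMap with
      cont := by
        change Continuous fun M : ι → ι → ℝ => Matrix.det (M : Matrix ι ι ℝ)
        exact Continuous.matrix_det (A := fun M : ι → ι → ℝ => (M : Matrix ι ι ℝ)) continuous_id }
  have hm : ∀ A : ι → ι → ℝ, m A = Matrix.det (A : Matrix ι ι ℝ) := fun A => rfl
  have h1 : HasFDerivAt (fun z => (fun i j => M z i j : ι → ι → ℝ))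
      (ContinuousLinearMap.pi fun i => ContinuousLinearMap.pi fun j =>
        fderiv ℝ (fun z => M z i j) y) y :=
    hasFDerivAt_pi.2 fun i => hasFDerivAt_pi.2 fun j => (hM i j).hasFDerivAt
  have h2 : HasFDerivAt (fun z => (M z).det) _ y :=
    HasFDerivAt.comp (g := m) (f := fun z => (fun i j => M z i j : ι → ι → ℝ)) y
      (m.hasFDerivAt (fun i j => M y i j)) h1
  refine ⟨_, h2, fun v => ?_⟩
  simp only [ContinuousLinearMap.comp_apply, ContinuousMultilinearMap.linearDeriv_apply]
  refine Finset.sum_congr rfl fun i _ => ?_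
  rw [hm]
  change Matrix.det (Matrix.updateRow (M y) i _) = _
  rw [← Matrix.cramer_transpose_apply, Matrix.cramer_eq_adjugate_mulVec,
      ← Matrix.adjugate_transpose]
  rfl

/-- Liouville's theorem in coordinates: if the two-form `Ω` is closed, with inverse bivector `A`,
and if `s` is a constant multiple of the Liouville density `√det Ω`, expressed infinitesimally by
Jacobi's formula, then the columns of `s A` are divergence free. -/
lemma sum_fderiv_density_mul_inverse_eq_zero {A Ω : E → Matrix ι ι ℝ} {s : E → ℝ} {y : E}
    (b : ι → E)
    (hA : ∀ i j, DifferentiableAt ℝ (fun z => A z i j) y)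
    (hΩ : ∀ i j, DifferentiableAt ℝ (fun z => Ω z i j) y) (hs : DifferentiableAt ℝ s y)
    (hinv : ∀ᶠ z in 𝓝 y, A z * Ω z = 1)
    (hanti : ∀ᶠ z in 𝓝 y, ∀ i j, Ω z i j = - Ω z j i)
    (hclosed : ∀ i j k, fderiv ℝ (fun z => Ω z j k) y (b i) + fderiv ℝ (fun z => Ω z k i) y (b j)
      + fderiv ℝ (fun z => Ω z i j) y (b k) = 0)
    (hs' : ∀ v, fderiv ℝ s y v
      = 1 / 2 * s y * ∑ i, ∑ j, A y i j * fderiv ℝ (fun z => Ω z j i) y v) (k : ι) :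
    ∑ j, fderiv ℝ (fun z => s z * A z j k) y (b j) = 0 := by
  have hy : A y * Ω y = 1 := hinv.self_of_nhds
  have hy' : Ω y * A y = 1 := mul_eq_one_comm.1 hy
  have hΩt : (Ω y).transpose = - Ω y := by
    ext i j; simpa using hanti.self_of_nhds j i
  have hAt : (A y).transpose = - A y := by
    have h1 : (A y).transpose * Ω y = -1 := by
      have := congrArg Matrix.transpose hy'
      rw [Matrix.transpose_mul, hΩt] at this
      rw [← neg_inj, neg_neg, ← Matrix.transpose_one, ← this, Matrix.mul_neg]
    calc (A y).transpose = (A y).transpose * (Ω y * A y) := by rw [hy', mul_one]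
      _ = _ := by rw [← Matrix.mul_assoc, h1, neg_mul, one_mul]
  have hA' : ∀ i j, A y i j = - A y j i := fun i j => by
    have := congrFun (congrFun hAt j) i
    simpa using this
  have hdΩ : ∀ i j v, fderiv ℝ (fun z => Ω z i j) y v = - fderiv ℝ (fun z => Ω z j i) y v := by
    intro i j v
    have : (fun z => Ω z i j) =ᶠ[𝓝 y] fun z => - Ω z j i := hanti.mono fun z hz => hz i j
    rw [this.fderiv_eq, fderiv_fun_neg]; rfl
  -- differentiate `A Ω = 1`
  have hprod : ∀ i k v, ∑ l, (fderiv ℝ (fun z => A z i l) y v * Ω y l k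
      + A y i l * fderiv ℝ (fun z => Ω z l k) y v) = 0 := by
    intro i k v
    have h1 : HasFDerivAt (fun z => ∑ l, A z i l * Ω z l k)
        (∑ l, (A y i l • fderiv ℝ (fun z => Ω z l k) y + Ω y l k • fderiv ℝ (fun z => A z i l) y))
            y :=
      HasFDerivAt.fun_sum fun l _ => (hA i l).hasFDerivAt.mul (hΩ l k).hasFDerivAt
    have h2 : (fun z => ∑ l, A z i l * Ω z l k) =ᶠ[𝓝 y] fun _ => (1 : Matrix ι ι ℝ) i k :=
      hinv.mono fun z hz => by simpa [Matrix.mul_apply] using congrFun (congrFun hz i) k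
    have h3 := h1.fderiv
    rw [h2.fderiv_eq] at h3
    have h4 := congrArg (fun L : E →L[ℝ] ℝ => L v) h3
    simp only [fderiv_fun_const, Pi.zero_apply, zero_apply,
      sum_apply, add_apply, smul_apply,
      smul_eq_mul] at h4
    rw [h4]
    exact Finset.sum_congr rfl fun l _ => by ring
  have hdA : ∀ i k v, fderiv ℝ (fun z => A z i k) y v
      = - ∑ m, (∑ a, A y i a * fderiv ℝ (fun z => Ω z a m) y v) * A y m k := by
    intro i k v
    have h1 : ∀ m, ∑ l, fderiv ℝ (fun z => A z i l) y v * Ω y l m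
        = - ∑ l, A y i l * fderiv ℝ (fun z => Ω z l m) y v := fun m => by
      have := hprod i m v
      rw [Finset.sum_add_distrib] at this
      linarith
    have h2 : ∀ l, ∑ m, Ω y l m * A y m k = if l = k then 1 else 0 := fun l => by
      simpa [Matrix.mul_apply, Matrix.one_apply] using congrFun (congrFun hy' l) k
    calc fderiv ℝ (fun z => A z i k) y v
        = ∑ l, fderiv ℝ (fun z => A z i l) y v * ∑ m, Ω y l m * A y m k := by simp [h2]
      _ = ∑ m, (∑ l, fderiv ℝ (fun z => A z i l) y v * Ω y l m) * A y m k := by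
        simp only [Finset.mul_sum, Finset.sum_mul]
        rw [Finset.sum_comm]
        exact Finset.sum_congr rfl fun m _ => Finset.sum_congr rfl fun l _ => by ring
      _ = _ := by
        rw [← Finset.sum_neg_distrib]
        exact Finset.sum_congr rfl fun m _ => by rw [h1]; ring
  -- the contraction of the closedness relation with `A`
  have hcontr : ∀ m, ∑ j, ∑ a, A y j a * fderiv ℝ (fun z => Ω z a m) y (b j)
      = 1 / 2 * ∑ i, ∑ j, A y i j * fderiv ℝ (fun z => Ω z j i) y (b m) := by
    intro m
    have h1 : ∑ j, ∑ a, A y j a * fderiv ℝ (fun z => Ω z a m) y (b j)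
        = ∑ j, ∑ a, A y j a * fderiv ℝ (fun z => Ω z m j) y (b a) := by
      rw [Finset.sum_comm]
      refine Finset.sum_congr rfl fun j _ => Finset.sum_congr rfl fun a _ => ?_
      rw [hA' a j, hdΩ j m]; ring
    have h2 : ∑ j, ∑ a, A y j a * fderiv ℝ (fun z => Ω z a m) y (b j)
        + ∑ j, ∑ a, A y j a * fderiv ℝ (fun z => Ω z m j) y (b a)
        = ∑ i, ∑ j, A y i j * fderiv ℝ (fun z => Ω z j i) y (b m) := by
      rw [← Finset.sum_add_distrib]
      refine Finset.sum_congr rfl fun j _ => ?_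
      rw [← Finset.sum_add_distrib]
      refine Finset.sum_congr rfl fun a _ => ?_
      have := hclosed j a m
      rw [hdΩ a j (b m)]
      linear_combination A y j a * this
    linarith
  calc ∑ j, fderiv ℝ (fun z => s z * A z j k) y (b j)
      = ∑ j, (s y * fderiv ℝ (fun z => A z j k) y (b j) + A y j k * fderiv ℝ s y (b j)) := by
        refine Finset.sum_congr rfl fun j _ => ?_
        rw [fderiv_fun_mul hs (hA j k)]; simp
    _ = ∑ m, A y m k * fderiv ℝ s y (b m)
        - s y * ∑ m, (∑ j, ∑ a, A y j a * fderiv ℝ (fun z => Ω z a m) y (b j)) * A y m k := by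
        rw [Finset.sum_add_distrib, ← Finset.mul_sum]
        simp only [hdA, Finset.sum_neg_distrib, Finset.sum_mul]
        rw [Finset.sum_comm]; ring
    _ = 0 := by
        simp only [hcontr, hs', Finset.mul_sum (a := s y), ← Finset.sum_sub_distrib]
        exact Finset.sum_eq_zero fun m _ => by ring

end LinearAlgebra

/-! ### Integration by parts in a vector space -/

section Calculus

variable {E : Type*} [NormedAddCommGroup E] [NormedSpace ℝ E]

/-- A smooth function on an open set vanishing off a compact subset extends by zero. -/
lemma contDiff_indicator_of_eq_zero {F : Type*} [NormedAddCommGroup F] [NormedSpace ℝ F]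
    {n : WithTop ℕ∞} {W K : Set E} (hW : IsOpen W) (hK : IsCompact K)
    (hKW : K ⊆ W) {g : E → F} (hg : ContDiffOn ℝ n g W) (h0 : ∀ y ∈ W, y ∉ K → g y = 0) :
    ContDiff ℝ n (W.indicator g) := by
  refine contDiff_iff_contDiffAt.2 fun y => ?_
  by_cases hy : y ∈ K
  · refine (hg.contDiffAt (hW.mem_nhds (hKW hy))).congr_of_eventuallyEq ?_
    filter_upwards [hW.mem_nhds (hKW hy)] with z hz using Set.indicator_of_mem hz g
  · refine (contDiffAt_const (c := (0 : F))).congr_of_eventuallyEq ?_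
    filter_upwards [hK.isClosed.isOpen_compl.mem_nhds hy] with z hz
    by_cases hzW : z ∈ W
    · rw [Set.indicator_of_mem hzW, h0 z hzW hz]
    · exact Set.indicator_of_notMem hzW g

lemma fderiv_eq_zero_of_eq_zero {W K : Set E} (hW : IsOpen W) (hK : IsCompact K)
    {g : E → ℂ} (h0 : ∀ y ∈ W, y ∉ K → g y = 0) : ∀ y ∈ W, y ∉ K → fderiv ℝ g y = 0 := by
  intro y hy hyK
  have : g =ᶠ[𝓝 y] fun _ => (0 : ℂ) := by
    filter_upwards [hW.mem_nhds hy, hK.isClosed.isOpen_compl.mem_nhds hyK] with z hz hz'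
      using h0 z hz hz'
  rw [this.fderiv_eq]; simp

variable [MeasurableSpace E] [BorelSpace E] {μ : Measure E}

lemma integrableOn_of_continuousOn_of_eq_zero [IsFiniteMeasureOnCompacts μ] {W K : Set E}
    (hW : IsOpen W) (hK : IsCompact K)
    (hKW : K ⊆ W) {g : E → ℂ} (hg : ContinuousOn g W) (h0 : ∀ y ∈ W, y ∉ K → g y = 0) :
    IntegrableOn g W μ := by
  have h1 : ContDiff ℝ 0 (W.indicator g) :=
    contDiff_indicator_of_eq_zero hW hK hKW (contDiffOn_zero.2 hg) h0
  have h2 : HasCompactSupport (W.indicator g) := by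
    refine HasCompactSupport.intro hK fun y hy => ?_
    by_cases hyW : y ∈ W
    · rw [Set.indicator_of_mem hyW, h0 y hyW hy]
    · exact Set.indicator_of_notMem hyW g
  exact (integrable_indicator_iff hW.measurableSet).1
    (h1.continuous.integrable_of_hasCompactSupport h2)

/-- The divergence theorem for a compactly supported function. -/
lemma setIntegral_fderiv_eq_zero [FiniteDimensional ℝ E] [μ.IsAddHaarMeasure] {W K : Set E}
    (hW : IsOpen W) (hK : IsCompact K)
    (hKW : K ⊆ W) {g : E → ℂ} (hg : ContDiffOn ℝ 1 g W) (h0 : ∀ y ∈ W, y ∉ K → g y = 0) (v : E) :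
    IntegrableOn (fun y => fderiv ℝ g y v) W μ ∧ ∫ y in W, fderiv ℝ g y v ∂μ = 0 := by
  have h1 : ContDiff ℝ 1 (W.indicator g) := contDiff_indicator_of_eq_zero hW hK hKW hg h0
  have h2 : HasCompactSupport (W.indicator g) := by
    refine HasCompactSupport.intro hK fun y hy => ?_
    by_cases hyW : y ∈ W
    · rw [Set.indicator_of_mem hyW, h0 y hyW hy]
    · exact Set.indicator_of_notMem hyW g
  have hfd : ∀ y, fderiv ℝ (W.indicator g) y v = W.indicator (fun y => fderiv ℝ g y v) y := by
    intro y
    by_cases hy : y ∈ W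
    · rw [Set.indicator_of_mem hy]
      congr 1
      refine Filter.EventuallyEq.fderiv_eq ?_
      filter_upwards [hW.mem_nhds hy] with z hz using Set.indicator_of_mem hz g
    · rw [Set.indicator_of_notMem hy]
      have : W.indicator g =ᶠ[𝓝 y] fun _ => (0 : ℂ) := by
        filter_upwards [hK.isClosed.isOpen_compl.mem_nhds fun h => hy (hKW h)] with z hz
        by_cases hzW : z ∈ W
        · rw [Set.indicator_of_mem hzW, h0 z hzW hz]
        · exact Set.indicator_of_notMem hzW g
      rw [this.fderiv_eq]; simp
  have h3 : Integrable (fun y => fderiv ℝ (W.indicator g) y v) μ := by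
    refine Continuous.integrable_of_hasCompactSupport ?_ (h2.fderiv_apply ℝ v)
    exact (h1.continuous_fderiv one_ne_zero).clm_apply continuous_const
  have h4 := integral_mul_fderiv_eq_neg_fderiv_mul_of_integrable (μ := μ) (𝕜 := ℂ)
    (f := fun _ => (1 : ℂ)) (g := W.indicator g) (v := v) (by simp) (by simpa using h3)
    (by simpa using h1.continuous.integrable_of_hasCompactSupport h2)
    (fun _ _ => differentiableAt_const _) (fun x _ => h1.differentiable one_ne_zero x)
  simp only [hfd] at h3 h4
  refine ⟨(integrable_indicator_iff hW.measurableSet).1 h3, ?_⟩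
  rw [← integral_indicator hW.measurableSet]
  simpa using h4

end Calculus

section FlatConnection

variable {E : Type*} [NormedAddCommGroup E] [NormedSpace ℝ E]

/-- The covariant derivative `df + θ f` of a function, i.e. of a section of a line bundle in a local
frame with connection form `θ`. -/
def covDeriv (θ : E → E →L[ℝ] ℂ) (f : E → ℂ) (y v : E) : ℂ := fderiv ℝ f y v + θ y v * f y

lemma contDiffOn_covDeriv {θ : E → E →L[ℝ] ℂ} {f : E → ℂ} {W : Set E} (hW : IsOpen W)
    (hθ : ContDiffOn ℝ ∞ θ W) (hf : ContDiffOn ℝ ∞ f W) (v : E) :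
    ContDiffOn ℝ ∞ (fun y => covDeriv θ f y v) W :=
  ((hf.fderiv_of_isOpen hW (by simp)).clm_apply contDiffOn_const).add
    ((hθ.clm_apply contDiffOn_const).mul hf)

variable {ι : Type*} [Fintype ι]

/-- The components `∑ k, a j k ∇_k u` of a gradient-like field. -/
def gradComp (θ : E → E →L[ℝ] ℂ) (b : ι → E) (a : ι → ι → E → ℝ) (u : E → ℂ) (j : ι) (y : E) : ℂ :=
  ∑ k, (a j k y : ℂ) * covDeriv θ u y (b k)

/-- The second order operator `∑ j k, ∇_j (a j k ∇_k u)`. -/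
def divGrad (θ : E → E →L[ℝ] ℂ) (b : ι → E) (a : ι → ι → E → ℝ) (u : E → ℂ) (y : E) : ℂ :=
  ∑ j, covDeriv θ (gradComp θ b a u j) y (b j)

variable {θ : E → E →L[ℝ] ℂ} {b : ι → E} {a : ι → ι → E → ℝ} {u f : E → ℂ} {H : E → ℝ} {W K : Set E}

lemma contDiffOn_ofReal {g : E → ℝ} (hg : ContDiffOn ℝ ∞ g W) :
    ContDiffOn ℝ ∞ (fun y => (g y : ℂ)) W :=
  Complex.ofRealCLM.contDiff.comp_contDiffOn hg

lemma contDiffOn_gradComp (hW : IsOpen W) (hθ : ContDiffOn ℝ ∞ θ W)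
    (ha : ∀ j k, ContDiffOn ℝ ∞ (a j k) W) (hu : ContDiffOn ℝ ∞ u W) (j : ι) :
    ContDiffOn ℝ ∞ (gradComp θ b a u j) W :=
  ContDiffOn.sum fun k _ => (contDiffOn_ofReal (ha j k)).mul (contDiffOn_covDeriv hW hθ hu (b k))

lemma contDiffOn_divGrad (hW : IsOpen W) (hθ : ContDiffOn ℝ ∞ θ W)
    (ha : ∀ j k, ContDiffOn ℝ ∞ (a j k) W) (hu : ContDiffOn ℝ ∞ u W) :
    ContDiffOn ℝ ∞ (divGrad θ b a u) W :=
  ContDiffOn.sum fun j _ => contDiffOn_covDeriv hW hθ (contDiffOn_gradComp hW hθ ha hu j) (b j)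

lemma covDeriv_eq_zero (hW : IsOpen W) (hK : IsCompact K) (h0 : ∀ y ∈ W, y ∉ K → u y = 0) (v : E) :
    ∀ y ∈ W, y ∉ K → covDeriv θ u y v = 0 := by
  intro y hy hyK
  simp [covDeriv, h0 y hy hyK, fderiv_eq_zero_of_eq_zero hW hK h0 y hy hyK]

lemma gradComp_eq_zero (hW : IsOpen W) (hK : IsCompact K) (h0 : ∀ y ∈ W, y ∉ K → u y = 0) (j : ι) :
    ∀ y ∈ W, y ∉ K → gradComp θ b a u j y = 0 := by
  intro y hy hyK
  exact Finset.sum_eq_zero fun k _ => by rw [covDeriv_eq_zero hW hK h0 _ y hy hyK, mul_zero]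

lemma divGrad_eq_zero (hW : IsOpen W) (hK : IsCompact K) (h0 : ∀ y ∈ W, y ∉ K → u y = 0) :
    ∀ y ∈ W, y ∉ K → divGrad θ b a u y = 0 := by
  intro y hy hyK
  exact Finset.sum_eq_zero fun j _ => covDeriv_eq_zero hW hK (gradComp_eq_zero hW hK h0 j)
      _ y hy hyK

lemma two_le_infty : (2 : WithTop ℕ∞) ≤ ∞ := WithTop.coe_le_coe.2 le_top

/-- If the coefficients `a` are antisymmetric and divergence free, `∑ ∇_j a_jk ∇_k` is the
multiplication with the contraction of `a` with the curvature `dθ`. -/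
lemma divGrad_of_antisymm (hW : IsOpen W) (hθ : ContDiffOn ℝ ∞ θ W)
    (ha : ∀ j k, ContDiffOn ℝ ∞ (a j k) W) (hu : ContDiffOn ℝ ∞ u W)
    (hanti : ∀ y ∈ W, ∀ j k, a j k y = - a k j y)
    (hdiv : ∀ y ∈ W, ∀ k, ∑ j, fderiv ℝ (a j k) y (b j) = 0) {y : E} (hy : y ∈ W) :
    divGrad θ b a u y
      = (1 / 2) * (∑ j, ∑ k, (a j k y : ℂ) *
          (fderiv ℝ θ y (b j) (b k) - fderiv ℝ θ y (b k) (b j))) * u y := by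
  have hWy := hW.mem_nhds hy
  have hθy : DifferentiableAt ℝ θ y := (hθ.contDiffAt hWy).differentiableAt (by simp)
  have huy : DifferentiableAt ℝ u y := (hu.contDiffAt hWy).differentiableAt (by simp)
  have huy' : DifferentiableAt ℝ (fderiv ℝ u) y :=
    ((hu.fderiv_of_isOpen hW (m := ∞) (by simp)).contDiffAt hWy).differentiableAt (by simp)
  have hsymm : ∀ v w, fderiv ℝ (fderiv ℝ u) y v w = fderiv ℝ (fderiv ℝ u) y w v :=
    fun v w => ((hu.contDiffAt hWy).isSymmSndFDerivAt
      (by simpa using two_le_infty)).eq v w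
  have hcov : ∀ v, HasFDerivAt (fun z => covDeriv θ u z v)
      ((fderiv ℝ (fderiv ℝ u) y).flip v +
        (θ y v • fderiv ℝ u y + u y • (fderiv ℝ θ y).flip v)) y := by
    intro v
    have h1 := huy'.hasFDerivAt.clm_apply (hasFDerivAt_const v y)
    have h2 := (hθy.hasFDerivAt.clm_apply (hasFDerivAt_const v y)).mul huy.hasFDerivAt
    simpa [covDeriv] using! h1.add h2
  have hcov' : ∀ v w, fderiv ℝ (fun z => covDeriv θ u z v) y w = fderiv ℝ (fderiv ℝ u) y w v +
        (θ y v * fderiv ℝ u y w + u y * fderiv ℝ θ y w v) := by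
    intro v w
    rw [(hcov v).fderiv]; simp
  have hgrad : ∀ j, fderiv ℝ (gradComp θ b a u j) y (b j) = ∑ k, ((fderiv ℝ (a j k) y (b j) : ℂ)
      * covDeriv θ u y (b k) + a j k y * fderiv ℝ (fun z => covDeriv θ u z (b k)) y (b j)) := by
    intro j
    have h1 : HasFDerivAt (gradComp θ b a u j) (∑ k, ((a j k y : ℂ) •
        fderiv ℝ (fun z => covDeriv θ u z (b k)) y + covDeriv θ u y (b k) •
          (Complex.ofRealCLM.comp (fderiv ℝ (a j k) y)))) y := by
      refine HasFDerivAt.fun_sum fun k _ => ?_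
      have h2 : HasFDerivAt (fun z => (a j k z : ℂ)) (Complex.ofRealCLM.comp (fderiv ℝ (a j k) y))
          y :=
        Complex.ofRealCLM.hasFDerivAt.comp y
          (((ha j k).contDiffAt hWy).differentiableAt (by simp)).hasFDerivAt
      exact h2.mul (hcov (b k)).differentiableAt.hasFDerivAt
    rw [h1.fderiv]
    simp only [sum_apply, add_apply, smul_apply, smul_eq_mul, ContinuousLinearMap.comp_apply,
      Complex.ofRealCLM_apply]
    exact Finset.sum_congr rfl fun k _ => by ring
  -- the symmetric part of the second covariant derivative
  set S : ι → ι → ℂ := fun j k => fderiv ℝ (fderiv ℝ u) y (b j) (b k)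
    + θ y (b k) * fderiv ℝ u y (b j) + θ y (b j) * fderiv ℝ u y (b k)
    + θ y (b j) * θ y (b k) * u y
  have hS : ∑ j, ∑ k, (a j k y : ℂ) * S j k = 0 := by
    have h1 : ∑ j, ∑ k, (a j k y : ℂ) * S j k = - ∑ j, ∑ k, (a j k y : ℂ) * S j k := by
      conv_lhs => rw [Finset.sum_comm]
      rw [← Finset.sum_neg_distrib]
      refine Finset.sum_congr rfl fun j _ => ?_
      rw [← Finset.sum_neg_distrib]
      refine Finset.sum_congr rfl fun k _ => ?_
      rw [hanti y hy k j]
      simp only [S, hsymm (b k) (b j)]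
      push_cast; ring
    have : (2 : ℂ) * ∑ j, ∑ k, (a j k y : ℂ) * S j k = 0 := by linear_combination h1
    simpa using this
  have hA : ∑ j, ∑ k, (a j k y : ℂ) * fderiv ℝ θ y (b k) (b j)
      = - ∑ j, ∑ k, (a j k y : ℂ) * fderiv ℝ θ y (b j) (b k) := by
    rw [Finset.sum_comm, ← Finset.sum_neg_distrib]
    refine Finset.sum_congr rfl fun j _ => ?_
    rw [← Finset.sum_neg_distrib]
    refine Finset.sum_congr rfl fun k _ => ?_
    rw [hanti y hy k j]
    push_cast; ring
  have hD : ∑ j, ∑ k, (fderiv ℝ (a j k) y (b j) : ℂ) * covDeriv θ u y (b k) = 0 := by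
    rw [Finset.sum_comm]
    refine Finset.sum_eq_zero fun k _ => ?_
    rw [← Finset.sum_mul, ← Complex.ofReal_sum, hdiv y hy k]
    simp
  calc divGrad θ b a u y
      = ∑ j, ∑ k, ((fderiv ℝ (a j k) y (b j) : ℂ) * covDeriv θ u y (b k)
          + (a j k y * S j k + a j k y * fderiv ℝ θ y (b j) (b k) * u y)) := by
        refine Finset.sum_congr rfl fun j _ => ?_
        rw [covDeriv, hgrad, gradComp, Finset.mul_sum, ← Finset.sum_add_distrib]
        refine Finset.sum_congr rfl fun k _ => ?_
        rw [hcov']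
        simp only [S, covDeriv]
        ring
    _ = (∑ j, ∑ k, (a j k y : ℂ) * fderiv ℝ θ y (b j) (b k)) * u y := by
        simp only [Finset.sum_add_distrib, hD, hS, Finset.sum_mul, zero_add]
    _ = _ := by
        simp only [mul_sub, Finset.sum_sub_distrib, hA]
        ring

variable [FiniteDimensional ℝ E] [MeasurableSpace E] [BorelSpace E] {μ : Measure E}
  [μ.IsAddHaarMeasure]

/-- Integration by parts for the unitary connection `d + θ` of the metric `H`. -/
lemma setIntegral_covDeriv_mul_covDeriv (hW : IsOpen W) (hK : IsCompact K) (hKW : K ⊆ W)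
    (hθ : ContDiffOn ℝ ∞ θ W) (ha : ∀ j k, ContDiffOn ℝ ∞ (a j k) W) (hu : ContDiffOn ℝ ∞ u W)
    (hf : ContDiffOn ℝ ∞ f W) (hH : ContDiffOn ℝ ∞ H W)
    (hθH : ∀ y ∈ W, ∀ v, (fderiv ℝ H y v : ℂ) = H y * (star (θ y v) + θ y v))
    (h0 : ∀ y ∈ W, y ∉ K → u y = 0) :
    ∫ y in W, (∑ j, ∑ k, (a j k y : ℂ) * (star (covDeriv θ f y (b j)) * covDeriv θ u y (b k)))
        * H y ∂μ
      = - ∫ y in W, star (f y) * divGrad θ b a u y * H y ∂μ := by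
  have hstar : ∀ {g : E → ℂ}, ContDiffOn ℝ ∞ g W → ContDiffOn ℝ ∞ (fun y => star (g y)) W :=
    fun {g} hg => (starL' ℝ (A := ℂ)).contDiff.comp_contDiffOn hg
  have hHc := contDiffOn_ofReal hH
  have hw := fun j => contDiffOn_gradComp (b := b) hW hθ ha hu j
  -- the vector field with components `F j` has the sum of the two integrands as its divergence
  set F : ι → E → ℂ := fun j y => star (f y) * (H y : ℂ) * gradComp θ b a u j y
  have hF : ∀ j, ContDiffOn ℝ ∞ (F j) W := fun j => ((hstar hf).mul hHc).mul (hw j)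
  have hF0 : ∀ j, ∀ y ∈ W, y ∉ K → F j y = 0 := fun j y hy hyK => by
    simp only [F, gradComp_eq_zero hW hK h0 j y hy hyK, mul_zero]
  have hint := fun j => setIntegral_fderiv_eq_zero (μ := μ) hW hK hKW ((hF j).of_le (by simp))
      (hF0 j) (b j)
  have hpt : ∀ y ∈ W, ∑ j, fderiv ℝ (F j) y (b j)
      = (∑ j, ∑ k, (a j k y : ℂ) * (star (covDeriv θ f y (b j)) * covDeriv θ u y (b k))) * H y
        + star (f y) * divGrad θ b a u y * H y := by
    intro y hy
    have hWy := hW.mem_nhds hy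
    simp only [divGrad, Finset.mul_sum, Finset.sum_mul]
    rw [← Finset.sum_add_distrib]
    refine Finset.sum_congr rfl fun j _ => ?_
    have d1 : HasFDerivAt (fun z => star (f z))
        ((starL' ℝ (A := ℂ) : ℂ →L[ℝ] ℂ).comp (fderiv ℝ f y)) y :=
      (starL' ℝ (A := ℂ)).hasFDerivAt.comp y
        ((hf.contDiffAt hWy).differentiableAt (by simp)).hasFDerivAt
    have d2 : HasFDerivAt (fun z => (H z : ℂ)) (Complex.ofRealCLM.comp (fderiv ℝ H y)) y :=
      Complex.ofRealCLM.hasFDerivAt.comp y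
        ((hH.contDiffAt hWy).differentiableAt (by simp)).hasFDerivAt
    have d3 := (((hw j).contDiffAt hWy).differentiableAt (by simp)).hasFDerivAt
    rw [show fderiv ℝ (F j) y = _ from ((d1.mul d2).mul d3).fderiv]
    simp only [add_apply, smul_apply, smul_eq_mul, ContinuousLinearMap.comp_apply,
      Complex.ofRealCLM_apply, hθH y hy, smul_add]
    have hg : gradComp θ b a u j y = ∑ k, (a j k y : ℂ) * covDeriv θ u y (b k) := rfl
    have e1 : (starL' ℝ (A := ℂ) : ℂ →L[ℝ] ℂ) (fderiv ℝ f y (b j))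
        = star (fderiv ℝ f y (b j)) := rfl
    have e2 : ∑ k, (a j k y : ℂ) * (star (covDeriv θ f y (b j)) * covDeriv θ u y (b k)) * (H y : ℂ)
        = star (covDeriv θ f y (b j)) * H y * gradComp θ b a u j y := by
      rw [hg, Finset.mul_sum]
      exact Finset.sum_congr rfl fun k _ => by ring
    rw [e1, e2]
    simp only [Pi.mul_apply, covDeriv, star_add, star_mul]
    ring
  have hcont : ContinuousOn (fun y => star (f y) * divGrad θ b a u y * H y) W :=
    (((hstar hf).mul (contDiffOn_divGrad hW hθ ha hu)).mul hHc).continuousOn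
  have hint2 : IntegrableOn (fun y => star (f y) * divGrad θ b a u y * H y) W μ :=
    integrableOn_of_continuousOn_of_eq_zero hW hK hKW hcont fun y hy hyK => by
      rw [divGrad_eq_zero hW hK h0 y hy hyK]; simp
  have h1 : ∫ y in W, ∑ j, fderiv ℝ (F j) y (b j) ∂μ = 0 := by
    rw [integral_finsetSum _ fun j _ => (hint j).1]
    exact Finset.sum_eq_zero fun j _ => (hint j).2
  have hint3 : IntegrableOn (fun y => ∑ j, fderiv ℝ (F j) y (b j)) W μ :=
    integrable_finsetSum _ fun j _ => (hint j).1
  rw [← zero_sub, ← h1, ← integral_sub hint3 hint2]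
  refine setIntegral_congr_fun hW.measurableSet fun y hy => ?_
  simp only [hpt y hy]
  ring

end FlatConnection

/-! ### Coordinate fields -/

section Charts

variable {E : Type*} [NormedAddCommGroup E] [NormedSpace ℂ E]
  {M : Type*} [TopologicalSpace M] [ChartedSpace E M]

/-- The constant vector field on a vector space. -/
def constField (v : E) (y : E) : TangentSpace 𝓘(ℝ, E) y := v

/-- The vector field on the domain of the chart `e` that is constant, equal to `v`, in this
chart. -/
def coordField (e : OpenPartialHomeomorph M E) (v : E) (x : M) : TangentSpace 𝓘(ℝ, E) x :=
  mpullback 𝓘(ℝ, E) 𝓘(ℝ, E) e (constField v) x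

/-- The derivative of a chart, with values in the model space. -/
def chartDeriv (e : OpenPartialHomeomorph M E) (x : M) : TangentSpace 𝓘(ℝ, E) x →L[ℝ] E :=
  mfderiv 𝓘(ℝ, E) 𝓘(ℝ, E) e x

variable [IsManifold 𝓘(ℂ, E) ω M] {e : OpenPartialHomeomorph M E} (he : e ∈ atlas E M)
include he

lemma contMDiffOn_chart : ContMDiffOn 𝓘(ℝ, E) 𝓘(ℝ, E) ∞ e e.source :=
  contMDiffOn_of_mem_maximalAtlas (IsManifold.subset_maximalAtlas he)

lemma contMDiffOn_chart_symm : ContMDiffOn 𝓘(ℝ, E) 𝓘(ℝ, E) ∞ e.symm e.target :=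
  contMDiffOn_symm_of_mem_maximalAtlas (IsManifold.subset_maximalAtlas he)

lemma contMDiffAt_chart_symm {y : E} (hy : y ∈ e.target) :
    ContMDiffAt 𝓘(ℝ, E) 𝓘(ℝ, E) ∞ e.symm y :=
  (contMDiffOn_chart_symm he).contMDiffAt (e.open_target.mem_nhds hy)

lemma contMDiffAt_chart {x : M} (hx : x ∈ e.source) :
    ContMDiffAt 𝓘(ℝ, E) 𝓘(ℝ, E) ∞ e x :=
  (contMDiffOn_chart he).contMDiffAt (e.open_source.mem_nhds hx)

lemma mdifferentiable_chart : e.MDifferentiable 𝓘(ℝ, E) 𝓘(ℝ, E) :=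
  have : IsManifold 𝓘(ℝ, E) 1 M := IsManifold.of_le (n := ∞) (by simp)
  mdifferentiable_of_mem_atlas he

lemma isInvertible_mfderiv_chart {x : M} (hx : x ∈ e.source) :
    (mfderiv 𝓘(ℝ, E) 𝓘(ℝ, E) e x).IsInvertible :=
  ⟨(mdifferentiable_chart he).mfderiv hx, rfl⟩

lemma isInvertible_mfderiv_chart_symm {y : E} (hy : y ∈ e.target) :
    (mfderiv 𝓘(ℝ, E) 𝓘(ℝ, E) e.symm y).IsInvertible :=
  ⟨(mdifferentiable_chart he).symm.mfderiv (x := y) hy, rfl⟩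

/-- The coordinate frame as a linear equivalence of the model space with the tangent space. -/
def coordEquiv {x : M} (hx : x ∈ e.source) : E ≃L[ℝ] TangentSpace 𝓘(ℝ, E) x :=
  ((mdifferentiable_chart he).mfderiv hx).symm

lemma coordEquiv_symm_apply {x : M} (hx : x ∈ e.source) (w : TangentSpace 𝓘(ℝ, E) x) :
    (coordEquiv he hx).symm w = chartDeriv e x w := rfl

lemma coordEquiv_apply {x : M} (hx : x ∈ e.source) (v : E) :
    coordEquiv he hx v = coordField e v x := by
  have h : mfderiv 𝓘(ℝ, E) 𝓘(ℝ, E) e x = ((mdifferentiable_chart he).mfderiv hx :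
      TangentSpace 𝓘(ℝ, E) x →L[ℝ] TangentSpace 𝓘(ℝ, E) (e x)) := rfl
  have h2 : (mfderiv 𝓘(ℝ, E) 𝓘(ℝ, E) e x).inverse = (((mdifferentiable_chart he).mfderiv hx).symm :
      TangentSpace 𝓘(ℝ, E) (e x) →L[ℝ] TangentSpace 𝓘(ℝ, E) x) := by
    rw [h, ContinuousLinearMap.inverse_equiv]
  exact (congrArg (fun L : TangentSpace 𝓘(ℝ, E) (e x) →L[ℝ] TangentSpace 𝓘(ℝ, E) x => L v) h2).symm

lemma chartDeriv_coordField {x : M} (hx : x ∈ e.source) (v : E) :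
    chartDeriv e x (coordField e v x) = v := by
  rw [← coordEquiv_apply he hx, ← coordEquiv_symm_apply he hx,
      ContinuousLinearEquiv.symm_apply_apply]

lemma coordField_chartDeriv {x : M} (hx : x ∈ e.source) (w : TangentSpace 𝓘(ℝ, E) x) :
    coordField e (chartDeriv e x w) x = w := by
  rw [← coordEquiv_apply he hx, ← coordEquiv_symm_apply he hx,
      ContinuousLinearEquiv.apply_symm_apply]

lemma coordField_symm {y : E} (hy : y ∈ e.target) (v : E) :
    coordField e v (e.symm y) = mfderiv 𝓘(ℝ, E) 𝓘(ℝ, E) e.symm y v := by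
  have h1 := (mdifferentiable_chart he).comp_symm_deriv hy
  have h2 : chartDeriv e (e.symm y) (mfderiv 𝓘(ℝ, E) 𝓘(ℝ, E) e.symm y v) = v :=
    congrArg (fun L : TangentSpace 𝓘(ℝ, E) y →L[ℝ] TangentSpace 𝓘(ℝ, E) y => L v) h1
  conv_lhs => rw [← h2]
  exact coordField_chartDeriv he (e.map_target hy) _

/-- Charts are holomorphic: their derivatives intertwine `J` with the multiplication by `i`. -/
lemma chartDeriv_J {x : M} (hx : x ∈ e.source) (w : TangentSpace 𝓘(ℝ, E) x) :
    chartDeriv e x (J x w) = Complex.I • chartDeriv e x w := by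
  have : IsManifold 𝓘(ℂ, E) 1 M := IsManifold.of_le (n := ω) (by simp)
  have hC : MDifferentiableAt 𝓘(ℂ, E) 𝓘(ℂ, E) e x :=
    (mdifferentiable_of_mem_atlas he).mdifferentiableAt hx
  have hR := (mdifferentiable_chart he).mdifferentiableAt hx
  have h1 := ((mdifferentiableAt_iff _ _).1 hC).2
  rw [modelWithCornersSelf_coe, Set.range_id, differentiableWithinAt_univ] at h1
  have h3 : chartDeriv e x =
    (fderiv ℂ (writtenInExtChartAt 𝓘(ℂ, E) 𝓘(ℂ, E) x e)
      (extChartAt 𝓘(ℂ, E) x x)).restrictScalars ℝ := by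
    refine (MDifferentiableAt.mfderiv hR).trans ?_
    rw [modelWithCornersSelf_coe, Set.range_id, fderivWithin_univ]
    exact (h1.hasFDerivAt.restrictScalars ℝ).fderiv
  rw [h3]
  exact (fderiv ℂ (writtenInExtChartAt 𝓘(ℂ, E) 𝓘(ℂ, E) x e)
      (extChartAt 𝓘(ℂ, E) x x)).map_smul Complex.I w

lemma J_coordField {x : M} (hx : x ∈ e.source) (v : E) :
    J x (coordField e v x) = coordField e (Complex.I • v) x := by
  rw [← coordField_chartDeriv he hx (J x (coordField e v x)), chartDeriv_J he hx,
    chartDeriv_coordField he hx]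

lemma smoothFieldAt_coordField [CompleteSpace E] {x : M} (hx : x ∈ e.source) (v : E) :
    SmoothFieldAt (coordField e v) x := by
  have : IsManifold 𝓘(ℝ, E) (∞ + 1) M := inferInstanceAs (IsManifold 𝓘(ℝ, E) ∞ M)
  refine ContMDiffAt.mpullback_vectorField_preimage (n := ∞) (m := ∞) ?_ (contMDiffAt_chart he hx)
    (isInvertible_mfderiv_chart he hx) le_rfl
  exact contMDiffAt_vectorSpace_iff_contDiffAt.2 contDiffAt_const

/-- The partial derivatives in a chart are the derivatives along the coordinate fields. -/
lemma fderiv_comp_chart_symm {F : Type*} [NormedAddCommGroup F] [NormedSpace ℝ F] {g : M → F}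
    {y : E} (hy : y ∈ e.target) (hg : MDifferentiableAt 𝓘(ℝ, E) 𝓘(ℝ, F) g (e.symm y)) (v : E) :
    fderiv ℝ (g ∘ e.symm) y v = mvfderiv 𝓘(ℝ, E) g (e.symm y) (coordField e v (e.symm y)) := by
  rw [coordField_symm he hy, ← mfderiv_eq_fderiv,
    mfderiv_comp (I' := 𝓘(ℝ, E)) y hg ((mdifferentiable_chart he).mdifferentiableAt_symm hy)]
  rfl

end Charts

section ChartFields

variable {E : Type*} [NormedAddCommGroup E] [NormedSpace ℂ E]
  {M : Type*} [TopologicalSpace M] [ChartedSpace E M]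

/-- The expression of a vector field in a chart. -/
def chartField (e : OpenPartialHomeomorph M E) (X : Π x : M, TangentSpace 𝓘(ℝ, E) x) (y : E) : E :=
  chartDeriv e (e.symm y) (X (e.symm y))

variable [IsManifold 𝓘(ℂ, E) ω M] {e : OpenPartialHomeomorph M E} (he : e ∈ atlas E M)
include he

lemma mpullback_chart_symm {y : E} (hy : y ∈ e.target) (X : Π x : M, TangentSpace 𝓘(ℝ, E) x) :
    mpullback 𝓘(ℝ, E) 𝓘(ℝ, E) e.symm X y = chartField e X y := by
  have h : mfderiv 𝓘(ℝ, E) 𝓘(ℝ, E) e.symm y = ((mdifferentiable_chart he).symm.mfderiv (x := y) hy :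
      TangentSpace 𝓘(ℝ, E) y →L[ℝ] TangentSpace 𝓘(ℝ, E) (e.symm y)) := rfl
  have h2 : (mfderiv 𝓘(ℝ, E) 𝓘(ℝ, E) e.symm y).inverse =
      (((mdifferentiable_chart he).symm.mfderiv (x := y) hy).symm :
      TangentSpace 𝓘(ℝ, E) (e.symm y) →L[ℝ] TangentSpace 𝓘(ℝ, E) y) := by
    rw [h, ContinuousLinearMap.inverse_equiv]
  exact congrArg (fun L : TangentSpace 𝓘(ℝ, E) (e.symm y) →L[ℝ] TangentSpace 𝓘(ℝ, E) y =>
    L (X (e.symm y))) h2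

lemma coordField_chartField {y : E} (hy : y ∈ e.target) (X : Π x : M, TangentSpace 𝓘(ℝ, E) x) :
    coordField e (chartField e X y) (e.symm y) = X (e.symm y) :=
  coordField_chartDeriv he (e.map_target hy) _

lemma chartField_coordField {y : E} (hy : y ∈ e.target) (v : E) :
    chartField e (coordField e v) y = v :=
  chartDeriv_coordField he (e.map_target hy) _

lemma mpullback_eventuallyEq_chartField {y : E} (hy : y ∈ e.target)
    (X : Π x : M, TangentSpace 𝓘(ℝ, E) x) :
    (mpullback 𝓘(ℝ, E) 𝓘(ℝ, E) e.symm X : E → E) =ᶠ[𝓝 y] chartField e X := by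
  filter_upwards [e.open_target.mem_nhds hy] with z hz using mpullback_chart_symm he hz X

lemma contDiffAt_chartField [CompleteSpace E] {y : E} (hy : y ∈ e.target)
    {X : Π x : M, TangentSpace 𝓘(ℝ, E) x} (hX : SmoothFieldAt X (e.symm y)) :
    ContDiffAt ℝ ∞ (chartField e X) y := by
  have : IsManifold 𝓘(ℝ, E) (∞ + 1) M := inferInstanceAs (IsManifold 𝓘(ℝ, E) ∞ M)
  refine ContDiffAt.congr_of_eventuallyEq ?_ (mpullback_eventuallyEq_chartField he hy X).symm
  refine contMDiffAt_vectorSpace_iff_contDiffAt.1 ?_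
  exact ContMDiffAt.mpullback_vectorField_preimage (n := ∞) (m := ∞)
      hX (contMDiffAt_chart_symm he hy)
    (isInvertible_mfderiv_chart_symm he hy) le_rfl

/-- The Lie bracket in a chart. -/
lemma chartDeriv_mlieBracket [CompleteSpace E] {y : E} (hy : y ∈ e.target)
    {X Y : Π x : M, TangentSpace 𝓘(ℝ, E) x} (hX : SmoothFieldAt X (e.symm y))
    (hY : SmoothFieldAt Y (e.symm y)) :
    chartDeriv e (e.symm y) (mlieBracket 𝓘(ℝ, E) X Y (e.symm y))
      = fderiv ℝ (chartField e Y) y (chartField e X y)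
        - fderiv ℝ (chartField e X) y (chartField e Y y) := by
  have : IsManifold 𝓘(ℝ, E) (minSmoothness ℝ 3) M := by
    rw [minSmoothness_of_isRCLikeNormedField]
    exact IsManifold.of_le (n := ∞) (WithTop.coe_le_coe.2 le_top)
  have h1 := mpullback_mlieBracket (I := 𝓘(ℝ, E)) (I' := 𝓘(ℝ, E)) (f := e.symm) (n := ∞)
    (hX.mdifferentiableAt (by simp)) (hY.mdifferentiableAt (by simp)) (contMDiffAt_chart_symm he hy)
    (by rw [minSmoothness_of_isRCLikeNormedField]; exact two_le_infty)
  rw [mpullback_chart_symm he hy] at h1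
  refine h1.trans ?_
  have h2 : ∀ V W : E → E, lieBracketWithin ℝ V W Set.univ y
      = fderiv ℝ W y (V y) - fderiv ℝ V y (W y) := fun V W => by
    rw [lieBracketWithin_univ]; rfl
  rw [← mlieBracketWithin_univ, mlieBracketWithin_eq_lieBracketWithin]
  refine (h2 _ _).trans ?_
  rw [(mpullback_eventuallyEq_chartField he hy X).fderiv_eq,
    (mpullback_eventuallyEq_chartField he hy Y).fderiv_eq, mpullback_chart_symm he hy X,
    mpullback_chart_symm he hy Y]

lemma mlieBracket_coordField [CompleteSpace E] {x : M} (hx : x ∈ e.source) (v w : E) :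
    mlieBracket 𝓘(ℝ, E) (coordField e v) (coordField e w) x = 0 := by
  have hy := e.map_source hx
  have h0 : ∀ v : E, fderiv ℝ (chartField e (coordField e v)) (e x) = 0 := fun v => by
    have : chartField e (coordField e v) =ᶠ[𝓝 (e x)] fun _ => v := by
      filter_upwards [e.open_target.mem_nhds hy] with z hz using chartField_coordField he hz v
    rw [this.fderiv_eq]; simp
  have h1 := chartDeriv_mlieBracket he hy (X := coordField e v) (Y := coordField e w)
    (by rw [e.left_inv hx]; exact smoothFieldAt_coordField he hx v)
    (by rw [e.left_inv hx]; exact smoothFieldAt_coordField he hx w)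
  rw [h0, h0, zero_apply, zero_apply, sub_zero, e.left_inv hx] at h1
  have h2 := (coordEquiv he hx).symm.map_eq_zero_iff.1 h1
  exact h2

end ChartFields

/-! ### The metric and the fundamental two-form in a chart -/

section ChartMetric

variable {E : Type*} [NormedAddCommGroup E] [NormedSpace ℂ E] [FiniteDimensional ℂ E]
  {M : Type*} [TopologicalSpace M] [ChartedSpace E M]
  [RiemannianBundle (fun x : M => TangentSpace 𝓘(ℝ, E) x)]

/-- The Gram matrix of the coordinate fields of a chart. -/
def chartGram (e : OpenPartialHomeomorph M E) (y : E) :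
    Matrix (Fin (Module.finrank ℝ E)) (Fin (Module.finrank ℝ E)) ℝ :=
  Matrix.of fun i j => inner ℝ (coordField e (Module.finBasis ℝ E i) (e.symm y))
    (coordField e (Module.finBasis ℝ E j) (e.symm y))

/-- The Riemannian density of a chart. -/
def chartDensity (e : OpenPartialHomeomorph M E) (y : E) : ℝ := Real.sqrt (chartGram e y).det

variable (E) in
/-- The matrix of the multiplication by `i`. -/
def mulIMatrix : Matrix (Fin (Module.finrank ℝ E)) (Fin (Module.finrank ℝ E)) ℝ :=
  LinearMap.toMatrix (Module.finBasis ℝ E) (Module.finBasis ℝ E)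
    ((LinearMap.lsmul ℂ E Complex.I).restrictScalars ℝ)

/-- The matrix of the fundamental two-form in a chart. -/
def chartOmega (e : OpenPartialHomeomorph M E) (y : E) :
    Matrix (Fin (Module.finrank ℝ E)) (Fin (Module.finrank ℝ E)) ℝ :=
  Matrix.of fun i j => inner ℝ (coordField e (Module.finBasis ℝ E i) (e.symm y))
    (coordField e (Complex.I • Module.finBasis ℝ E j) (e.symm y))

/-- The bivector `∑ e ⊗ J e` in a chart; it is the inverse of the fundamental two-form. -/
def chartBivector (e : OpenPartialHomeomorph M E) (y : E) :
    Matrix (Fin (Module.finrank ℝ E)) (Fin (Module.finrank ℝ E)) ℝ :=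
  (chartGram e y)⁻¹ * (mulIMatrix E).transpose

lemma I_smul_finBasis (k : Fin (Module.finrank ℝ E)) :
    Complex.I • Module.finBasis ℝ E k = ∑ l, mulIMatrix E l k • Module.finBasis ℝ E l := by
  have := (Module.finBasis ℝ E).sum_repr (Complex.I • Module.finBasis ℝ E k)
  conv_lhs => rw [← this]
  refine Finset.sum_congr rfl fun l _ => ?_
  rw [mulIMatrix, LinearMap.toMatrix_apply]
  rfl

variable [IsManifold 𝓘(ℂ, E) ω M] {e : OpenPartialHomeomorph M E} (he : e ∈ atlas E M)

include he in
lemma coordField_sum {ι : Type*} (s : Finset ι) (c : ι → ℝ) (v : ι → E) {x : M}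
    (hx : x ∈ e.source) :
    coordField e (∑ i ∈ s, c i • v i) x = ∑ i ∈ s, c i • coordField e (v i) x := by
  simp only [← coordEquiv_apply he hx, map_sum, map_smul]

/-- The coordinate frame as a basis of the tangent space. -/
def coordBasis {x : M} (hx : x ∈ e.source) :
    Module.Basis (Fin (Module.finrank ℝ E)) ℝ (TangentSpace 𝓘(ℝ, E) x) :=
  (Module.finBasis ℝ E).map (coordEquiv he hx).toLinearEquiv

lemma coordBasis_apply {x : M} (hx : x ∈ e.source) (i : Fin (Module.finrank ℝ E)) :
    coordBasis he hx i = coordField e (Module.finBasis ℝ E i) x := by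
  rw [← coordEquiv_apply he hx]
  simp [coordBasis]

lemma chartGram_eq_gram {y : E} (hy : y ∈ e.target) :
    chartGram e y = Matrix.gram ℝ (coordBasis he (e.map_target hy)) := by
  ext i j
  simp only [chartGram, Matrix.of_apply, Matrix.gram_apply, coordBasis_apply]

include he

lemma chartGram_det_pos {y : E} (hy : y ∈ e.target) : 0 < (chartGram e y).det := by
  rw [chartGram_eq_gram he hy]
  exact (Matrix.posDef_gram_of_linearIndependent (coordBasis he _).linearIndependent).det_pos

lemma chartDensity_pos {y : E} (hy : y ∈ e.target) : 0 < chartDensity e y :=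
  Real.sqrt_pos.2 (chartGram_det_pos he hy)

/-- The Riemannian trace of a bilinear map in a chart. -/
lemma sum_orthonormalBasis_eq_sum_chart {F κ : Type*} [AddCommGroup F] [Module ℝ F] [Fintype κ]
    {y : E} (hy : y ∈ e.target) (f : OrthonormalBasis κ ℝ (TangentSpace 𝓘(ℝ, E) (e.symm y)))
    (B : TangentSpace 𝓘(ℝ, E) (e.symm y) →ₗ[ℝ] TangentSpace 𝓘(ℝ, E) (e.symm y) →ₗ[ℝ] F) :
    ∑ i, B (f i) (f i) = ∑ j, ∑ k, (chartGram e y)⁻¹ j k •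
      B (coordField e (Module.finBasis ℝ E j) (e.symm y))
        (coordField e (Module.finBasis ℝ E k) (e.symm y)) := by
  rw [sum_orthonormalBasis_eq_sum_gram_inv f (coordBasis he (e.map_target hy)),
      chartGram_eq_gram he hy]
  simp only [coordBasis_apply]

lemma chartOmega_eq {y : E} (hy : y ∈ e.target) :
    chartOmega e y = chartGram e y * mulIMatrix E := by
  ext i j
  simp only [chartOmega, chartGram, Matrix.of_apply, Matrix.mul_apply, I_smul_finBasis,
    coordField_sum he _ _ _ (e.map_target hy), inner_sum, real_inner_smul_right]
  exact Finset.sum_congr rfl fun k _ => mul_comm _ _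

/-- The twisted Riemannian trace `∑ B (e, J e)` in a chart. -/
lemma sum_orthonormalBasis_J_eq_sum_chart {F κ : Type*} [AddCommGroup F] [Module ℝ F] [Fintype κ]
    {y : E} (hy : y ∈ e.target) (f : OrthonormalBasis κ ℝ (TangentSpace 𝓘(ℝ, E) (e.symm y)))
    (B : TangentSpace 𝓘(ℝ, E) (e.symm y) →ₗ[ℝ] TangentSpace 𝓘(ℝ, E) (e.symm y) →ₗ[ℝ] F) :
    ∑ i, B (f i) (J (e.symm y) (f i)) = ∑ j, ∑ k, chartBivector e y j k •
      B (coordField e (Module.finBasis ℝ E j) (e.symm y))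
        (coordField e (Module.finBasis ℝ E k) (e.symm y)) := by
  have hx := e.map_target hy
  let Jl : TangentSpace 𝓘(ℝ, E) (e.symm y) →ₗ[ℝ] TangentSpace 𝓘(ℝ, E) (e.symm y) :=
    (LinearMap.lsmul ℂ E Complex.I).restrictScalars ℝ
  have hJ : ∀ v, Jl v = J (e.symm y) v := fun v => rfl
  have h := sum_orthonormalBasis_eq_sum_chart he hy f (B.compl₂ Jl)
  simp only [LinearMap.compl₂_apply, hJ, J_coordField he hx] at h
  rw [h]
  refine Finset.sum_congr rfl fun j _ => ?_
  simp only [I_smul_finBasis, coordField_sum he _ _ _ hx, map_sum, map_smul, Finset.smul_sum,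
      smul_smul]
  rw [Finset.sum_comm]
  refine Finset.sum_congr rfl fun l _ => ?_
  rw [← Finset.sum_smul, chartBivector, Matrix.mul_apply]
  simp only [Matrix.transpose_apply]

variable [IsContMDiffRiemannianBundle 𝓘(ℝ, E) ∞ E (fun x : M => TangentSpace 𝓘(ℝ, E) x)]

lemma contDiffOn_inner_coordField (v w : E) :
    ContDiffOn ℝ ∞ (fun y => (inner ℝ (coordField e v (e.symm y)) (coordField e w (e.symm y)) : ℝ))
      e.target := by
  have : CompleteSpace E := FiniteDimensional.complete ℂ E
  intro y hy
  have hx := e.map_target hy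
  have h1 : ContMDiffAt 𝓘(ℝ, E) 𝓘(ℝ, ℝ) ∞
      (fun x : M => (inner ℝ (coordField e v x) (coordField e w x) : ℝ)) (e.symm y) :=
    ContMDiffAt.inner_bundle (smoothFieldAt_coordField he hx v) (smoothFieldAt_coordField he hx w)
  exact (h1.comp y (contMDiffAt_chart_symm he hy)).contDiffAt.contDiffWithinAt

lemma contDiffOn_chartGram (i j) : ContDiffOn ℝ ∞ (fun y => chartGram e y i j) e.target :=
  contDiffOn_inner_coordField he _ _

lemma contDiffOn_chartOmega (i j) : ContDiffOn ℝ ∞ (fun y => chartOmega e y i j) e.target :=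
  contDiffOn_inner_coordField he _ _

end ChartMetric

section MatrixSmooth

variable {E : Type*} [NormedAddCommGroup E] [NormedSpace ℝ E] {ι : Type*} [Fintype ι]
    [DecidableEq ι]
  {W : Set E} {A : E → Matrix ι ι ℝ}

lemma contDiffOn_det (hA : ∀ i j, ContDiffOn ℝ ∞ (fun y => A y i j) W) :
    ContDiffOn ℝ ∞ (fun y => (A y).det) W := by
  simp only [Matrix.det_apply']
  exact ContDiffOn.sum fun σ _ => contDiffOn_const.mul (contDiffOn_prod fun i _ => hA _ _)

lemma contDiffOn_matrix_inv (hA : ∀ i j, ContDiffOn ℝ ∞ (fun y => A y i j) W)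
    (h0 : ∀ y ∈ W, (A y).det ≠ 0) (i j : ι) : ContDiffOn ℝ ∞ (fun y => (A y)⁻¹ i j) W := by
  have h1 : ContDiffOn ℝ ∞ (fun y => (A y).adjugate i j) W := by
    simp only [Matrix.adjugate_apply]
    refine contDiffOn_det fun k l => ?_
    by_cases hk : k = j
    · subst hk; simpa using contDiffOn_const
    · simpa [Matrix.updateRow_apply, hk] using hA k l
  refine (((contDiffOn_det hA).inv h0).mul h1).congr fun y hy => ?_
  simp [Matrix.inv_def]

end MatrixSmooth

section Kahler

variable {E : Type*} [NormedAddCommGroup E] [NormedSpace ℂ E] [FiniteDimensional ℂ E]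
  {M : Type*} [TopologicalSpace M] [ChartedSpace E M]
  [RiemannianBundle (fun x : M => TangentSpace 𝓘(ℝ, E) x)]
  [IsManifold 𝓘(ℂ, E) ω M]
  [IsContMDiffRiemannianBundle 𝓘(ℝ, E) ∞ E (fun x : M => TangentSpace 𝓘(ℝ, E) x)]
  {e : OpenPartialHomeomorph M E} (he : e ∈ atlas E M)
include he

lemma contDiffOn_chartGram_inv (i j) : ContDiffOn ℝ ∞ (fun y => (chartGram e y)⁻¹ i j) e.target :=
  contDiffOn_matrix_inv (contDiffOn_chartGram he) (fun _ hy => (chartGram_det_pos he hy).ne') i j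

lemma contDiffOn_chartBivector (i j) :
    ContDiffOn ℝ ∞ (fun y => chartBivector e y i j) e.target := by
  simp only [chartBivector, Matrix.mul_apply]
  exact ContDiffOn.sum fun k _ => (contDiffOn_chartGram_inv he i k).mul contDiffOn_const

lemma contDiffOn_chartDensity : ContDiffOn ℝ ∞ (chartDensity e) e.target :=
  (contDiffOn_det (contDiffOn_chartGram he)).sqrt fun _ hy => (chartGram_det_pos he hy).ne'

variable (hg : IsKahler E M)
include hg

/-- The fundamental two-form is antisymmetric, as `g` is invariant under `J` and `J² = -1`. -/
lemma inner_I_smul_right {y : E} (hy : y ∈ e.target) (v w : E) :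
    (inner ℝ (coordField e v (e.symm y)) (coordField e (Complex.I • w) (e.symm y)) : ℝ)
      = - inner ℝ (coordField e w (e.symm y)) (coordField e (Complex.I • v) (e.symm y)) := by
  have hx := e.map_target hy
  rw [← hg.hermitian, J_coordField he hx, J_coordField he hx, smul_smul, Complex.I_mul_I,
      neg_one_smul,
    ← coordEquiv_apply he hx (-w), map_neg, coordEquiv_apply he hx, inner_neg_right,
        real_inner_comm]

lemma chartOmega_antisymm {y : E} (hy : y ∈ e.target) (i j) :
    chartOmega e y i j = - chartOmega e y j i :=
  inner_I_smul_right he hg hy _ _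

lemma chartBivector_mul_chartOmega {y : E} (hy : y ∈ e.target) :
    chartBivector e y * chartOmega e y = 1 := by
  have h1 : (mulIMatrix E).transpose * chartOmega e y = chartGram e y := by
    ext i j
    simp only [Matrix.mul_apply, Matrix.transpose_apply]
    have hx := e.map_target hy
    have := hg.hermitian (e.symm y) (coordField e (Module.finBasis ℝ E i) (e.symm y))
      (coordField e (Module.finBasis ℝ E j) (e.symm y))
    rw [J_coordField he hx, J_coordField he hx, I_smul_finBasis i, coordField_sum he _ _ _ hx,
      sum_inner] at this
    simp only [real_inner_smul_left] at this
    exact this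
  rw [chartBivector, Matrix.mul_assoc, h1,
      Matrix.nonsing_inv_mul _ (chartGram_det_pos he hy).ne'.isUnit]

lemma chartBivector_antisymm {y : E} (hy : y ∈ e.target) (i j) :
    chartBivector e y i j = - chartBivector e y j i := by
  have h := chartBivector_mul_chartOmega he hg hy
  have h' : chartOmega e y * chartBivector e y = 1 := mul_eq_one_comm.1 h
  have hΩ : (chartOmega e y).transpose = - chartOmega e y := by
    ext i j; simpa using chartOmega_antisymm he hg hy j i
  have h1 : (chartBivector e y).transpose * chartOmega e y = -1 := by
    have := congrArg Matrix.transpose h'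
    rw [Matrix.transpose_mul, hΩ] at this
    rw [← neg_inj, neg_neg, ← Matrix.transpose_one, ← this, Matrix.mul_neg]
  have h2 : (chartBivector e y).transpose = - chartBivector e y := by
    calc (chartBivector e y).transpose
        = (chartBivector e y).transpose * (chartOmega e y * chartBivector e y) := by rw [h',
            mul_one]
      _ = _ := by rw [← Matrix.mul_assoc, h1, neg_mul, one_mul]
  have := congrFun (congrFun h2 j) i
  simpa using this

lemma fderiv_chartOmega {y : E} (hy : y ∈ e.target) (v : E) (i j) :
    fderiv ℝ (fun z => chartOmega e z i j) y v
      = mvfderiv 𝓘(ℝ, E) (fundamentalForm (coordField e (Module.finBasis ℝ E i))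
          (coordField e (Module.finBasis ℝ E j))) (e.symm y) (coordField e v (e.symm y)) := by
  have : CompleteSpace E := FiniteDimensional.complete ℂ E
  have hx := e.map_target hy
  set F := fundamentalForm (coordField e (Module.finBasis ℝ E i))
      (coordField e (Module.finBasis ℝ E j))
  have h1 : ContMDiffAt 𝓘(ℝ, E) 𝓘(ℝ, ℝ) ∞ F (e.symm y) := by
    have h2 : ContMDiffAt 𝓘(ℝ, E) 𝓘(ℝ, ℝ) ∞
      (fun x : M => (inner ℝ (coordField e (Module.finBasis ℝ E i) x)
        (coordField e (Complex.I • Module.finBasis ℝ E j) x) : ℝ)) (e.symm y) :=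
      ContMDiffAt.inner_bundle (smoothFieldAt_coordField he hx _) (smoothFieldAt_coordField he hx _)
    refine h2.congr_of_eventuallyEq ?_
    filter_upwards [e.open_source.mem_nhds hx] with x hx'
    simp only [F, fundamentalForm, J_coordField he hx']
  rw [← fderiv_comp_chart_symm he hy (h1.mdifferentiableAt (by simp))]
  congr 1
  refine Filter.EventuallyEq.fderiv_eq ?_
  filter_upwards [e.open_target.mem_nhds hy] with z hz
  simp only [F, fundamentalForm, Function.comp_apply, chartOmega, Matrix.of_apply,
    J_coordField he (e.map_target hz)]

/-- Closedness of the fundamental two-form in a chart, where the bracket terms vanish since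
coordinate fields commute. -/
lemma chartOmega_closed {y : E} (hy : y ∈ e.target) (i j k) :
    fderiv ℝ (fun z => chartOmega e z j k) y (Module.finBasis ℝ E i)
      + fderiv ℝ (fun z => chartOmega e z k i) y (Module.finBasis ℝ E j)
      + fderiv ℝ (fun z => chartOmega e z i j) y (Module.finBasis ℝ E k) = 0 := by
  have : CompleteSpace E := FiniteDimensional.complete ℂ E
  have hx := e.map_target hy
  have h := hg.closed (e.symm y) (coordField e (Module.finBasis ℝ E i))
    (coordField e (Module.finBasis ℝ E j)) (coordField e (Module.finBasis ℝ E k))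
    (smoothFieldAt_coordField he hx _) (smoothFieldAt_coordField he hx _)
    (smoothFieldAt_coordField he hx _)
  simp only [fderiv_chartOmega he hg hy]
  simpa only [fundamentalForm, mlieBracket_coordField he hx, inner_zero_left, sub_zero] using h

/-- The bivector `∑ e ⊗ J e` of a Kähler manifold is divergence free. -/
lemma sum_fderiv_chartDensity_mul_chartBivector {y : E} (hy : y ∈ e.target) (k) :
    ∑ j, fderiv ℝ (fun z => chartDensity e z * chartBivector e z j k) y (Module.finBasis ℝ E j)
        = 0 := by
  have hWy := e.open_target.mem_nhds hy
  have hdiff : ∀ {g : E → ℝ}, ContDiffOn ℝ ∞ g e.target → DifferentiableAt ℝ g y :=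
    fun h => (h.contDiffAt hWy).differentiableAt (by simp)
  refine sum_fderiv_density_mul_inverse_eq_zero (Ω := chartOmega e) _
    (fun i j => hdiff (contDiffOn_chartBivector he i j)) (fun i j =>
        hdiff (contDiffOn_chartOmega he i j))
    (hdiff (contDiffOn_chartDensity he)) ?_ ?_ (chartOmega_closed he hg hy) ?_ k
  · filter_upwards [hWy] with z hz using chartBivector_mul_chartOmega he hg hz
  · filter_upwards [hWy] with z hz using chartOmega_antisymm he hg hz
  · intro v
    obtain ⟨D, hD, hDv⟩ := hasFDerivAt_det (M := chartGram e) (y := y)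
      fun i j => hdiff (contDiffOn_chartGram he i j)
    have hpos := chartGram_det_pos he hy
    have h1 : fderiv ℝ (chartDensity e) y = (1 / (2 * √(chartGram e y).det)) • D :=
      (hD.sqrt hpos.ne').fderiv
    -- `i A = G⁻¹` as matrices
    have hJA : mulIMatrix E * chartBivector e y = (chartGram e y)⁻¹ := by
      have h2 : chartOmega e y * chartBivector e y = 1 :=
        mul_eq_one_comm.1 (chartBivector_mul_chartOmega he hg hy)
      rw [chartOmega_eq he hy, Matrix.mul_assoc] at h2
      exact (Matrix.inv_eq_right_inv h2).symm
    have hdΩ : ∀ j i, fderiv ℝ (fun z => chartOmega e z j i) y v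
        = ∑ l, fderiv ℝ (fun z => chartGram e z j l) y v * mulIMatrix E l i := by
      intro j i
      have h3 : (fun z => chartOmega e z j i)
          =ᶠ[𝓝 y] fun z => ∑ l, chartGram e z j l * mulIMatrix E l i := by
        filter_upwards [hWy] with z hz
        rw [chartOmega_eq he hz, Matrix.mul_apply]
      have h4 : HasFDerivAt (fun z => ∑ l, chartGram e z j l * mulIMatrix E l i)
          (∑ l, mulIMatrix E l i • fderiv ℝ (fun z => chartGram e z j l) y) y :=
        HasFDerivAt.fun_sum fun l _ =>
          (hdiff (contDiffOn_chartGram he j l)).hasFDerivAt.mul_const (mulIMatrix E l i)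
      rw [h3.fderiv_eq, h4.fderiv]
      simp only [sum_apply, smul_apply, smul_eq_mul, mul_comm]
    have h5 : ∑ i, ∑ j, chartBivector e y i j * fderiv ℝ (fun z => chartOmega e z j i) y v
        = ∑ j, ∑ l, (chartGram e y)⁻¹ l j * fderiv ℝ (fun z => chartGram e z j l) y v := by
      simp only [hdΩ, Finset.mul_sum, ← hJA, Matrix.mul_apply, Finset.sum_mul]
      rw [Finset.sum_comm]
      refine Finset.sum_congr rfl fun j _ => ?_
      rw [Finset.sum_comm]
      exact Finset.sum_congr rfl fun l _ => Finset.sum_congr rfl fun i _ => by ring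
    have h6 : ∀ l j, (chartGram e y).adjugate l j
        = (chartGram e y).det * (chartGram e y)⁻¹ l j := by
      intro l j
      rw [Matrix.inv_def, Ring.inverse_eq_inv', Matrix.smul_apply, smul_eq_mul,
          mul_inv_cancel_left₀ hpos.ne']
    rw [h5, h1, smul_apply, hDv, smul_eq_mul]
    simp only [h6, mul_assoc, ← Finset.mul_sum, chartDensity]
    rw [← mul_assoc, ← mul_assoc]
    congr 1
    have := Real.mul_self_sqrt hpos.le
    have h7 := (Real.sqrt_pos.2 hpos).ne'
    field_simp
    nlinarith [this]

end Kahler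

/-! ### Restriction of scalars for bundles -/

section RestrictScalars

variable {B F : Type*} {L : B → Type*} [TopologicalSpace B] [NormedAddCommGroup F] [NormedSpace ℂ F]
  [TopologicalSpace (TotalSpace F L)] [∀ x, NormedAddCommGroup (L x)] [∀ x, NormedSpace ℂ (L x)]
  [FiberBundle F L]

instance [VectorBundle ℂ F L] (t : Trivialization F (π F L)) [MemTrivializationAtlas t] :
    t.IsLinear ℝ where
  linear x hx := by
    have h := Trivialization.linear ℂ t hx
    exact ⟨h.map_add, fun c w => by
      have := h.map_smul (c : ℂ) w
      simpa using! this⟩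

lemma coordChangeL_restrictScalars [VectorBundle ℂ F L]
    (t t' : Trivialization F (π F L)) [MemTrivializationAtlas t]
    [MemTrivializationAtlas t'] {x : B} (hx : x ∈ t.baseSet ∩ t'.baseSet) :
    (t.coordChangeL ℝ t' x : F →L[ℝ] F)
      = ContinuousLinearMap.restrictScalars ℝ (t.coordChangeL ℂ t' x : F →L[ℂ] F) := by
  ext v
  simp only [ContinuousLinearMap.coe_restrictScalars', ContinuousLinearEquiv.coe_coe]
  rw [Trivialization.coordChangeL_apply t t' hx, Trivialization.coordChangeL_apply t t' hx]

/-- A complex vector bundle is a real vector bundle. -/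
instance realVectorBundle [VectorBundle ℂ F L] : VectorBundle ℝ F L where
  trivialization_linear' _ := inferInstance
  continuousOn_coordChange' t t' _ _ := by
    have h := continuousOn_coordChange ℂ t t'
    have h2 := (ContinuousLinearMap.restrictScalarsL ℂ F F ℝ ℝ).continuous.comp_continuousOn h
    exact h2.congr fun x hx => coordChangeL_restrictScalars t t' hx

variable {E : Type*} [NormedAddCommGroup E] [NormedSpace ℂ E] [ChartedSpace E B]

lemma contMDiffAt_restrictScalars {F' : Type*} [NormedAddCommGroup F'] [NormedSpace ℂ F']
    {f : B → F'}
    {x : B} (hf : ContMDiffAt 𝓘(ℂ, E) 𝓘(ℂ, F') ω f x) :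
    ContMDiffAt 𝓘(ℝ, E) 𝓘(ℝ, F') ∞ f x := by
  rw [contMDiffAt_iff] at hf ⊢
  refine ⟨hf.1, ?_⟩
  exact (ContDiffWithinAt.restrict_scalars ℝ hf.2).of_le le_top

/-- A holomorphic vector bundle is a smooth real vector bundle. -/
instance realContMDiffVectorBundle [VectorBundle ℂ F L] [ContMDiffVectorBundle ω F L 𝓘(ℂ, E)] :
    ContMDiffVectorBundle ∞ F L 𝓘(ℝ, E) where
  contMDiffOn_coordChangeL t t' _ _ := by
    have h := contMDiffOn_coordChangeL (IB := 𝓘(ℂ, E)) (n := ω) t t'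
    have hopen : IsOpen (t.baseSet ∩ t'.baseSet) := t.open_baseSet.inter t'.open_baseSet
    intro x hx
    have h1 := contMDiffAt_restrictScalars (h.contMDiffAt (hopen.mem_nhds hx))
    have h2 : ContMDiffAt 𝓘(ℝ, E) 𝓘(ℝ, F →L[ℝ] F) ∞
        (fun b => ContinuousLinearMap.restrictScalars ℝ (t.coordChangeL ℂ t' b : F →L[ℂ] F)) x :=
      ((ContinuousLinearMap.restrictScalarsL ℂ F F ℝ ℝ).contMDiff (n := ∞)).contMDiffAt.comp x h1
    refine (h2.congr_of_eventuallyEq ?_).contMDiffWithinAt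
    filter_upwards [hopen.mem_nhds hx] with b hb using coordChangeL_restrictScalars t t' hb

end RestrictScalars

/-! ### Local frames of the line bundle -/

section Frame

variable {E : Type*} [NormedAddCommGroup E] [NormedSpace ℂ E]
  {M : Type*} [TopologicalSpace M] [ChartedSpace E M]
  {L : M → Type*} [TopologicalSpace (TotalSpace ℂ L)]
  [∀ x, NormedAddCommGroup (L x)] [∀ x, InnerProductSpace ℂ (L x)]
  [FiberBundle ℂ L]

/-- The reference section of a trivialization. -/
def frame (t : Trivialization ℂ (π ℂ L)) (x : M) : L x := t.symm x (1 : ℂ)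

/-- The component of a section in a trivialization. -/
def coord (t : Trivialization ℂ (π ℂ L)) (ψ : Π x, L x) (x : M) : ℂ :=
    (t (TotalSpace.mk' ℂ x (ψ x))).2

variable [VectorBundle ℂ ℂ L] {t : Trivialization ℂ (π ℂ L)} [MemTrivializationAtlas t]

lemma coord_smul_frame {x : M} (hx : x ∈ t.baseSet) (ψ : Π x, L x) :
    coord t ψ x • frame t x = ψ x := by
  have h := t.symm_apply_apply_mk hx (ψ x)
  have h2 := (t.symmₗ ℂ x).map_smul (coord t ψ x) (1 : ℂ)
  rw [smul_eq_mul, mul_one, t.symmₗ_apply hx, t.symmₗ_apply hx] at h2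
  rw [frame]
  exact h2.symm.trans h

lemma coord_eq_of_eq_smul {x : M} (hx : x ∈ t.baseSet) {ψ : Π x, L x} {c : ℂ}
    (h : ψ x = c • frame t x) : coord t ψ x = c := by
  have h2 := (t.symmₗ ℂ x).map_smul c (1 : ℂ)
  rw [smul_eq_mul, mul_one, t.symmₗ_apply hx, t.symmₗ_apply hx] at h2
  have h3 : ψ x = t.symm x c := h.trans h2.symm
  rw [coord, h3, TotalSpace.mk', t.apply_mk_symm hx]

lemma coord_frame {x : M} (hx : x ∈ t.baseSet) : coord t (frame t) x = 1 :=
  coord_eq_of_eq_smul hx (one_smul ℂ _).symm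

lemma frame_ne_zero {x : M} (hx : x ∈ t.baseSet) : frame t x ≠ 0 := by
  intro h
  have := coord_eq_of_eq_smul hx (ψ := frame t) (c := 0) (by rw [h, smul_zero])
  rw [coord_frame hx] at this
  exact one_ne_zero this

lemma inner_eq_coord {x : M} (hx : x ∈ t.baseSet) (φ ψ : Π x, L x) :
    inner ℂ (φ x) (ψ x) = star (coord t φ x) * coord t ψ x * ((‖frame t x‖ ^ 2 : ℝ) : ℂ) := by
  conv_lhs => rw [← coord_smul_frame hx φ, ← coord_smul_frame hx ψ]
  rw [inner_smul_left, inner_smul_right, inner_self_eq_norm_sq_to_K]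
  simp only [Complex.coe_algebraMap, starRingEnd_apply]
  push_cast
  ring

lemma coord_add {x : M} (hx : x ∈ t.baseSet) (φ ψ : Π x, L x) :
    coord t (fun x => φ x + ψ x) x = coord t φ x + coord t ψ x :=
  coord_eq_of_eq_smul hx (by rw [add_smul, coord_smul_frame hx, coord_smul_frame hx])

lemma coord_smul {x : M} (hx : x ∈ t.baseSet) (c : M → ℂ) (ψ : Π x, L x) :
    coord t (fun x => c x • ψ x) x = c x * coord t ψ x :=
  coord_eq_of_eq_smul hx (by rw [mul_smul, coord_smul_frame hx])

variable [ContMDiffVectorBundle ω ℂ L 𝓘(ℂ, E)]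

lemma smoothSectionAt_iff {x : M} (hx : x ∈ t.baseSet) {ψ : Π x, L x} :
    SmoothSectionAt E ψ x ↔ ContMDiffAt 𝓘(ℝ, E) 𝓘(ℝ, ℂ) ∞ (coord t ψ) x :=
  t.contMDiffAt_section_iff hx

lemma coord_frame_eventuallyEq {x : M} (hx : x ∈ t.baseSet) :
    coord t (frame t) =ᶠ[𝓝 x] fun _ => 1 := by
  filter_upwards [t.open_baseSet.mem_nhds hx] with z hz using coord_frame hz

lemma smoothSectionAt_frame {x : M} (hx : x ∈ t.baseSet) : SmoothSectionAt E (frame t) x :=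
  (smoothSectionAt_iff hx).2 (contMDiffAt_const.congr_of_eventuallyEq (coord_frame_eventuallyEq hx))

lemma holomorphicSectionAt_frame {x : M} (hx : x ∈ t.baseSet) :
    HolomorphicSectionAt E (frame t) x :=
  (t.contMDiffAt_section_iff (IB := 𝓘(ℂ, E)) hx).2
    (contMDiffAt_const.congr_of_eventuallyEq (coord_frame_eventuallyEq hx))

lemma exists_trivialization (x : M) : ∃ t : Trivialization ℂ (π ℂ L),
    MemTrivializationAtlas t ∧ x ∈ t.baseSet :=
  ⟨trivializationAt ℂ L x, inferInstance, FiberBundle.mem_baseSet_trivializationAt' x⟩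

lemma SmoothSectionAt.add {x : M} {φ ψ : Π x, L x} (hφ : SmoothSectionAt E φ x)
    (hψ : SmoothSectionAt E ψ x) : SmoothSectionAt E (fun x => φ x + ψ x) x := by
  obtain ⟨t, _, hx⟩ := exists_trivialization (L := L) x
  rw [smoothSectionAt_iff hx] at hφ hψ ⊢
  refine (hφ.add hψ).congr_of_eventuallyEq ?_
  filter_upwards [t.open_baseSet.mem_nhds hx] with z hz using coord_add hz φ ψ

lemma SmoothSectionAt.smul {x : M} {c : M → ℂ} {ψ : Π x, L x}
    (hc : ContMDiffAt 𝓘(ℝ, E) 𝓘(ℝ, ℂ) ∞ c x)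
    (hψ : SmoothSectionAt E ψ x) : SmoothSectionAt E (fun x => c x • ψ x) x := by
  obtain ⟨t, _, hx⟩ := exists_trivialization (L := L) x
  rw [smoothSectionAt_iff hx] at hψ ⊢
  have hmul : ContMDiffAt 𝓘(ℝ, E) 𝓘(ℝ, ℂ) ∞ (fun x => c x * coord t ψ x) x :=
    (contDiff_mul (𝔸 := ℂ)).contMDiff.contMDiffAt.comp x (hc.prodMk_space hψ)
  refine hmul.congr_of_eventuallyEq ?_
  filter_upwards [t.open_baseSet.mem_nhds hx] with z hz using coord_smul hz c ψ

lemma SmoothSectionAt.congr {x : M} {φ ψ : Π x, L x} (hφ : SmoothSectionAt E φ x)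
    (h : ∀ᶠ z in 𝓝 x, ψ z = φ z) : SmoothSectionAt E ψ x := by
  refine ContMDiffAt.congr_of_eventuallyEq (hφ : ContMDiffAt _ _ _ _ _) ?_
  filter_upwards [h] with z hz
  rw [hz]

lemma smoothSectionAt_zero (x : M) : SmoothSectionAt E (fun x => (0 : L x)) x := by
  obtain ⟨t, _, hx⟩ := exists_trivialization (L := L) x
  refine ((smoothSectionAt_frame hx).smul (c := fun _ => 0) contMDiffAt_const).congr ?_
  filter_upwards with z; simp

lemma SmoothSectionAt.mdifferentiableAt {x : M} {ψ : Π x, L x} (h : SmoothSectionAt E ψ x) :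
    MDifferentiableAt 𝓘(ℝ, E) (𝓘(ℝ, E).prod 𝓘(ℝ, ℂ)) (fun y => TotalSpace.mk' ℂ y (ψ y)) x :=
  ContMDiffAt.mdifferentiableAt h (by simp)

end Frame

/-! ### The connection in a chart -/

section ConnForm

variable {E : Type*} [NormedAddCommGroup E] [NormedSpace ℂ E]
  {M : Type*} [TopologicalSpace M] [ChartedSpace E M]
  {L : M → Type*} [TopologicalSpace (TotalSpace ℂ L)]
  [∀ x, NormedAddCommGroup (L x)] [∀ x, InnerProductSpace ℂ (L x)]
  [FiberBundle ℂ L]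

/-- The multiplication by `i` as a real linear map. -/
def mulI (E : Type*) [NormedAddCommGroup E] [NormedSpace ℂ E] : E →L[ℝ] E :=
  (ContinuousLinearMap.lsmul ℂ ℂ Complex.I : E →L[ℂ] E).restrictScalars ℝ

/-- The squared length of the reference section of `t` in the chart `e`. -/
def frameNormSq (e : OpenPartialHomeomorph M E) (t : Trivialization ℂ (π ℂ L)) (y : E) : ℝ :=
  ‖frame t (e.symm y)‖ ^ 2

/-- The complex one-form `½ (dℓ - i dℓ ∘ i)`, the `(1,0)`-part of the differential of a real
function `ℓ`. -/
def delForm (ℓ : E → ℝ) (y : E) : E →L[ℝ] ℂ :=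
  (1 / 2 : ℂ) • (Complex.ofRealCLM.comp (fderiv ℝ ℓ y)
    - Complex.I • Complex.ofRealCLM.comp ((fderiv ℝ ℓ y).comp (mulI E)))

lemma delForm_apply (ℓ : E → ℝ) (y v : E) : delForm ℓ y v
    = (1 / 2) * ((fderiv ℝ ℓ y v : ℂ) - Complex.I * (fderiv ℝ ℓ y (Complex.I • v) : ℂ)) := rfl

/-- The connection form `∂ log ‖s‖²` of the Chern connection in the holomorphic frame `s` of the
trivialization `t`, in the chart `e`. -/
def connForm (e : OpenPartialHomeomorph M E) (t : Trivialization ℂ (π ℂ L)) : E → E →L[ℝ] ℂ :=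
  delForm fun y => Real.log (frameNormSq e t y)

/-- The domain of the chart `e` and the trivialization `t`, in the model space. -/
def domain (e : OpenPartialHomeomorph M E) (t : Trivialization ℂ (π ℂ L)) : Set E :=
  e.target ∩ e.symm ⁻¹' t.baseSet

lemma isOpen_domain (e : OpenPartialHomeomorph M E) (t : Trivialization ℂ (π ℂ L)) :
    IsOpen (domain e t) :=
  e.isOpen_inter_preimage_symm t.open_baseSet

lemma domain_subset (e : OpenPartialHomeomorph M E) (t : Trivialization ℂ (π ℂ L)) :
    domain e t ⊆ e.target := Set.inter_subset_left

lemma contDiffOn_delForm {ℓ : E → ℝ} {W : Set E} (hW : IsOpen W) (hℓ : ContDiffOn ℝ ∞ ℓ W) :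
    ContDiffOn ℝ ∞ (delForm ℓ) W := by
  have h1 : ContDiffOn ℝ ∞ (fderiv ℝ ℓ) W := hℓ.fderiv_of_isOpen hW (by simp)
  have h2 : ContDiffOn ℝ ∞ (fun y => Complex.ofRealCLM.comp (fderiv ℝ ℓ y)) W :=
    contDiffOn_const.clm_comp h1
  have h3 : ContDiffOn ℝ ∞ (fun y => Complex.ofRealCLM.comp ((fderiv ℝ ℓ y).comp (mulI E))) W :=
    contDiffOn_const.clm_comp (h1.clm_comp contDiffOn_const)
  exact (contDiffOn_const (c := (1 / 2 : ℂ))).smul (h2.sub ((contDiffOn_const (c :=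
      Complex.I)).smul h3))

/-- The differential of `½ (dℓ - i dℓ ∘ i)`. -/
lemma fderiv_delForm {ℓ : E → ℝ} {W : Set E} (hW : IsOpen W) (hℓ : ContDiffOn ℝ ∞ ℓ W) {y : E}
    (hy : y ∈ W) (v w : E) : fderiv ℝ (delForm ℓ) y v w
      = (1 / 2) * ((fderiv ℝ (fderiv ℝ ℓ) y v w : ℂ)
        - Complex.I * (fderiv ℝ (fderiv ℝ ℓ) y v (Complex.I • w) : ℂ)) := by
  have hd : DifferentiableAt ℝ (fderiv ℝ ℓ) y :=
    ((hℓ.fderiv_of_isOpen hW (m := ∞)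
        (by simp)).contDiffAt (hW.mem_nhds hy)).differentiableAt (by simp)
  have hd' : DifferentiableAt ℝ (delForm ℓ) y :=
    ((contDiffOn_delForm hW hℓ).contDiffAt (hW.mem_nhds hy)).differentiableAt (by simp)
  have e1 : fderiv ℝ (delForm ℓ) y v w = fderiv ℝ (fun z => delForm ℓ z w) y v := by
    rw [fderiv_clm_apply hd' (differentiableAt_const w)]; simp
  have h : ∀ w, HasFDerivAt (fun z => (fderiv ℝ ℓ z w : ℂ))
      (Complex.ofRealCLM.comp ((fderiv ℝ (fderiv ℝ ℓ) y).flip w)) y := fun w => by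
    have h1 := hd.hasFDerivAt.clm_apply (hasFDerivAt_const w y)
    exact Complex.ofRealCLM.hasFDerivAt.comp y (by simpa using! h1)
  have h2 := (((h w).sub ((h (Complex.I • w)).const_mul Complex.I)).const_mul (1 / 2)).fderiv
  rw [e1]
  refine (congrArg (fun T : E →L[ℝ] ℂ => T v) h2).trans ?_
  simp

variable [IsManifold 𝓘(ℂ, E) ω M] [VectorBundle ℂ ℂ L] [ContMDiffVectorBundle ω ℂ L 𝓘(ℂ, E)]
  {e : OpenPartialHomeomorph M E} (he : e ∈ atlas E M)
  {t : Trivialization ℂ (π ℂ L)} [MemTrivializationAtlas t]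

include he in
lemma contDiffAt_coord {y : E} (hy : y ∈ domain e t) {ψ : Π x, L x}
    (hψ : SmoothSectionAt E ψ (e.symm y)) : ContDiffAt ℝ ∞ (coord t ψ ∘ e.symm) y :=
  (((smoothSectionAt_iff hy.2).1 hψ).comp y (contMDiffAt_chart_symm he hy.1)).contDiffAt

include he in
lemma contDiffOn_frameNormSq (hh : IsSmoothHermitian E L) :
    ContDiffOn ℝ ∞ (frameNormSq e t) (domain e t) := by
  intro y hy
  have h1 := (hh t).contMDiffAt (t.open_baseSet.mem_nhds hy.2)
  exact (ContMDiffAt.comp (g := fun x => ‖t.symm x (1 : ℂ)‖ ^ 2) y h1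
    (contMDiffAt_chart_symm he hy.1)).contDiffAt.contDiffWithinAt

omit [IsManifold 𝓘(ℂ, E) ω M] [ContMDiffVectorBundle ω ℂ L 𝓘(ℂ, E)] in
lemma frameNormSq_pos {y : E} (hy : y ∈ domain e t) : 0 < frameNormSq e t y :=
  pow_pos (norm_pos_iff.2 (frame_ne_zero hy.2)) 2

include he in
lemma contDiffOn_log_frameNormSq (hh : IsSmoothHermitian E L) :
    ContDiffOn ℝ ∞ (fun y => Real.log (frameNormSq e t y)) (domain e t) :=
  (contDiffOn_frameNormSq he hh).log fun _ hy => (frameNormSq_pos hy).ne'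

include he in
lemma contDiffOn_connForm (hh : IsSmoothHermitian E L) :
    ContDiffOn ℝ ∞ (connForm e t) (domain e t) :=
  contDiffOn_delForm (isOpen_domain e t) (contDiffOn_log_frameNormSq he hh)

/-- The connection `d + θ` is compatible with the metric. -/
lemma fderiv_frameNormSq (he : e ∈ atlas E M) (hh : IsSmoothHermitian E L) {y : E}
    (hy : y ∈ domain e t) (v : E) :
    (fderiv ℝ (frameNormSq e t) y v : ℂ)
      = frameNormSq e t y * (star (connForm e t y v) + connForm e t y v) := by
  have hpos := (frameNormSq_pos hy).ne'
  have h1 : DifferentiableAt ℝ (frameNormSq e t) y :=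
    ((contDiffOn_frameNormSq he hh).contDiffAt
      ((isOpen_domain e t).mem_nhds hy)).differentiableAt (by simp)
  have h2 : fderiv ℝ (fun y => Real.log (frameNormSq e t y)) y
      = (frameNormSq e t y)⁻¹ • fderiv ℝ (frameNormSq e t) y := (h1.hasFDerivAt.log hpos).fderiv
  simp only [connForm, delForm_apply, h2, smul_apply, smul_eq_mul]
  have h3 : (frameNormSq e t y : ℂ) ≠ 0 := Complex.ofReal_ne_zero.2 hpos
  simp only [star_mul', star_sub, Complex.star_def, Complex.conj_ofReal, Complex.conj_I, map_div₀,
    map_one, map_ofNat]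
  push_cast
  field_simp
  ring

variable {D : CovariantDerivative 𝓘(ℝ, E) ℂ L} (hD : IsCompatible D)

lemma cov_congr {x : M} {φ ψ : Π x, L x} (hφ : SmoothSectionAt E φ x)
    (h : ∀ᶠ z in 𝓝 x, ψ z = φ z) : D ψ x = D φ x :=
  (D.isCovariantDerivativeOn (s := Set.univ)).congr_of_eventuallyEq (hφ.congr h).mdifferentiableAt
    hφ.mdifferentiableAt univ_mem h

lemma cov_add {x : M} {φ ψ : Π x, L x} (hφ : SmoothSectionAt E φ x) (hψ : SmoothSectionAt E ψ x) :
    D (fun x => φ x + ψ x) x = D φ x + D ψ x :=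
  D.isCovariantDerivativeOnUniv.add hφ.mdifferentiableAt hψ.mdifferentiableAt

lemma cov_real_smul {x : M} {ψ : Π x, L x} {g : M → ℝ} (hg : ContMDiffAt 𝓘(ℝ, E) 𝓘(ℝ, ℝ) ∞ g x)
    (hψ : SmoothSectionAt E ψ x) (v : TangentSpace 𝓘(ℝ, E) x) :
    D (fun x => (g x : ℂ) • ψ x) x v
      = (g x : ℂ) • D ψ x v + (mvfderiv 𝓘(ℝ, E) g x v : ℂ) • ψ x := by
  have h := D.isCovariantDerivativeOnUniv.leibniz hψ.mdifferentiableAt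
    (hg.mdifferentiableAt (by simp))
  have h2 := congrArg (fun T : TangentSpace 𝓘(ℝ, E) x →L[ℝ] L x => T v) h
  exact h2

omit [IsManifold 𝓘(ℂ, E) ω M] in
lemma mvfderiv_clm_comp {F G : Type*} [NormedAddCommGroup F] [NormedSpace ℝ F]
    [NormedAddCommGroup G] [NormedSpace ℝ G] (T : F →L[ℝ] G) {g : M → F} {x : M}
    (hg : MDifferentiableAt 𝓘(ℝ, E) 𝓘(ℝ, F) g x)
    (v : TangentSpace 𝓘(ℝ, E) x) :
    mvfderiv 𝓘(ℝ, E) (fun x => T (g x)) x v = T (mvfderiv 𝓘(ℝ, E) g x v) := by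
  have h := mfderiv_comp x T.differentiableAt.mdifferentiableAt hg
  rw [mfderiv_eq_fderiv, T.fderiv] at h
  exact congrArg (fun S : TangentSpace 𝓘(ℝ, E) x →L[ℝ] G => S v) h

include hD

/-- The Leibniz rule for complex functions. -/
lemma cov_smul {x : M} {ψ : Π x, L x} {g : M → ℂ} (hg : ContMDiffAt 𝓘(ℝ, E) 𝓘(ℝ, ℂ) ∞ g x)
    (hψ : SmoothSectionAt E ψ x) (v : TangentSpace 𝓘(ℝ, E) x) :
    D (fun x => g x • ψ x) x v = g x • D ψ x v + mvfderiv 𝓘(ℝ, E) g x v • ψ x := by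
  have hre : ContMDiffAt 𝓘(ℝ, E) 𝓘(ℝ, ℝ) ∞ (fun x => (g x).re) x :=
    (Complex.reCLM.contMDiff (n := ∞)).contMDiffAt.comp x hg
  have him : ContMDiffAt 𝓘(ℝ, E) 𝓘(ℝ, ℝ) ∞ (fun x => (g x).im) x :=
    (Complex.imCLM.contMDiff (n := ∞)).contMDiffAt.comp x hg
  have hI : SmoothSectionAt E (fun x => Complex.I • ψ x) x := hψ.smul (c := fun _ => Complex.I)
      contMDiffAt_const
  have hofReal : ∀ {a : M → ℝ}, ContMDiffAt 𝓘(ℝ, E) 𝓘(ℝ, ℝ) ∞ a x →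
      ContMDiffAt 𝓘(ℝ, E) 𝓘(ℝ, ℂ) ∞ (fun x => (a x : ℂ)) x := fun h =>
    (Complex.ofRealCLM.contMDiff (n := ∞)).contMDiffAt.comp x h
  have h1 : (fun x => g x • ψ x)
      = fun x => ((g x).re : ℂ) • ψ x + ((g x).im : ℂ) • (Complex.I • ψ x) := by
    ext x
    rw [smul_smul, ← add_smul, Complex.re_add_im]
  have hg' := hg.mdifferentiableAt (by simp)
  have hmre : mvfderiv 𝓘(ℝ, E) (fun x => (g x).re) x v = (mvfderiv 𝓘(ℝ, E) g x v).re :=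
    mvfderiv_clm_comp Complex.reCLM hg' v
  have hmim : mvfderiv 𝓘(ℝ, E) (fun x => (g x).im) x v = (mvfderiv 𝓘(ℝ, E) g x v).im :=
    mvfderiv_clm_comp Complex.imCLM hg' v
  rw [h1, cov_add (hψ.smul (hofReal hre)) (hI.smul (hofReal him)), add_apply, cov_real_smul hre hψ,
    cov_real_smul him hI, hD.smul x ψ hψ, hmre, hmim]
  conv_rhs => rw [← Complex.re_add_im (g x), ← Complex.re_add_im (mvfderiv 𝓘(ℝ, E) g x v)]
  module

/-- The connection in a holomorphic frame `s`. Compatibility with the metric gives the real part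
`½ d log ‖s‖²` of the connection form, and `∇_{Z̄} s = 0` then determines its imaginary part. -/
lemma cov_frame (he : e ∈ atlas E M) (hh : IsSmoothHermitian E L) {y : E} (hy : y ∈ domain e t)
    (v : E) :
    D (frame t) (e.symm y) (coordField e v (e.symm y)) = connForm e t y v • frame t (e.symm y) := by
  set x := e.symm y with hxdef
  have hx : x ∈ e.source := e.map_target hy.1
  have hs : SmoothSectionAt E (frame t) x := smoothSectionAt_frame hy.2
  -- the connection form in the frame
  set α : E → ℂ := fun v => (t (TotalSpace.mk' ℂ x (D (frame t) x (coordField e v x)))).2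
  have hα : ∀ v, D (frame t) x (coordField e v x) = α v • frame t x := by
    intro v
    have h1 := t.symm_apply_apply_mk hy.2 (D (frame t) x (coordField e v x))
    have h2 := (t.symmₗ ℂ x).map_smul (α v) (1 : ℂ)
    rw [smul_eq_mul, mul_one, t.symmₗ_apply hy.2, t.symmₗ_apply hy.2] at h2
    exact h1.symm.trans h2
  have hH : DifferentiableAt ℝ (frameNormSq e t) y :=
    ((contDiffOn_frameNormSq he hh).contDiffAt
      ((isOpen_domain e t).mem_nhds hy)).differentiableAt (by simp)
  have hpos := frameNormSq_pos hy
  have hmetric : ∀ v, (fderiv ℝ (frameNormSq e t) y v : ℂ)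
      = (star (α v) + α v) * frameNormSq e t y := by
    intro v
    have h1 := hD.metric x (frame t) (frame t) hs hs (coordField e v x)
    have hsm : ContMDiffAt 𝓘(ℝ, E) 𝓘(ℝ, ℂ) ∞
        (fun x => (inner ℂ (frame t x) (frame t x) : ℂ)) x := by
      have h2 : ContMDiffAt 𝓘(ℝ, E) 𝓘(ℝ, ℂ) ∞ (fun x => ((‖t.symm x (1 : ℂ)‖ ^ 2 : ℝ) : ℂ)) x :=
        (Complex.ofRealCLM.contMDiff (n := ∞)).contMDiffAt.comp x
          ((hh t).contMDiffAt (t.open_baseSet.mem_nhds hy.2))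
      refine h2.congr_of_eventuallyEq (Filter.Eventually.of_forall fun z => ?_)
      simp only [inner_self_eq_norm_sq_to_K, frame]
      push_cast; rfl
    rw [← fderiv_comp_chart_symm he hy.1 (hsm.mdifferentiableAt (by simp)), hα, inner_smul_left,
      inner_smul_right, inner_self_eq_norm_sq_to_K] at h1
    have h3 : (fun x => (inner ℂ (frame t x) (frame t x) : ℂ)) ∘ e.symm
        = fun y => (frameNormSq e t y : ℂ) := by
      ext z
      simp only [Function.comp_apply, inner_self_eq_norm_sq_to_K, frameNormSq]
      push_cast; rfl
    have h4 : fderiv ℝ (fun y => (frameNormSq e t y : ℂ)) y v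
        = (fderiv ℝ (frameNormSq e t) y v : ℂ) := by
      have := (Complex.ofRealCLM.hasFDerivAt.comp y hH.hasFDerivAt).fderiv
      exact congrArg (fun T : E →L[ℝ] ℂ => T v) this
    rw [h3, h4] at h1
    rw [h1, add_mul, frameNormSq]
    push_cast; rfl
  -- apply `∇_{Z̄} s = 0` to `Z̄ = v + i J v`
  have hhol : ∀ v, α v + Complex.I * α (Complex.I • v) = 0 := by
    intro v
    have h1 := hD.holomorphic x (frame t) (holomorphicSectionAt_frame hy.2)
      ⟨coordField e v x, coordField e (Complex.I • v) x⟩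
      ⟨J_coordField he hx v, by
        change J x (coordField e (Complex.I • v) x) = - coordField e v x
        rw [J_coordField he hx, smul_smul, Complex.I_mul_I, neg_one_smul, ← coordEquiv_apply he hx,
          map_neg, coordEquiv_apply he hx]⟩
    change D (frame t) x (coordField e v x)
      + Complex.I • D (frame t) x (coordField e (Complex.I • v) x) = 0 at h1
    rw [hα, hα, smul_smul, ← add_smul] at h1
    exact (smul_eq_zero.1 h1).resolve_right (frame_ne_zero hy.2)
  have hlog : ∀ v, fderiv ℝ (fun y => Real.log (frameNormSq e t y)) y v = 2 * (α v).re := by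
    intro v
    have h2 : fderiv ℝ (fun y => Real.log (frameNormSq e t y)) y
      = (frameNormSq e t y)⁻¹ • fderiv ℝ (frameNormSq e t) y := (hH.hasFDerivAt.log hpos.ne').fderiv
    have h3 : fderiv ℝ (frameNormSq e t) y v = 2 * (α v).re * frameNormSq e t y := by
      have := congrArg Complex.re (hmetric v)
      simp at this
      rw [this]; ring
    rw [h2, smul_apply, h3, smul_eq_mul]
    field_simp
  rw [hα v]
  congr 1
  rw [connForm, delForm_apply, hlog, hlog]
  have h1 := hhol v
  have hre := congrArg Complex.re h1
  have him := congrArg Complex.im h1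
  simp at hre him
  apply Complex.ext
  · simp
  · simp; linarith

/-- The connection in a chart and a holomorphic frame. -/
lemma cov_eq (he : e ∈ atlas E M) (hh : IsSmoothHermitian E L) {y : E} (hy : y ∈ domain e t)
    {ψ : Π x, L x} (hψ : SmoothSectionAt E ψ (e.symm y)) (v : E) :
    D ψ (e.symm y) (coordField e v (e.symm y))
      = covDeriv (connForm e t) (coord t ψ ∘ e.symm) y v • frame t (e.symm y) := by
  have hc := (smoothSectionAt_iff hy.2).1 hψ
  have hs : SmoothSectionAt E (frame t) (e.symm y) := smoothSectionAt_frame hy.2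
  have h1 : ∀ᶠ z in 𝓝 (e.symm y), ψ z = coord t ψ z • frame t z := by
    filter_upwards [t.open_baseSet.mem_nhds hy.2] with z hz using (coord_smul_frame hz ψ).symm
  rw [cov_congr (hs.smul hc) h1, cov_smul hD hc hs, cov_frame hD he hh hy,
    ← fderiv_comp_chart_symm he hy.1 (hc.mdifferentiableAt (by simp)), covDeriv, smul_smul,
        ← add_smul]
  congr 1
  rw [Function.comp_apply]
  ring

end ConnForm

/-! ### Pointwise traces -/

section Pointwise

/-- Orthonormal bases for an inner product that is not given by an instance on the space. -/
lemma exists_core_orthonormal {V : Type*} [AddCommGroup V] [Module ℂ V] [FiniteDimensional ℂ V]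
    (c : InnerProductSpace.Core ℂ V) :
    ∃ b : Fin (Module.finrank ℂ V) → V, ∀ k l, c.inner (b k) (b l) = if k = l then 1 else 0 := by
  let _ : NormedAddCommGroup V := c.toNormedAddCommGroup
  let _ : InnerProductSpace ℂ V := InnerProductSpace.ofCore c.toCore
  exact ⟨stdOrthonormalBasis ℂ V, orthonormal_iff_ite.1 (stdOrthonormalBasis ℂ V).orthonormal⟩

variable {E : Type*} [NormedAddCommGroup E] [NormedSpace ℂ E] [FiniteDimensional ℂ E]
  {M : Type*} [TopologicalSpace M] [ChartedSpace E M]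
  [RiemannianBundle (fun x : M => TangentSpace 𝓘(ℝ, E) x)]
  [IsManifold 𝓘(ℂ, E) ω M]

/-- `J` as a linear map. -/
def JLin (x : M) : TangentSpace 𝓘(ℝ, E) x →ₗ[ℝ] TangentSpace 𝓘(ℝ, E) x :=
  (LinearMap.lsmul ℂ E Complex.I).restrictScalars ℝ

lemma JLin_apply (x : M) (v : TangentSpace 𝓘(ℝ, E) x) : JLin x v = J x v := rfl

lemma J_J (x : M) (v : TangentSpace 𝓘(ℝ, E) x) : J x (J x v) = -v := by
  have h : ∀ w : E, Complex.I • Complex.I • w = -w := fun w => by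
    rw [smul_smul, Complex.I_mul_I, neg_one_smul]
  exact h v

lemma J_smul (x : M) (r : ℝ) (v : TangentSpace 𝓘(ℝ, E) x) : J x (r • v) = r • J x v :=
  (JLin x).map_smul r v

/-- The Hermitian form `⟨v, w⟩ = g(v, w) - i g(v, J w)`. -/
def tangentHermitian (x : M) (v w : TangentSpace 𝓘(ℝ, E) x) : ℂ :=
  ((inner ℝ v w : ℝ) : ℂ) - Complex.I * ((inner ℝ v (J x w) : ℝ) : ℂ)

variable (hg : IsKahler E M)
include hg

lemma inner_J_left (x : M) (v w : TangentSpace 𝓘(ℝ, E) x) :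
    (inner ℝ (J x v) w : ℝ) = - inner ℝ v (J x w) := by
  rw [← hg.hermitian x (J x v) w, J_J, inner_neg_left]

lemma inner_J_self (x : M) (v : TangentSpace 𝓘(ℝ, E) x) : (inner ℝ v (J x v) : ℝ) = 0 := by
  have := inner_J_left hg x v v
  rw [real_inner_comm] at this
  linarith

lemma tangentHermitian_conj_symm (x : M) (v w : TangentSpace 𝓘(ℝ, E) x) :
    starRingEnd ℂ (tangentHermitian x w v) = tangentHermitian x v w := by
  have h := inner_J_left hg x v w
  simp only [tangentHermitian, map_sub, map_mul, Complex.conj_ofReal, Complex.conj_I]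
  rw [real_inner_comm, real_inner_comm (J x v), h]
  push_cast; ring

lemma tangentHermitian_self (x : M) (v : TangentSpace 𝓘(ℝ, E) x) :
    tangentHermitian x v v = ((inner ℝ v v : ℝ) : ℂ) := by
  rw [tangentHermitian, inner_J_self hg]
  simp

omit hg in
lemma tangentHermitian_add_left (x : M) (u v w : TangentSpace 𝓘(ℝ, E) x) :
    tangentHermitian x (u + v) w = tangentHermitian x u w + tangentHermitian x v w := by
  simp only [tangentHermitian, inner_add_left]
  push_cast; ring

lemma tangentHermitian_smul_left (x : M) (v w : TangentSpace 𝓘(ℝ, E) x) (r : ℂ) :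
    tangentHermitian x (r.re • v + r.im • J x v) w
      = starRingEnd ℂ r * tangentHermitian x v w := by
  conv_rhs => rw [← Complex.re_add_im r]
  simp only [tangentHermitian, inner_add_left, real_inner_smul_left, inner_J_left hg, J_J,
    inner_neg_right, map_add, map_mul, Complex.conj_ofReal, Complex.conj_I]
  push_cast
  linear_combination (-(r.im : ℂ) * (inner ℝ v (J x w) : ℝ)) * Complex.I_sq

/-- The Hermitian inner product on the tangent space, identified with the model space, whose real
part is the Riemannian metric. -/
@[reducible] def hermitianCore (x : M) : InnerProductSpace.Core ℂ E where
  inner := tangentHermitian x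
  conj_inner_symm v w := tangentHermitian_conj_symm hg x v w
  re_inner_nonneg v := by
    have h : ∀ v' : TangentSpace 𝓘(ℝ, E) x, 0 ≤ RCLike.re (tangentHermitian x v' v') := fun v' => by
      rw [tangentHermitian_self hg]
      exact real_inner_self_nonneg (x := v')
    exact h v
  add_left u v w := tangentHermitian_add_left x u v w
  smul_left v w r := by
    have h0 : r • v = r.re • v + r.im • (Complex.I • v) := by
      conv_lhs => rw [← Complex.re_add_im r, add_smul, mul_smul]
      rfl
    exact (congrArg (fun u : E => tangentHermitian x u w) h0).trans
      (tangentHermitian_smul_left hg x v w r)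
  definite v h := by
    have h2 : ∀ v' : TangentSpace 𝓘(ℝ, E) x, tangentHermitian x v' v' = 0 → v' = 0 :=
      fun v' h' => by
        rw [tangentHermitian_self hg] at h'
        exact inner_self_eq_zero.1 (Complex.ofReal_eq_zero.1 h')
    exact h2 v h

lemma exists_isAntiholomorphicONB (x : M) :
    ∃ Z : Fin (Module.finrank ℂ E) → CTangent E x, IsAntiholomorphicONB x Z := by
  obtain ⟨b, hb⟩ : ∃ b : Fin (Module.finrank ℂ E) → TangentSpace 𝓘(ℝ, E) x,
      ∀ k l, tangentHermitian x (b k) (b l) = if k = l then 1 else 0 :=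
    exists_core_orthonormal (hermitianCore hg x)
  have hre : ∀ k l, (inner ℝ (b k) (b l) : ℝ) = if k = l then 1 else 0 := fun k l => by
    have := congrArg Complex.re (hb k l)
    simp only [tangentHermitian] at this
    split_ifs at this ⊢ <;> simpa using this
  have him : ∀ k l, (inner ℝ (b k) (J x (b l)) : ℝ) = 0 := fun k l => by
    have := congrArg Complex.im (hb k l)
    simp only [tangentHermitian] at this
    split_ifs at this <;> simpa using this
  have hs : (√2)⁻¹ * (√2)⁻¹ = (1 / 2 : ℝ) := by
    rw [← mul_inv, Real.mul_self_sqrt (by norm_num)]; norm_num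
  refine ⟨fun k => ⟨(√2)⁻¹ • b k, (√2)⁻¹ • J x (b k)⟩, fun k => ⟨J_smul _ _ _, ?_⟩, fun k l => ?_⟩
  · change J x ((√2)⁻¹ • J x (b k)) = -((√2)⁻¹ • b k)
    rw [J_smul, J_J, smul_neg]
  · simp only [cMetric, real_inner_smul_left, real_inner_smul_right, hg.hermitian, inner_J_left hg,
      hre, him]
    split_ifs
    · rw [mul_one, hs]; norm_num
    · simp

/-- An antiholomorphic orthonormal basis comes from a real orthonormal basis of the form
`(E_k, J E_k)`, with `Z̄_k = (E_k + i J E_k) / √2`. -/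
lemma IsAntiholomorphicONB.exists_orthonormalBasis {x : M}
    {Z : Fin (Module.finrank ℂ E) → CTangent E x} (hZ : IsAntiholomorphicONB x Z) :
    ∃ f : OrthonormalBasis (Fin (Module.finrank ℂ E) ⊕ Fin (Module.finrank ℂ E)) ℝ
      (TangentSpace 𝓘(ℝ, E) x),
      ∀ k, f (Sum.inl k) = √2 • (Z k).re ∧ f (Sum.inr k) = √2 • J x (Z k).re := by
  have him : ∀ k, (Z k).im = J x (Z k).re := fun k => (hZ.1 k).1.symm
  have h1 : ∀ k l, 2 * (inner ℝ (Z k).re (Z l).re : ℝ) = if k = l then 1 else 0 := fun k l => by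
    have := congrArg Complex.re (hZ.2 k l)
    simp only [cMetric, him, hg.hermitian, inner_J_left hg] at this
    split_ifs at this ⊢ <;> simp at this <;> linarith
  have h2 : ∀ k l, (inner ℝ (Z k).re (J x (Z l).re) : ℝ) = 0 := fun k l => by
    have := congrArg Complex.im (hZ.2 k l)
    simp only [cMetric, him, hg.hermitian, inner_J_left hg] at this
    split_ifs at this <;> simp at this <;> linarith
  have hs : √2 * √2 = (2 : ℝ) := Real.mul_self_sqrt (by norm_num)
  let g : Fin (Module.finrank ℂ E) ⊕ Fin (Module.finrank ℂ E) → TangentSpace 𝓘(ℝ, E) x :=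
    Sum.elim (fun k => √2 • (Z k).re) fun k => √2 • J x (Z k).re
  have hon : Orthonormal ℝ g := by
    rw [orthonormal_iff_ite]
    rintro (k | k) (l | l) <;>
    simp only [g, Sum.elim_inl, Sum.elim_inr, real_inner_smul_left, real_inner_smul_right,
      hg.hermitian, inner_J_left hg, h2, ← mul_assoc, hs, h1, mul_zero, neg_zero, Sum.inl.injEq,
      Sum.inr.injEq, reduceCtorEq, if_false]
  have hcard : Fintype.card (Fin (Module.finrank ℂ E) ⊕ Fin (Module.finrank ℂ E))
      = Module.finrank ℝ (TangentSpace 𝓘(ℝ, E) x) := by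
    have h3 : Module.finrank ℝ (TangentSpace 𝓘(ℝ, E) x) = Module.finrank ℝ E := rfl
    rw [h3, finrank_real_of_complex, Fintype.card_sum, Fintype.card_fin, two_mul]
  refine ⟨OrthonormalBasis.mk hon
    (hon.linearIndependent.span_eq_top_of_card_eq_finrank' hcard).ge, fun k => ?_⟩
  simp [g]

/-- The Riemannian trace in terms of an antiholomorphic orthonormal basis. -/
lemma IsAntiholomorphicONB.sum_add {F κ : Type*} [AddCommGroup F] [Module ℝ F] [Fintype κ] {x : M}
    {Z : Fin (Module.finrank ℂ E) → CTangent E x} (hZ : IsAntiholomorphicONB x Z)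
    (f : OrthonormalBasis κ ℝ (TangentSpace 𝓘(ℝ, E) x))
    (B : TangentSpace 𝓘(ℝ, E) x →ₗ[ℝ] TangentSpace 𝓘(ℝ, E) x →ₗ[ℝ] F) :
    ∑ k, (B (Z k).re (Z k).re + B (J x (Z k).re) (J x (Z k).re))
      = (1 / 2 : ℝ) • ∑ i, B (f i) (f i) := by
  obtain ⟨f', hf'⟩ := hZ.exists_orthonormalBasis hg
  have hs : √2 * √2 = (2 : ℝ) := Real.mul_self_sqrt (by norm_num)
  rw [sum_orthonormalBasis_eq f f', Fintype.sum_sum_type, ← Finset.sum_add_distrib, Finset.smul_sum]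
  refine Finset.sum_congr rfl fun k _ => ?_
  simp only [(hf' k).1, (hf' k).2, map_smul, LinearMap.smul_apply, smul_smul, hs, smul_add]
  norm_num

/-- The twisted Riemannian trace in terms of an antiholomorphic orthonormal basis. -/
lemma IsAntiholomorphicONB.sum_sub {F κ : Type*} [AddCommGroup F] [Module ℝ F] [Fintype κ] {x : M}
    {Z : Fin (Module.finrank ℂ E) → CTangent E x} (hZ : IsAntiholomorphicONB x Z)
    (f : OrthonormalBasis κ ℝ (TangentSpace 𝓘(ℝ, E) x))
    (B : TangentSpace 𝓘(ℝ, E) x →ₗ[ℝ] TangentSpace 𝓘(ℝ, E) x →ₗ[ℝ] F) :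
    ∑ k, (B (Z k).re (J x (Z k).re) - B (J x (Z k).re) (Z k).re)
      = (1 / 2 : ℝ) • ∑ i, B (f i) (J x (f i)) := by
  have h := hZ.sum_add hg f (B.compl₂ (JLin x))
  simp only [LinearMap.compl₂_apply, JLin_apply, J_J, map_neg] at h
  simpa only [sub_eq_add_neg] using h

end Pointwise

section Integrands

variable {E : Type*} [NormedAddCommGroup E] [NormedSpace ℂ E] [FiniteDimensional ℂ E]
  {M : Type*} [TopologicalSpace M] [ChartedSpace E M]
  [RiemannianBundle (fun x : M => TangentSpace 𝓘(ℝ, E) x)]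
  {L : M → Type*} [TopologicalSpace (TotalSpace ℂ L)]
  [∀ x, NormedAddCommGroup (L x)] [∀ x, InnerProductSpace ℂ (L x)]
  [FiberBundle ℂ L]

/-- The integrand of the Bochner form. -/
def bochnerDensity (D : CovariantDerivative 𝓘(ℝ, E) ℂ L) (φ ψ : Π x, L x) (x : M) : ℂ :=
  ∑ k, inner ℂ (D φ x (stdOrthonormalBasis ℝ (TangentSpace 𝓘(ℝ, E) x) k))
    (D ψ x (stdOrthonormalBasis ℝ (TangentSpace 𝓘(ℝ, E) x) k))

/-- The density `∑ h(∇_e φ, ∇_{J e} ψ)`, the trace being taken in an orthonormal basis. -/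
def twistedDensity (D : CovariantDerivative 𝓘(ℝ, E) ℂ L) (φ ψ : Π x, L x) (x : M) : ℂ :=
  ∑ k, inner ℂ (D φ x (stdOrthonormalBasis ℝ (TangentSpace 𝓘(ℝ, E) x) k))
    (D ψ x (J x (stdOrthonormalBasis ℝ (TangentSpace 𝓘(ℝ, E) x) k)))

/-- The integrand of the holomorphic form. -/
def holomorphicDensity (D : CovariantDerivative 𝓘(ℝ, E) ℂ L) (φ ψ : Π x, L x) (x : M) : ℂ :=
  ∑ k, inner ℂ (cCov D (antiholomorphicBasis E k) φ x) (cCov D (antiholomorphicBasis E k) ψ x)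

/-- The real bilinear map `(v, w) ↦ h(A v, C w)`. -/
def innerComp {V : Type*} [AddCommGroup V] [Module ℝ V] [TopologicalSpace V] {x : M}
    (A C : V →L[ℝ] L x) : V →ₗ[ℝ] V →ₗ[ℝ] ℂ :=
  LinearMap.mk₂ ℝ (fun v w => inner ℂ (A v) (C w))
    (fun u v w => by simp only [map_add, inner_add_left])
    (fun c v w => by
      rw [map_smul, ← Complex.coe_smul, inner_smul_left, Complex.conj_ofReal]; rfl)
    (fun u v w => by simp only [map_add, inner_add_right])
    (fun c v w => by
      rw [map_smul, ← Complex.coe_smul, inner_smul_right]; rfl)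

lemma innerComp_apply {V : Type*} [AddCommGroup V] [Module ℝ V] [TopologicalSpace V] {x : M}
    (A C : V →L[ℝ] L x) (v w : V) : innerComp A C v w = inner ℂ (A v) (C w) := rfl

variable [IsManifold 𝓘(ℂ, E) ω M] (hg : IsKahler E M) (D : CovariantDerivative 𝓘(ℝ, E) ℂ L)
include hg

lemma isAntiholomorphicONB_antiholomorphicBasis (x : M) :
    IsAntiholomorphicONB x fun k => antiholomorphicBasis E k x :=
  Classical.epsilon_spec (exists_isAntiholomorphicONB hg x)

lemma cCov_antiholomorphicBasis (φ : Π x, L x) (x : M) (k : Fin (Module.finrank ℂ E)) :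
    cCov D (antiholomorphicBasis E k) φ x = D φ x (antiholomorphicBasis E k x).re
      + Complex.I • D φ x (J x (antiholomorphicBasis E k x).re) := by
  rw [cCov, ((isAntiholomorphicONB_antiholomorphicBasis hg x).1 k).1]

/-- The trace over `T^(0,1)` as half the Riemannian trace plus a twisted trace. -/
lemma holomorphicDensity_eq (φ ψ : Π x, L x) (x : M) :
    holomorphicDensity D φ ψ x
      = (1 / 2) * (bochnerDensity D φ ψ x + Complex.I * twistedDensity D φ ψ x) := by
  have hZ := isAntiholomorphicONB_antiholomorphicBasis hg x
  have h1 := hZ.sum_add hg (stdOrthonormalBasis ℝ (TangentSpace 𝓘(ℝ, E) x)) (innerComp (D φ x)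
      (D ψ x))
  have h2 := hZ.sum_sub hg (stdOrthonormalBasis ℝ (TangentSpace 𝓘(ℝ, E) x)) (innerComp (D φ x)
      (D ψ x))
  simp only [innerComp_apply] at h1 h2
  rw [← bochnerDensity] at h1
  rw [← twistedDensity] at h2
  have h3 : holomorphicDensity D φ ψ x = (1 / 2 : ℝ) • bochnerDensity D φ ψ x
      + Complex.I * ((1 / 2 : ℝ) • twistedDensity D φ ψ x) := by
    rw [← h1, ← h2, Finset.mul_sum, ← Finset.sum_add_distrib, holomorphicDensity]
    refine Finset.sum_congr rfl fun k _ => ?_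
    rw [cCov_antiholomorphicBasis hg, cCov_antiholomorphicBasis hg]
    simp only [inner_add_left, inner_add_right, inner_smul_left, inner_smul_right, Complex.conj_I]
    linear_combination (-inner ℂ (D φ x (J x (antiholomorphicBasis E k x).re))
      (D ψ x (J x (antiholomorphicBasis E k x).re)) : ℂ) * Complex.I_sq
  rw [h3, Complex.real_smul, Complex.real_smul]
  push_cast; ring

/-- The holomorphic energy density is dominated by the Bochner energy density. -/
lemma holomorphicDensity_self_le (φ : Π x, L x) (x : M) :
    ∃ r R : ℝ, holomorphicDensity D φ φ x = r ∧ bochnerDensity D φ φ x = R ∧ 0 ≤ r ∧ r ≤ R := by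
  have hZ := isAntiholomorphicONB_antiholomorphicBasis hg x
  have h1 := hZ.sum_add hg (stdOrthonormalBasis ℝ (TangentSpace 𝓘(ℝ, E) x)) (innerComp (D φ x)
      (D φ x))
  simp only [innerComp_apply] at h1
  rw [← bochnerDensity] at h1
  have hself : ∀ w : L x, inner ℂ w w = ((‖w‖ ^ 2 : ℝ) : ℂ) := fun w => by
    rw [inner_self_eq_norm_sq_to_K]; push_cast; rfl
  simp only [hself] at h1
  refine ⟨∑ k, ‖cCov D (antiholomorphicBasis E k) φ x‖ ^ 2, 2 * ∑ k,
    (‖D φ x (antiholomorphicBasis E k x).re‖ ^ 2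
      + ‖D φ x (J x (antiholomorphicBasis E k x).re)‖ ^ 2),
    ?_, ?_, Finset.sum_nonneg fun k _ => by positivity, ?_⟩
  · simp only [holomorphicDensity, hself]; push_cast; rfl
  · rw [Complex.real_smul] at h1
    push_cast at h1 ⊢
    rw [h1]; ring
  · rw [Finset.mul_sum]
    refine Finset.sum_le_sum fun k _ => ?_
    rw [cCov_antiholomorphicBasis hg]
    have h2 := norm_add_le (D φ x (antiholomorphicBasis E k x).re)
      (Complex.I • D φ x (J x (antiholomorphicBasis E k x).re))
    rw [norm_smul, Complex.norm_I, one_mul] at h2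
    nlinarith [sq_nonneg (‖D φ x (antiholomorphicBasis E k x).re‖
      - ‖D φ x (J x (antiholomorphicBasis E k x).re)‖),
          norm_nonneg (D φ x (antiholomorphicBasis E k x).re
      + Complex.I • D φ x (J x (antiholomorphicBasis E k x).re))]

end Integrands

/-! ### Curvature -/

section FlatCurvature

variable {E : Type*} [NormedAddCommGroup E] [NormedSpace ℝ E]

/-- The exterior derivative `dθ` of a one-form, as a bilinear map, with the convention
`dθ(v, w) = Dθ(v)(w) - Dθ(w)(v)`, without a factor `½`. -/
def extDeriv (θ : E → E →L[ℝ] ℂ) (y : E) : E →L[ℝ] E →L[ℝ] ℂ := fderiv ℝ θ y - (fderiv ℝ θ y).flip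

lemma extDeriv_apply (θ : E → E →L[ℝ] ℂ) (y v w : E) :
    extDeriv θ y v w = fderiv ℝ θ y v w - fderiv ℝ θ y w v := rfl

lemma extDeriv_self (θ : E → E →L[ℝ] ℂ) (y v : E) : extDeriv θ y v v = 0 := by
  rw [extDeriv_apply, sub_self]

lemma contDiffAt_covDeriv {θ : E → E →L[ℝ] ℂ} {u : E → ℂ} {X : E → E} {y : E}
    (hθ : ContDiffAt ℝ ∞ θ y) (hu : ContDiffAt ℝ ∞ u y) (hX : ContDiffAt ℝ ∞ X y) :
    ContDiffAt ℝ ∞ (fun z => covDeriv θ u z (X z)) y :=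
  ((hu.fderiv_right (m := ∞) (by simp)).clm_apply hX).add ((hθ.clm_apply hX).mul hu)

/-- The curvature of the connection `d + θ` of a line bundle is `dθ`; the term `θ ∧ θ` vanishes. -/
lemma covDeriv_commutator {θ : E → E →L[ℝ] ℂ} {u : E → ℂ} {X Y : E → E} {y : E}
    (hθ : ContDiffAt ℝ ∞ θ y) (hu : ContDiffAt ℝ ∞ u y) (hX : ContDiffAt ℝ ∞ X y)
    (hY : ContDiffAt ℝ ∞ Y y) :
    covDeriv θ (fun z => covDeriv θ u z (Y z)) y (X y)
      - covDeriv θ (fun z => covDeriv θ u z (X z)) y (Y y)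
      - covDeriv θ u y (fderiv ℝ Y y (X y) - fderiv ℝ X y (Y y))
      = extDeriv θ y (X y) (Y y) * u y := by
  have hθ' := (hθ.differentiableAt (by simp)).hasFDerivAt
  have hu' := (hu.differentiableAt (by simp)).hasFDerivAt
  have hu'' := ((hu.fderiv_right (m := ∞) (by simp)).differentiableAt (by simp)).hasFDerivAt
  have hsymm : fderiv ℝ (fderiv ℝ u) y (X y) (Y y) = fderiv ℝ (fderiv ℝ u) y (Y y) (X y) :=
    (hu.isSymmSndFDerivAt (by simpa using two_le_infty)).eq _ _
  have key : ∀ {Y : E → E}, ContDiffAt ℝ ∞ Y y → ∀ w,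
      fderiv ℝ (fun z => covDeriv θ u z (Y z)) y w
        = fderiv ℝ (fderiv ℝ u) y w (Y y) + fderiv ℝ u y (fderiv ℝ Y y w)
          + (θ y (Y y) * fderiv ℝ u y w
            + u y * (fderiv ℝ θ y w (Y y) + θ y (fderiv ℝ Y y w))) := by
    intro Y hY w
    have hY' := (hY.differentiableAt (by simp)).hasFDerivAt
    have h1 := (hu''.clm_apply hY').add ((hθ'.clm_apply hY').mul hu')
    have h2 : fderiv ℝ (fun z => covDeriv θ u z (Y z)) y = _ := h1.fderiv
    rw [h2]
    simp
    ring
  have hc : ∀ f v, covDeriv θ f y v = fderiv ℝ f y v + θ y v * f y := fun _ _ => rfl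
  simp only [hc, key hX, key hY, hsymm, extDeriv_apply, map_sub]
  ring

end FlatCurvature

section Curvature

variable {E : Type*} [NormedAddCommGroup E] [NormedSpace ℂ E] [FiniteDimensional ℂ E]
  {M : Type*} [TopologicalSpace M] [ChartedSpace E M]
  {L : M → Type*} [TopologicalSpace (TotalSpace ℂ L)]
  [∀ x, NormedAddCommGroup (L x)] [∀ x, InnerProductSpace ℂ (L x)]
  [FiberBundle ℂ L] [IsManifold 𝓘(ℂ, E) ω M] [VectorBundle ℂ ℂ L]
  [ContMDiffVectorBundle ω ℂ L 𝓘(ℂ, E)]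
  {e : OpenPartialHomeomorph M E} {t : Trivialization ℂ (π ℂ L)} [MemTrivializationAtlas t]
  {D : CovariantDerivative 𝓘(ℝ, E) ℂ L}

/-- The curvature form `K` of the connection, computed in the chart `e` and the trivialization `t`:
`K(v, w) = Dθ(v)(w) - Dθ(w)(v)`, without a factor `½`, where `θ` is the connection form. -/
def curvForm (e : OpenPartialHomeomorph M E) (t : Trivialization ℂ (π ℂ L)) (x : M) :
    TangentSpace 𝓘(ℝ, E) x →ₗ[ℝ] TangentSpace 𝓘(ℝ, E) x →ₗ[ℝ] ℂ :=
  LinearMap.mk₂ ℝ (fun v w => extDeriv (connForm e t) (e x) (chartDeriv e x v) (chartDeriv e x w))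
    (fun _ _ _ => by simp only [map_add, add_apply])
    (fun _ _ _ => by simp only [map_smul, smul_apply])
    (fun _ _ _ => by simp only [map_add])
    (fun _ _ _ => by simp only [map_smul])

lemma curvForm_apply (x : M) (v w : TangentSpace 𝓘(ℝ, E) x) : curvForm e t x v w
    = extDeriv (connForm e t) (e x) (chartDeriv e x v) (chartDeriv e x w) := rfl

lemma contDiffAt_connForm (he : e ∈ atlas E M) (hh : IsSmoothHermitian E L) {y : E}
    (hy : y ∈ domain e t) : ContDiffAt ℝ ∞ (connForm e t) y :=
  (contDiffOn_connForm he hh).contDiffAt ((isOpen_domain e t).mem_nhds hy)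

omit [FiniteDimensional ℂ E] [∀ x, InnerProductSpace ℂ (L x)] [IsManifold 𝓘(ℂ, E) ω M]
    [VectorBundle ℂ ℂ L]
  [ContMDiffVectorBundle ω ℂ L 𝓘(ℂ, E)] [MemTrivializationAtlas t] in
lemma map_mem_domain {x : M} (hx : x ∈ e.source) (hxt : x ∈ t.baseSet) : e x ∈ domain e t :=
  ⟨e.map_source hx, by rw [Set.mem_preimage, e.left_inv hx]; exact hxt⟩

variable (hD : IsCompatible D) (he : e ∈ atlas E M) (hh : IsSmoothHermitian E L)
include hD he hh

lemma coord_cov {y : E} (hy : y ∈ domain e t) {ψ : Π x, L x}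
    (hψ : SmoothSectionAt E ψ (e.symm y)) (X : Π x : M, TangentSpace 𝓘(ℝ, E) x) :
    coord t (fun x => D ψ x (X x)) (e.symm y)
      = covDeriv (connForm e t) (coord t ψ ∘ e.symm) y (chartField e X y) := by
  refine coord_eq_of_eq_smul hy.2 ?_
  rw [← cov_eq hD he hh hy hψ, coordField_chartField he hy.1]

lemma coord_cov_eventuallyEq {y : E} (hy : y ∈ domain e t) {ψ : Π x, L x}
    (hψ : ∀ᶠ x in 𝓝 (e.symm y), SmoothSectionAt E ψ x) (X : Π x : M, TangentSpace 𝓘(ℝ, E) x) :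
    coord t (fun x => D ψ x (X x)) ∘ e.symm
      =ᶠ[𝓝 y] fun z => covDeriv (connForm e t) (coord t ψ ∘ e.symm) z (chartField e X z) := by
  have h1 := (e.continuousAt_symm hy.1).eventually hψ
  filter_upwards [h1, (isOpen_domain e t).mem_nhds hy]
      with z hz hz' using coord_cov hD he hh hz' hz X

omit [MemTrivializationAtlas t] he in
lemma smoothSectionAt_cov {x : M} {ψ : Π x, L x} (hψ : ∀ᶠ z in 𝓝 x, SmoothSectionAt E ψ z)
    {X : Π x : M, TangentSpace 𝓘(ℝ, E) x} (hX : SmoothFieldAt X x) :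
    SmoothSectionAt E (fun z => D ψ z (X z)) x := by
  have : CompleteSpace E := FiniteDimensional.complete ℂ E
  obtain ⟨t, _, hxt⟩ := exists_trivialization (L := L) x
  have hx := mem_chart_source E x
  have he := chart_mem_atlas E x
  set e := chartAt E x
  have hy : e x ∈ domain e t := map_mem_domain hx hxt
  have hsx : e.symm (e x) = x := e.left_inv hx
  rw [smoothSectionAt_iff hxt]
  have h1 := coord_cov_eventuallyEq hD he hh hy (by rw [hsx]; exact hψ) X
  have h2 : ContDiffAt ℝ ∞ (coord t (fun x => D ψ x (X x)) ∘ e.symm) (e x) :=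
    (contDiffAt_covDeriv (contDiffAt_connForm he hh hy)
      (contDiffAt_coord he hy (by rw [hsx]; exact hψ.self_of_nhds))
      (contDiffAt_chartField he hy.1 (by rw [hsx]; exact hX))).congr_of_eventuallyEq h1
  refine (h2.contMDiffAt.comp x (contMDiffAt_chart he hx)).congr_of_eventuallyEq ?_
  filter_upwards [e.open_source.mem_nhds hx] with z hz
  simp only [Function.comp_apply, e.left_inv hz]

/-- The curvature of real vector fields. -/
lemma curvature_real {x : M} (hx : x ∈ e.source) (hxt : x ∈ t.baseSet) {ψ : Π x, L x}
    (hψ : ∀ᶠ z in 𝓝 x, SmoothSectionAt E ψ z) {X Y : Π x : M, TangentSpace 𝓘(ℝ, E) x}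
    (hX : SmoothFieldAt X x) (hY : SmoothFieldAt Y x) :
    D (fun z => D ψ z (Y z)) x (X x) - D (fun z => D ψ z (X z)) x (Y x)
      - D ψ x (mlieBracket 𝓘(ℝ, E) X Y x) = curvForm e t x (X x) (Y x) • ψ x := by
  have : CompleteSpace E := FiniteDimensional.complete ℂ E
  obtain ⟨y, hy1, rfl⟩ : ∃ y ∈ e.target, e.symm y = x := ⟨e x, e.map_source hx, e.left_inv hx⟩
  have hy : y ∈ domain e t := ⟨hy1, hxt⟩
  have hcomm := covDeriv_commutator (contDiffAt_connForm he hh hy)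
    (contDiffAt_coord he hy hψ.self_of_nhds) (contDiffAt_chartField he hy1 hX)
    (contDiffAt_chartField he hy1 hY)
  have key : ∀ {X Y : Π x : M, TangentSpace 𝓘(ℝ, E) x}, SmoothFieldAt X (e.symm y) →
      SmoothFieldAt Y (e.symm y) → D (fun z => D ψ z (Y z)) (e.symm y) (X (e.symm y))
        = covDeriv (connForm e t) (fun z => covDeriv (connForm e t) (coord t ψ ∘ e.symm) z
            (chartField e Y z)) y (chartField e X y) • frame t (e.symm y) := by
    intro X Y hX hY
    rw [← coordField_chartField he hy1 X, cov_eq hD he hh hy (smoothSectionAt_cov hD hh hψ hY)]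
    have h1 := coord_cov_eventuallyEq hD he hh hy hψ Y
    rw [covDeriv, covDeriv, h1.fderiv_eq, h1.eq_of_nhds]
  rw [key hX hY, key hY hX, ← coordField_chartDeriv he hx (mlieBracket 𝓘(ℝ, E) X Y (e.symm y)),
    chartDeriv_mlieBracket he hy1 hX hY, cov_eq hD he hh hy hψ.self_of_nhds, ← sub_smul, ← sub_smul,
    hcomm, mul_smul, Function.comp_apply, coord_smul_frame hy.2, curvForm_apply, e.right_inv hy1]
  rfl

/-- The curvature of complexified vector fields, by complex bilinearity. -/
lemma curvature_eq {x : M} (hx : x ∈ e.source) (hxt : x ∈ t.baseSet) {ψ : Π x, L x}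
    (hψ : ∀ᶠ z in 𝓝 x, SmoothSectionAt E ψ z) {V W : Π x : M, CTangent E x}
    (hV : SmoothFieldAt (fun y => (V y).re) x) (hV' : SmoothFieldAt (fun y => (V y).im) x)
    (hW : SmoothFieldAt (fun y => (W y).re) x) (hW' : SmoothFieldAt (fun y => (W y).im) x) :
    curvature D V W ψ x = (curvForm e t x (V x).re (W x).re
      + Complex.I * curvForm e t x (V x).re (W x).im
      + Complex.I * curvForm e t x (V x).im (W x).re
      - curvForm e t x (V x).im (W x).im) • ψ x := by
  have h1 := curvature_real hD he hh hx hxt hψ hV hW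
  have h2 := curvature_real hD he hh hx hxt hψ hV hW'
  have h3 := curvature_real hD he hh hx hxt hψ hV' hW
  have h4 := curvature_real hD he hh hx hxt hψ hV' hW'
  have hsplit : ∀ {V : Π x : M, CTangent E x}, SmoothFieldAt (fun y => (V y).re) x →
      SmoothFieldAt (fun y => (V y).im) x → ∀ v, D (cCov D V ψ) x v
        = D (fun z => D ψ z (V z).re) x v + Complex.I • D (fun z => D ψ z (V z).im) x v := by
    intro V hV hV' v
    have s1 := smoothSectionAt_cov hD hh hψ hV
    have s2 := smoothSectionAt_cov hD hh hψ hV'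
    have s3 : SmoothSectionAt E (fun z => Complex.I • D ψ z (V z).im) x :=
      s2.smul (c := fun _ => Complex.I) contMDiffAt_const
    have h5 := cov_add (D := D) s1 s3
    rw [← hD.smul x _ s2, ← add_apply, ← h5]
    rfl
  have hbr : D ψ x (cLie V W x).re + Complex.I • D ψ x (cLie V W x).im
      = D ψ x (mlieBracket 𝓘(ℝ, E) (fun y => (V y).re) (fun y => (W y).re) x)
        - D ψ x (mlieBracket 𝓘(ℝ, E) (fun y => (V y).im) (fun y => (W y).im) x)
        + Complex.I • (D ψ x (mlieBracket 𝓘(ℝ, E) (fun y => (V y).re) (fun y => (W y).im) x)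
          + D ψ x (mlieBracket 𝓘(ℝ, E) (fun y => (V y).im) (fun y => (W y).re) x)) := by
    rw [cLie, map_sub, map_add]
  have hI : ∀ w : L x, Complex.I • Complex.I • w = -w := fun w => by
    rw [smul_smul, Complex.I_mul_I, neg_one_smul]
  rw [curvature, cCov, cCov, cCov, hsplit hW hW', hsplit hW hW', hsplit hV hV', hsplit hV hV', hbr,
    sub_smul, add_smul, add_smul, mul_smul, mul_smul, ← h1, ← h2, ← h3, ← h4]
  simp only [smul_add, smul_sub, hI]
  abel

/-- The curvature form does not depend on the chart and the trivialization. -/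
lemma curvForm_eq {e' : OpenPartialHomeomorph M E} (he' : e' ∈ atlas E M)
    {t' : Trivialization ℂ (π ℂ L)} [MemTrivializationAtlas t'] {x : M} (hx : x ∈ e.source)
    (hxt : x ∈ t.baseSet) (hx' : x ∈ e'.source) (hxt' : x ∈ t'.baseSet) :
    curvForm e t x = curvForm e' t' x := by
  have : CompleteSpace E := FiniteDimensional.complete ℂ E
  have hψ : ∀ᶠ z in 𝓝 x, SmoothSectionAt E (frame t) z := by
    filter_upwards [t.open_baseSet.mem_nhds hxt] with z hz using smoothSectionAt_frame hz
  ext v w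
  have hv := smoothFieldAt_coordField he hx (chartDeriv e x v)
  have hw := smoothFieldAt_coordField he hx (chartDeriv e x w)
  have h1 := curvature_real hD he hh hx hxt hψ hv hw
  rw [curvature_real hD he' hh hx' hxt' hψ hv hw, coordField_chartDeriv he hx,
    coordField_chartDeriv he hx] at h1
  exact (smul_left_injective ℂ (frame_ne_zero hxt) h1).symm

omit hD in
/-- The curvature form is purely imaginary. -/
lemma curvForm_re {x : M} (hx : x ∈ e.source) (hxt : x ∈ t.baseSet) (v w : TangentSpace 𝓘(ℝ, E) x) :
    (curvForm e t x v w).re = 0 := by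
  have hy : e x ∈ domain e t := map_mem_domain hx hxt
  have hℓ := contDiffOn_log_frameNormSq (t := t) he hh
  have hsymm := ((hℓ.contDiffAt ((isOpen_domain e t).mem_nhds hy)).isSymmSndFDerivAt
    (by simpa using two_le_infty)).eq (chartDeriv e x v) (chartDeriv e x w)
  rw [curvForm_apply, extDeriv_apply, connForm, fderiv_delForm (isOpen_domain e t) hℓ hy,
    fderiv_delForm (isOpen_domain e t) hℓ hy, hsymm]
  simp

end Curvature

section CurvatureTrace

variable {E : Type*} [NormedAddCommGroup E] [NormedSpace ℂ E] [FiniteDimensional ℂ E]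
  {M : Type*} [TopologicalSpace M] [ChartedSpace E M]
  [RiemannianBundle (fun x : M => TangentSpace 𝓘(ℝ, E) x)]
  {L : M → Type*} [TopologicalSpace (TotalSpace ℂ L)]
  [∀ x, NormedAddCommGroup (L x)] [∀ x, InnerProductSpace ℂ (L x)]
  [FiberBundle ℂ L] [IsManifold 𝓘(ℂ, E) ω M] [VectorBundle ℂ ℂ L]
  [ContMDiffVectorBundle ω ℂ L 𝓘(ℂ, E)]
  {e : OpenPartialHomeomorph M E} {t : Trivialization ℂ (π ℂ L)} [MemTrivializationAtlas t]
  {D : CovariantDerivative 𝓘(ℝ, E) ℂ L}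

variable (E L) in
/-- The curvature term `ρ = -(i/2) ∑ K(e, J e)`, where `K` is the curvature form and the trace is
taken in an orthonormal basis. Since `K` is purely imaginary, this is real; taking the real part
only serves to have a function with real values. -/
def curvTrace (x : M) : ℝ :=
  (-(Complex.I / 2) * ∑ k, curvForm (chartAt E x) (trivializationAt ℂ L x) x
    (stdOrthonormalBasis ℝ (TangentSpace 𝓘(ℝ, E) x) k)
    (J x (stdOrthonormalBasis ℝ (TangentSpace 𝓘(ℝ, E) x) k))).re

variable (hD : IsCompatible D) (hh : IsSmoothHermitian E L) (he : e ∈ atlas E M)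
include hD hh he

lemma curvTrace_eq {x : M} (hx : x ∈ e.source) (hxt : x ∈ t.baseSet) :
    (curvTrace E L x : ℂ) = -(Complex.I / 2) * ∑ k, curvForm e t x
      (stdOrthonormalBasis ℝ (TangentSpace 𝓘(ℝ, E) x) k)
      (J x (stdOrthonormalBasis ℝ (TangentSpace 𝓘(ℝ, E) x) k)) := by
  have hmem : x ∈ (trivializationAt ℂ L x).baseSet := FiberBundle.mem_baseSet_trivializationAt' x
  rw [curvTrace, curvForm_eq hD (chart_mem_atlas E x) hh he (mem_chart_source E x) hmem hx hxt]
  refine Complex.ext rfl ?_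
  have h0 : (∑ k, curvForm e t x (stdOrthonormalBasis ℝ (TangentSpace 𝓘(ℝ, E) x) k)
      (J x (stdOrthonormalBasis ℝ (TangentSpace 𝓘(ℝ, E) x) k))).re = 0 := by
    rw [Complex.re_sum]
    exact Finset.sum_eq_zero fun k _ => curvForm_re he hh hx hxt _ _
  simp [h0]

lemma curvTrace_chart {y : E} (hy : y ∈ domain e t) :
    (curvTrace E L (e.symm y) : ℂ) = -(Complex.I / 2) * ∑ j, ∑ k, (chartBivector e y j k : ℂ) *
      extDeriv (connForm e t) y (Module.finBasis ℝ E j) (Module.finBasis ℝ E k) := by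
  have hx := e.map_target hy.1
  rw [curvTrace_eq hD hh he hx hy.2, sum_orthonormalBasis_J_eq_sum_chart he hy.1]
  simp only [curvForm_apply, chartDeriv_coordField he hx, e.right_inv hy.1, Complex.real_smul]

omit he in
lemma contMDiff_curvTrace
    [IsContMDiffRiemannianBundle 𝓘(ℝ, E) ∞ E (fun x : M => TangentSpace 𝓘(ℝ, E) x)] :
    ContMDiff 𝓘(ℝ, E) 𝓘(ℝ, ℝ) ∞ (curvTrace E L : M → ℝ) := by
  intro x
  obtain ⟨t, _, hxt⟩ := exists_trivialization (L := L) x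
  have hx := mem_chart_source E x
  have he := chart_mem_atlas E x
  set e := chartAt E x
  have hy : e x ∈ domain e t := map_mem_domain hx hxt
  have hW := (isOpen_domain e t).mem_nhds hy
  have h1 : ∀ v w, ContDiffOn ℝ ∞ (fun y => extDeriv (connForm e t) y v w)
      (domain e t) := fun v w => by
    have h2 := (contDiffOn_connForm (t := t) he hh).fderiv_of_isOpen (isOpen_domain e t) (m := ∞)
        (by simp)
    exact ((h2.clm_apply contDiffOn_const).clm_apply contDiffOn_const).sub
      ((h2.clm_apply contDiffOn_const).clm_apply contDiffOn_const)
  have h3 : ContDiffOn ℝ ∞ (fun y => (-(Complex.I / 2) * ∑ j, ∑ k, (chartBivector e y j k : ℂ) *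
      extDeriv (connForm e t) y (Module.finBasis ℝ E j) (Module.finBasis ℝ E k)).re)
      (domain e t) := by
    refine Complex.reCLM.contDiff.comp_contDiffOn (contDiffOn_const.mul ?_)
    refine ContDiffOn.sum fun j _ => ContDiffOn.sum fun k _ => ?_
    exact (contDiffOn_ofReal ((contDiffOn_chartBivector he j k).mono (domain_subset e t))).mul
      (h1 _ _)
  refine (((h3.contDiffAt hW).contMDiffAt).comp x (contMDiffAt_chart he hx)).congr_of_eventuallyEq
    ?_
  filter_upwards [e.open_source.mem_nhds hx, t.open_baseSet.mem_nhds hxt] with z hz hz'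
  rw [Function.comp_apply, ← curvTrace_chart hD hh he (map_mem_domain hz hz'), e.left_inv hz,
    Complex.ofReal_re]

omit he in
/-- The function `ρ` is the trace of the curvature over `T^(0,1)`. -/
lemma curvTrace_smul (hg : IsKahler E M) {U : Set M}
    {Z : Fin (Module.finrank ℂ E) → Π x : M, CTangent E x} (hU : IsOpen U)
    (hZ : ∀ k, ∀ x ∈ U, SmoothFieldAt (fun y => (Z k y).re) x ∧
      SmoothFieldAt (fun y => (Z k y).im) x)
    (hZ' : ∀ x ∈ U, IsAntiholomorphicONB x (fun k => Z k x)) {ψ : Π x, L x}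
    (hψ : ∀ x ∈ U, SmoothSectionAt E ψ x) {x : M} (hx : x ∈ U) :
    (curvTrace E L x : ℂ) • ψ x = ∑ k, curvature D (Z k) (fun y => (Z k y).conj) ψ x := by
  obtain ⟨t, _, hxt⟩ := exists_trivialization (L := L) x
  have hxs := mem_chart_source E x
  have he := chart_mem_atlas E x
  set e := chartAt E x
  have hψ' : ∀ᶠ z in 𝓝 x, SmoothSectionAt E ψ z := by
    filter_upwards [hU.mem_nhds hx] with z hz using hψ z hz
  have hneg : ∀ k, SmoothFieldAt (fun y => -(Z k y).im) x := fun k => by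
    have h1 : ContMDiffAt 𝓘(ℝ, E) (𝓘(ℝ, E).prod 𝓘(ℝ, E)) ∞ (fun y => (TotalSpace.mk' E y
      ((-1 : ℝ) • (Z k y).im) : TangentBundle 𝓘(ℝ, E) M)) x :=
      ContMDiffAt.const_smul_section (a := (-1 : ℝ)) (hZ k x hx).2
    simpa only [neg_one_smul] using! h1
  have h1 : ∀ k, curvature D (Z k) (fun y => (Z k y).conj) ψ x
      = (-Complex.I * (curvForm e t x (Z k x).re (J x (Z k x).re)
        - curvForm e t x (J x (Z k x).re) (Z k x).re)) • ψ x := fun k => by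
    rw [curvature_eq (W := fun y => (Z k y).conj)
        hD he hh hxs hxt hψ' (hZ k x hx).1 (hZ k x hx).2 (hZ k x hx).1 (hneg k)]
    congr 1
    have h2 := ((hZ' x hx).1 k).1
    simp only [CTangent.conj]
    rw [← h2]
    simp only [curvForm_apply, map_neg, extDeriv_self]
    ring
  have h2 := (hZ' x hx).sum_sub hg (stdOrthonormalBasis ℝ (TangentSpace 𝓘(ℝ, E) x)) (curvForm e t x)
  simp only [h1]
  rw [← Finset.sum_smul, ← Finset.mul_sum, h2, curvTrace_eq hD hh he hxs hxt, Complex.real_smul]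
  congr 1
  push_cast
  ring

end CurvatureTrace

/-! ### The Riemannian volume in a chart -/

section Volume

variable {E : Type*} [NormedAddCommGroup E] [NormedSpace ℂ E] [FiniteDimensional ℂ E]
  {M : Type*} [TopologicalSpace M] [ChartedSpace E M]
  [RiemannianBundle (fun x : M => TangentSpace 𝓘(ℝ, E) x)]

/-- A Gram determinant changes by the square of the determinant under a linear map. -/
lemma det_of_bilin_comp {ι V : Type*} [Fintype ι] [DecidableEq ι] [AddCommGroup V] [Module ℝ V]
    (b : Module.Basis ι ℝ V) (B : V →ₗ[ℝ] V →ₗ[ℝ] ℝ) (A : V →ₗ[ℝ] V) :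
    (Matrix.of fun i j => B (A (b i)) (A (b j))).det
      = LinearMap.det A ^ 2 * (Matrix.of fun i j => B (b i) (b j)).det := by
  have h : (Matrix.of fun i j => B (A (b i)) (A (b j)))
      = (LinearMap.toMatrix b b A).transpose * (Matrix.of fun i j => B (b i) (b j))
        * LinearMap.toMatrix b b A := by
    have hA : ∀ i, A (b i) = ∑ k, LinearMap.toMatrix b b A k i • b k := fun i => by
      conv_lhs => rw [← b.sum_repr (A (b i))]
      exact Finset.sum_congr rfl fun k _ => by rw [LinearMap.toMatrix_apply]
    ext i j
    simp only [Matrix.of_apply, Matrix.mul_apply, Matrix.transpose_apply]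
    rw [hA i, hA j]
    simp only [map_sum, map_smul, LinearMap.sum_apply, LinearMap.smul_apply, smul_eq_mul,
      Finset.sum_mul]
    refine (Finset.sum_congr rfl fun k _ => ?_)
    rw [Finset.mul_sum]
    exact Finset.sum_congr rfl fun l _ => by ring
  rw [h, Matrix.det_mul, Matrix.det_mul, Matrix.det_transpose, LinearMap.det_toMatrix]
  ring

variable [IsManifold 𝓘(ℂ, E) ω M] {e : OpenPartialHomeomorph M E} (he : e ∈ atlas E M)
include he

/-- The transformation law of the Riemannian density under a change of charts. -/
lemma chartDensity_change {e' : OpenPartialHomeomorph M E} (he' : e' ∈ atlas E M) {y : E}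
    (hy : y ∈ e.target) (hy' : e.symm y ∈ e'.source) :
    chartDensity e y = |(fderiv ℝ (e' ∘ e.symm) y).det| * chartDensity e' (e' (e.symm y)) := by
  set x := e.symm y
  have hT : ∀ v, coordField e v x = coordField e' (fderiv ℝ (e' ∘ e.symm) y v) x := fun v => by
    have h1 : fderiv ℝ (e' ∘ e.symm) y v = chartDeriv e' x (coordField e v x) :=
      fderiv_comp_chart_symm he hy ((mdifferentiable_chart he').mdifferentiableAt hy') v
    rw [h1, coordField_chartDeriv he' hy']
  let B : E →ₗ[ℝ] E →ₗ[ℝ] ℝ := LinearMap.mk₂ ℝ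
    (fun v w => inner ℝ (coordEquiv he' hy' v) (coordEquiv he' hy' w))
    (fun u v w => by rw [map_add, inner_add_left])
    (fun c v w => by rw [map_smul, real_inner_smul_left]; rfl)
    (fun u v w => by rw [map_add, inner_add_right])
    (fun c v w => by rw [map_smul, real_inner_smul_right]; rfl)
  have hB : ∀ v w, B v w = inner ℝ (coordField e' v x) (coordField e' w x) := fun v w => by
    rw [← coordEquiv_apply he' hy', ← coordEquiv_apply he' hy']; rfl
  have h2 := det_of_bilin_comp (Module.finBasis ℝ E) B (fderiv ℝ (e' ∘ e.symm) y).toLinearMap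
  have h3 : (Matrix.of fun i j => B ((fderiv ℝ (e' ∘ e.symm) y).toLinearMap (Module.finBasis ℝ E i))
      ((fderiv ℝ (e' ∘ e.symm) y).toLinearMap (Module.finBasis ℝ E j))) = chartGram e y := by
    ext i j
    simp only [Matrix.of_apply, chartGram, hB, ContinuousLinearMap.coe_coe]
    rw [← hT, ← hT]
  have h4 : (Matrix.of fun i j => B (Module.finBasis ℝ E i) (Module.finBasis ℝ E j))
      = chartGram e' (e' x) := by
    ext i j
    simp only [Matrix.of_apply, chartGram, hB]
    exact congrArg (fun z => (inner ℝ (coordField e' (Module.finBasis ℝ E i) z)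
      (coordField e' (Module.finBasis ℝ E j) z) : ℝ)) (e'.left_inv hy').symm
  rw [h3, h4] at h2
  rw [chartDensity, h2, Real.sqrt_mul (sq_nonneg _), Real.sqrt_sq_eq_abs]
  rfl

variable [MeasurableSpace E] [BorelSpace E]

omit [BorelSpace E] in
lemma volumeDensity_eq {y : E} (hy : y ∈ e.target) :
    volumeDensity e y = ENNReal.ofReal (chartDensity e y) := by
  simp only [volumeDensity, chartDensity, chartGram, coordField_symm he hy]

variable [MeasurableSpace M] [BorelSpace M]

omit [FiniteDimensional ℂ E] [RiemannianBundle (fun x : M => TangentSpace 𝓘(ℝ, E) x)]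
  [IsManifold 𝓘(ℂ, E) ω M] he in
lemma measurableSet_target_inter_preimage (e : OpenPartialHomeomorph M E) {A : Set M}
    (hA : MeasurableSet A) : MeasurableSet (e.target ∩ e.symm ⁻¹' A) := by
  have h1 : Measurable (e.target.domRestrict e.symm) := e.continuousOn_symm.domRestrict.measurable
  have h2 := MeasurableSet.subtype_image e.open_target.measurableSet (h1 hA)
  convert h2 using 1
  ext y
  simp [Set.mem_image, and_comm]

omit he [IsManifold 𝓘(ℂ, E) ω M] in
lemma aemeasurable_chart_symm (e : OpenPartialHomeomorph M E) : AEMeasurable e.symm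
    ((((Module.finBasis ℝ E).addHaar).restrict e.target).withDensity (volumeDensity e)) :=
  (e.continuousOn_symm.aemeasurable e.open_target.measurableSet).mono_ac
    (withDensity_absolutelyContinuous _ _)

omit he in
lemma chartVolume_apply (he : e ∈ atlas E M) {A : Set M} (hA : MeasurableSet A) :
    chartVolume e A = ∫⁻ y in e.target ∩ e.symm ⁻¹' A, ENNReal.ofReal (chartDensity e y)
      ∂(Module.finBasis ℝ E).addHaar := by
  rw [chartVolume, Measure.map_apply_of_aemeasurable (aemeasurable_chart_symm e) hA,
    withDensity_apply', Measure.restrict_restrict' e.open_target.measurableSet, Set.inter_comm]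
  exact setLIntegral_congr_fun (measurableSet_target_inter_preimage e hA)
    fun y hy => volumeDensity_eq he hy.1

omit he in
/-- The volumes of two charts agree on the intersection of their domains. -/
lemma chartVolume_eq_of_subset (he : e ∈ atlas E M) {e' : OpenPartialHomeomorph M E}
    (he' : e' ∈ atlas E M) {A : Set M} (hA : MeasurableSet A) (hAe : A ⊆ e.source)
    (hAe' : A ⊆ e'.source) : chartVolume e A = chartVolume e' A := by
  rw [chartVolume_apply he hA, chartVolume_apply he' hA]
  have himage : (e' ∘ e.symm) '' (e.target ∩ e.symm ⁻¹' A) = e'.target ∩ e'.symm ⁻¹' A := by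
    ext z
    constructor
    · rintro ⟨y, ⟨hy, hyA⟩, rfl⟩
      refine ⟨e'.map_source (hAe' hyA), ?_⟩
      rw [Set.mem_preimage, Function.comp_apply, e'.left_inv (hAe' hyA)]
      exact hyA
    · rintro ⟨hz, hzA⟩
      refine ⟨e (e'.symm z), ⟨e.map_source (hAe hzA), ?_⟩, ?_⟩
      · rw [Set.mem_preimage, e.left_inv (hAe hzA)]
        exact hzA
      · rw [Function.comp_apply, e.left_inv (hAe hzA), e'.right_inv hz]
  have hinj : Set.InjOn (e' ∘ e.symm) (e.target ∩ e.symm ⁻¹' A) := by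
    rintro y ⟨hy, hyA⟩ z ⟨hz, hzA⟩ h
    have h1 := e'.injOn (hAe' hyA) (hAe' hzA) h
    exact e.symm.injOn hy hz h1
  have hderiv : ∀ y ∈ e.target ∩ e.symm ⁻¹' A, HasFDerivWithinAt (e' ∘ e.symm)
      (fderiv ℝ (e' ∘ e.symm) y) (e.target ∩ e.symm ⁻¹' A) y := by
    rintro y ⟨hy, hyA⟩
    have h1 : ContMDiffAt 𝓘(ℝ, E) 𝓘(ℝ, E) ∞ (e' ∘ e.symm) y :=
      (contMDiffAt_chart he' (hAe' hyA)).comp y (contMDiffAt_chart_symm he hy)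
    exact (h1.contDiffAt.differentiableAt (by simp)).hasFDerivAt.hasFDerivWithinAt
  rw [← himage, lintegral_image_eq_lintegral_abs_det_fderiv_mul _
    (measurableSet_target_inter_preimage e hA) hderiv hinj]
  refine setLIntegral_congr_fun (measurableSet_target_inter_preimage e hA) fun y hy => ?_
  simp only [chartDensity_change he he' hy.1 (hAe' hy.2), ENNReal.ofReal_mul (abs_nonneg _)]
  rfl

omit he in
lemma chartVolume_inter_source (he : e ∈ atlas E M) {A : Set M} (hA : MeasurableSet A) :
    chartVolume e (A ∩ e.source) = chartVolume e A := by
  rw [chartVolume_apply he hA, chartVolume_apply he (hA.inter e.open_source.measurableSet)]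
  congr 2
  ext y
  simp only [Set.mem_inter_iff, Set.mem_preimage]
  exact ⟨fun h => ⟨h.1, h.2.1⟩, fun h => ⟨h.1, h.2, e.map_target h.1⟩⟩

/-- The Riemannian volume restricts to the chart volume on the domain of a chart. -/
lemma vol_restrict_source : (vol E M).restrict e.source = chartVolume e := by
  have hs := e.open_source.measurableSet
  refine le_antisymm ?_ ?_
  -- all chart volumes lie below the chart volume of `e`, extended by infinity off the chart domain
  · have hle : vol E M ≤ chartVolume e + (⊤ : Measure M).restrict e.sourceᶜ := by
      refine iSup₂_le fun e' he' => Measure.le_iff.2 fun A hA => ?_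
      have h1 : chartVolume e' (A ∩ e.source) ≤ chartVolume e A := by
        have hm : MeasurableSet (A ∩ e.source ∩ e'.source) :=
          (hA.inter hs).inter e'.open_source.measurableSet
        rw [← chartVolume_inter_source he' (hA.inter hs), chartVolume_eq_of_subset he' he hm
          Set.inter_subset_right fun _ h => h.1.2]
        exact measure_mono fun _ h => h.1.1
      calc chartVolume e' A ≤ chartVolume e' (A ∩ e.source) + chartVolume e' (A \ e.source) :=
            measure_le_inter_add_sdiff _ _ _
        _ ≤ chartVolume e A + (⊤ : Measure M) (A \ e.source) :=
            add_le_add h1 (Measure.le_iff'.1 le_top _)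
        _ = _ := by
            rw [Measure.add_apply, Measure.restrict_apply hA, Set.sdiff_eq]
    refine (Measure.restrict_mono subset_rfl hle).trans ?_
    rw [Measure.restrict_add, Measure.restrict_restrict hs, Set.inter_compl_self,
      Measure.restrict_empty, add_zero]
    exact Measure.restrict_le_self
  · refine Measure.le_iff.2 fun A hA => ?_
    rw [Measure.restrict_apply hA, ← chartVolume_inter_source he hA]
    exact Measure.le_iff'.1 (le_iSup₂ (f := fun (e : OpenPartialHomeomorph M E)
      (_ : e ∈ atlas E M) => chartVolume e) e he) _

variable [IsContMDiffRiemannianBundle 𝓘(ℝ, E) ∞ E (fun x : M => TangentSpace 𝓘(ℝ, E) x)]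

omit he e in
instance isFiniteMeasureOnCompacts_vol : IsFiniteMeasureOnCompacts (vol E M) := by
  have : IsLocallyFiniteMeasure (vol E M) := by
    refine ⟨fun x => ?_⟩
    have hx := mem_chart_source E x
    have he := chart_mem_atlas E x
    set e := chartAt E x
    have : FiniteDimensional ℝ E := FiniteDimensional.complexToReal E
    have : ProperSpace E := FiniteDimensional.proper ℝ E
    obtain ⟨K, hK, hxK, hKt⟩ := exists_compact_subset e.open_target (e.map_source hx)
    refine ⟨e.source ∩ e ⁻¹' interior K,
      (e.isOpen_inter_preimage isOpen_interior).mem_nhds ⟨hx, hxK⟩, ?_⟩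
    have hm := (e.isOpen_inter_preimage (isOpen_interior (s := K))).measurableSet
    have h1 : vol E M (e.source ∩ e ⁻¹' interior K)
        = chartVolume e (e.source ∩ e ⁻¹' interior K) := by
      rw [← vol_restrict_source he, Measure.restrict_apply hm,
        Set.inter_eq_self_of_subset_left Set.inter_subset_left]
    rw [h1, chartVolume_apply he hm]
    have h2 : e.target ∩ e.symm ⁻¹' (e.source ∩ e ⁻¹' interior K) ⊆ K := fun y hy => by
      have := hy.2.2
      rw [Set.mem_preimage, e.right_inv hy.1] at this
      exact interior_subset this
    exact (lintegral_mono_set h2).trans_lt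
      ((contDiffOn_chartDensity he).continuousOn.mono hKt
        |>.integrableOn_compact hK).lintegral_lt_top
  infer_instance

/-- Integrals of continuous functions supported in the domain of a chart. -/
lemma integral_eq_integral_chart {F : M → ℂ} (hF : Continuous F) {W : Set E}
    (hWt : W ⊆ e.target) (h0 : ∀ x, F x ≠ 0 → x ∈ e.source ∧ e x ∈ W) :
    ∫ x, F x ∂(vol E M) = ∫ y in W, (chartDensity e y : ℂ) * F (e.symm y)
      ∂(Module.finBasis ℝ E).addHaar := by
  have hmt := e.open_target.measurableSet
  have h1 : ∫ x, F x ∂(vol E M) = ∫ x, F x ∂(chartVolume e) := by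
    rw [← vol_restrict_source he, setIntegral_eq_integral_of_forall_compl_eq_zero]
    intro x hx
    by_contra h
    exact hx (h0 x h).1
  have hae : (volumeDensity e) =ᵐ[(Module.finBasis ℝ E).addHaar.restrict e.target]
      fun y => ENNReal.ofReal (chartDensity e y) := by
    filter_upwards [ae_restrict_mem hmt] with y hy using volumeDensity_eq he hy
  have hmeas : AEMeasurable (fun y => ENNReal.ofReal (chartDensity e y))
      ((Module.finBasis ℝ E).addHaar.restrict e.target) :=
    ((contDiffOn_chartDensity he).continuousOn.aemeasurable hmt).ennreal_ofReal
  rw [h1, chartVolume, integral_map (aemeasurable_chart_symm e) hF.aestronglyMeasurable,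
    withDensity_congr_ae hae, integral_withDensity_eq_integral_toReal_smul₀ hmeas
      (Eventually.of_forall fun _ => ENNReal.ofReal_lt_top)]
  have h2 : ∀ y, (ENNReal.ofReal (chartDensity e y)).toReal • F (e.symm y)
      = (chartDensity e y : ℂ) * F (e.symm y) := fun y => by
    rw [ENNReal.toReal_ofReal (show 0 ≤ chartDensity e y from Real.sqrt_nonneg _),
        Complex.real_smul]
  simp only [h2]
  refine setIntegral_eq_of_subset_of_forall_sdiff_eq_zero hmt hWt fun y hy => ?_
  have : F (e.symm y) = 0 := by
    by_contra h
    have := (h0 _ h).2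
    rw [e.right_inv hy.1] at this
    exact hy.2 this
  rw [this, mul_zero]

end Volume

/-! ### Test sections -/

section TestSections

variable {E : Type*} [NormedAddCommGroup E] [NormedSpace ℂ E]
  {M : Type*} [TopologicalSpace M] [ChartedSpace E M]
  {L : M → Type*} [TopologicalSpace (TotalSpace ℂ L)]
  [∀ x, NormedAddCommGroup (L x)] [∀ x, InnerProductSpace ℂ (L x)]
  [FiberBundle ℂ L] [IsManifold 𝓘(ℂ, E) ω M] [VectorBundle ℂ ℂ L]
  [ContMDiffVectorBundle ω ℂ L 𝓘(ℂ, E)]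

lemma isTestSection_zero : IsTestSection E fun x => (0 : L x) :=
  ⟨smoothSectionAt_zero, by simp⟩

lemma IsTestSection.add {φ ψ : Π x, L x} (hφ : IsTestSection E φ) (hψ : IsTestSection E ψ) :
    IsTestSection E fun x => φ x + ψ x := by
  refine ⟨fun x => (hφ.1 x).add (hψ.1 x), (hφ.2.union hψ.2).of_isClosed_subset isClosed_closure ?_⟩
  rw [← closure_union]
  refine closure_mono fun x hx => ?_
  by_contra h
  rw [Set.mem_union, not_or] at h
  simp only [Set.mem_ofPred_eq, not_not] at h hx
  exact hx (by rw [h.1, h.2, add_zero])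

lemma IsTestSection.smul {c : M → ℂ} (hc : ContMDiff 𝓘(ℝ, E) 𝓘(ℝ, ℂ) ∞ c) {ψ : Π x, L x}
    (hψ : IsTestSection E ψ) : IsTestSection E fun x => c x • ψ x := by
  refine ⟨fun x => (hψ.1 x).smul (hc x), hψ.2.of_isClosed_subset isClosed_closure
    (closure_mono fun x hx h => hx ?_)⟩
  change c x • ψ x = 0
  rw [h, smul_zero]

lemma IsTestSection.sub {φ ψ : Π x, L x} (hφ : IsTestSection E φ) (hψ : IsTestSection E ψ) :
    IsTestSection E (φ - ψ) := by
  have h := hφ.add (hψ.smul (c := fun _ => -1) contMDiff_const)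
  simpa only [neg_one_smul, ← sub_eq_add_neg] using! h

lemma isTestSection_sum {ι : Type*} (s : Finset ι) {ψ : ι → Π x, L x}
    (h : ∀ i ∈ s, IsTestSection E (ψ i)) : IsTestSection E fun x => ∑ i ∈ s, ψ i x := by
  classical
  induction s using Finset.induction_on with
  | empty => simpa using isTestSection_zero
  | insert i s hi ih =>
    simp only [Finset.sum_insert hi]
    exact (h i (Finset.mem_insert_self i s)).add (ih fun j hj => h j (Finset.mem_insert_of_mem hj))

/-- By a partition of unity, an additive property of test sections may be checked on those that are
supported in the domain of a chart and a trivialization. -/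
theorem IsTestSection.induction [FiniteDimensional ℂ E] [T2Space M] [SecondCountableTopology M]
    {P : (Π x, L x) → Prop} (hzero : P fun _ => 0)
    (hadd : ∀ φ ψ, IsTestSection E φ → IsTestSection E ψ → P φ → P ψ → P fun x => φ x + ψ x)
    (hloc : ∀ e ∈ atlas E M, ∀ (t : Trivialization ℂ (π ℂ L)) [MemTrivializationAtlas t],
      ∀ ψ, IsTestSection E ψ → closure {x | ψ x ≠ 0} ⊆ e.source ∩ t.baseSet → P ψ)
    {ψ : Π x, L x} (hψ : IsTestSection E ψ) : P ψ := by
  classical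
  have : FiniteDimensional ℝ E := FiniteDimensional.complexToReal E
  have : ProperSpace E := FiniteDimensional.proper ℝ E
  have : LocallyCompactSpace M := ChartedSpace.locallyCompactSpace E M
  let U : M → Set M := fun x => (chartAt E x).source ∩ (trivializationAt ℂ L x).baseSet
  have hU : ∀ x, IsOpen (U x) := fun x =>
      (chartAt E x).open_source.inter (trivializationAt ℂ L x).open_baseSet
  obtain ⟨f, hf⟩ := SmoothPartitionOfUnity.exists_isSubordinate 𝓘(ℝ, E)
    (isClosed_closure (s := {x | ψ x ≠ 0})) U hU fun x _ => Set.mem_iUnion.2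
      ⟨x, mem_chart_source E x, FiberBundle.mem_baseSet_trivializationAt' x⟩
  have hfin := f.locallyFinite.finite_nonempty_inter_compact hψ.2
  have hsmooth : ∀ i, ContMDiff 𝓘(ℝ, E) 𝓘(ℝ, ℂ) ∞ fun x => (f i x : ℂ) := fun i =>
    (Complex.ofRealCLM.contMDiff (n := ∞)).comp (f i).contMDiff
  have htest : ∀ i, IsTestSection E fun x => (f i x : ℂ) • ψ x := fun i => hψ.smul (hsmooth i)
  have hsum : ψ = fun x => ∑ i ∈ hfin.toFinset, (f i x : ℂ) • ψ x := by
    ext x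
    by_cases hx : ψ x = 0
    · simp [hx]
    · have hxK : x ∈ closure {x | ψ x ≠ 0} := subset_closure hx
      have h1 := f.sum_eq_one hxK
      rw [finsum_eq_sum_of_support_subset (s := hfin.toFinset)] at h1
      · rw [← Finset.sum_smul, ← Complex.ofReal_sum, h1, Complex.ofReal_one, one_smul]
      · intro i hi
        simp only [Set.Finite.coe_toFinset, Set.mem_ofPred_eq]
        exact ⟨x, hi, hxK⟩
  have key : ∀ s : Finset M, P fun x => ∑ i ∈ s, (f i x : ℂ) • ψ x := by
    intro s
    induction s using Finset.induction_on with
    | empty => simpa using hzero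
    | insert i s hi ih =>
      simp only [Finset.sum_insert hi]
      refine hadd _ _ (htest i) (isTestSection_sum s fun j _ => htest j) ?_ ih
      refine hloc _ (chart_mem_atlas E i) (trivializationAt ℂ L i) _ (htest i) ?_
      refine Set.Subset.trans (closure_mono fun x hx => ?_) (hf i)
      intro h
      exact hx (by simp [h])
  rw [hsum]
  exact key _

/-- Continuity may be checked in the charts and trivializations. -/
lemma continuous_of_continuousOn_domain {F : M → ℂ}
    (h : ∀ e ∈ atlas E M, ∀ (t : Trivialization ℂ (π ℂ L)) [MemTrivializationAtlas t],
      ContinuousOn (F ∘ e.symm) (domain e t)) : Continuous F := by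
  refine continuous_iff_continuousAt.2 fun x => ?_
  obtain ⟨t, _, hxt⟩ := exists_trivialization (L := L) x
  have hx := mem_chart_source E x
  have h1 := (h _ (chart_mem_atlas E x) t).continuousAt ((isOpen_domain _ t).mem_nhds
    (map_mem_domain hx hxt))
  refine (h1.comp ((chartAt E x).continuousAt hx)).congr ?_
  filter_upwards [(chartAt E x).open_source.mem_nhds hx] with z hz
  simp only [Function.comp_apply, (chartAt E x).left_inv hz]

end TestSections

section Forms

variable {E : Type*} [NormedAddCommGroup E] [NormedSpace ℂ E] [FiniteDimensional ℂ E]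
  {M : Type*} [TopologicalSpace M] [ChartedSpace E M]
  [RiemannianBundle (fun x : M => TangentSpace 𝓘(ℝ, E) x)]
  {L : M → Type*} [TopologicalSpace (TotalSpace ℂ L)]
  [∀ x, NormedAddCommGroup (L x)] [∀ x, InnerProductSpace ℂ (L x)]
  [FiberBundle ℂ L] [IsManifold 𝓘(ℂ, E) ω M] [VectorBundle ℂ ℂ L]
  [ContMDiffVectorBundle ω ℂ L 𝓘(ℂ, E)]
  {e : OpenPartialHomeomorph M E} {t : Trivialization ℂ (π ℂ L)} [MemTrivializationAtlas t]
  {D : CovariantDerivative 𝓘(ℝ, E) ℂ L}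

/-- The local expression `∑ a_jk conj(∇_j f) ∇_k u H` of the densities. -/
def localDensity (e : OpenPartialHomeomorph M E) (t : Trivialization ℂ (π ℂ L))
    (a : E → Matrix (Fin (Module.finrank ℝ E)) (Fin (Module.finrank ℝ E)) ℝ) (φ ψ : Π x, L x)
    (y : E) : ℂ :=
  (∑ j, ∑ k, (a y j k : ℂ) *
    (star (covDeriv (connForm e t) (coord t φ ∘ e.symm) y (Module.finBasis ℝ E j))
      * covDeriv (connForm e t) (coord t ψ ∘ e.symm) y (Module.finBasis ℝ E k))) * frameNormSq e t y

lemma inner_chart (e : OpenPartialHomeomorph M E) {y : E} (hy : y ∈ domain e t) (φ ψ : Π x, L x) :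
    inner ℂ (φ (e.symm y)) (ψ (e.symm y))
      = star ((coord t φ ∘ e.symm) y) * (coord t ψ ∘ e.symm) y * frameNormSq e t y :=
  inner_eq_coord hy.2 φ ψ

lemma contDiffOn_coord (he : e ∈ atlas E M) {ψ : Π x, L x} (hψ : ∀ x, SmoothSectionAt E ψ x) :
    ContDiffOn ℝ ∞ (coord t ψ ∘ e.symm) (domain e t) := fun _ hy =>
  (contDiffAt_coord he hy (hψ _)).contDiffWithinAt

lemma continuousOn_localDensity (he : e ∈ atlas E M) (hh : IsSmoothHermitian E L)
    {a : E → Matrix (Fin (Module.finrank ℝ E)) (Fin (Module.finrank ℝ E)) ℝ}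
    (ha : ∀ j k, ContDiffOn ℝ ∞ (fun y => a y j k) (domain e t)) {φ ψ : Π x, L x}
    (hφ : ∀ x, SmoothSectionAt E φ x) (hψ : ∀ x, SmoothSectionAt E ψ x) :
    ContinuousOn (localDensity e t a φ ψ) (domain e t) := by
  have hW := isOpen_domain e t
  have h1 : ∀ {ψ : Π x, L x}, (∀ x, SmoothSectionAt E ψ x) → ∀ v, ContinuousOn
      (fun y => covDeriv (connForm e t) (coord t ψ ∘ e.symm) y v) (domain e t) := fun hψ v =>
    (contDiffOn_covDeriv hW (contDiffOn_connForm he hh) (contDiffOn_coord he hψ) v).continuousOn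
  refine ContinuousOn.mul (continuousOn_finsetSum _ fun j _ => continuousOn_finsetSum _ fun k _ =>
      ?_)
    (contDiffOn_ofReal (contDiffOn_frameNormSq he hh)).continuousOn
  exact (contDiffOn_ofReal (ha j k)).continuousOn.mul ((h1 hφ _).star.mul (h1 hψ _))

variable (hD : IsCompatible D) (hh : IsSmoothHermitian E L)
include hD hh

lemma innerComp_chart (he : e ∈ atlas E M) {y : E} (hy : y ∈ domain e t) {φ ψ : Π x, L x}
    (hφ : ∀ x, SmoothSectionAt E φ x) (hψ : ∀ x, SmoothSectionAt E ψ x) (v w : E) :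
    innerComp (D φ (e.symm y)) (D ψ (e.symm y)) (coordField e v (e.symm y))
        (coordField e w (e.symm y))
      = star (covDeriv (connForm e t) (coord t φ ∘ e.symm) y v)
        * covDeriv (connForm e t) (coord t ψ ∘ e.symm) y w * frameNormSq e t y := by
  rw [innerComp_apply, cov_eq hD he hh hy (hφ _), cov_eq hD he hh hy (hψ _), inner_smul_left,
    inner_smul_right, inner_self_eq_norm_sq_to_K, frameNormSq, starRingEnd_apply]
  push_cast
  rw [mul_assoc]
  rfl

lemma bochnerDensity_chart (he : e ∈ atlas E M) {y : E} (hy : y ∈ domain e t) {φ ψ : Π x, L x}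
    (hφ : ∀ x, SmoothSectionAt E φ x) (hψ : ∀ x, SmoothSectionAt E ψ x) :
    bochnerDensity D φ ψ (e.symm y) = localDensity e t (fun y => (chartGram e y)⁻¹) φ ψ y := by
  have h := sum_orthonormalBasis_eq_sum_chart he hy.1
    (stdOrthonormalBasis ℝ (TangentSpace 𝓘(ℝ, E) (e.symm y)))
    (innerComp (D φ (e.symm y)) (D ψ (e.symm y)))
  refine (h : bochnerDensity D φ ψ (e.symm y) = _).trans ?_
  simp only [innerComp_chart hD hh he hy hφ hψ, localDensity, Finset.sum_mul, Complex.real_smul,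
    mul_assoc]

lemma twistedDensity_chart (he : e ∈ atlas E M) {y : E} (hy : y ∈ domain e t) {φ ψ : Π x, L x}
    (hφ : ∀ x, SmoothSectionAt E φ x) (hψ : ∀ x, SmoothSectionAt E ψ x) :
    twistedDensity D φ ψ (e.symm y) = localDensity e t (chartBivector e) φ ψ y := by
  have h := sum_orthonormalBasis_J_eq_sum_chart he hy.1
    (stdOrthonormalBasis ℝ (TangentSpace 𝓘(ℝ, E) (e.symm y)))
    (innerComp (D φ (e.symm y)) (D ψ (e.symm y)))
  refine (h : twistedDensity D φ ψ (e.symm y) = _).trans ?_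
  simp only [innerComp_chart hD hh he hy hφ hψ, localDensity, Finset.sum_mul, Complex.real_smul,
    mul_assoc]

variable [IsContMDiffRiemannianBundle 𝓘(ℝ, E) ∞ E (fun x : M => TangentSpace 𝓘(ℝ, E) x)]
  {φ ψ : Π x, L x}

lemma continuous_bochnerDensity (hφ : ∀ x, SmoothSectionAt E φ x)
    (hψ : ∀ x, SmoothSectionAt E ψ x) :
    Continuous (bochnerDensity D φ ψ) := by
  refine continuous_of_continuousOn_domain (E := E) (L := L) fun e he t _ => ?_
  refine (continuousOn_localDensity (a := fun y => (chartGram e y)⁻¹) he hh (fun j k =>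
    (contDiffOn_chartGram_inv he j k).mono (domain_subset e t)) hφ hψ).congr fun y hy => ?_
  exact bochnerDensity_chart hD hh he hy hφ hψ

lemma continuous_twistedDensity (hφ : ∀ x, SmoothSectionAt E φ x)
    (hψ : ∀ x, SmoothSectionAt E ψ x) :
    Continuous (twistedDensity D φ ψ) := by
  refine continuous_of_continuousOn_domain (E := E) (L := L) fun e he t _ => ?_
  refine (continuousOn_localDensity he hh (fun j k =>
    (contDiffOn_chartBivector he j k).mono (domain_subset e t)) hφ hψ).congr fun y hy => ?_
  exact twistedDensity_chart hD hh he hy hφ hψ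

omit [IsContMDiffRiemannianBundle 𝓘(ℝ, E) ∞ E (fun x : M => TangentSpace 𝓘(ℝ, E) x)] hD in
lemma continuous_inner (hφ : ∀ x, SmoothSectionAt E φ x) (hψ : ∀ x, SmoothSectionAt E ψ x) :
    Continuous fun x => (inner ℂ (φ x) (ψ x) : ℂ) := by
  refine continuous_of_continuousOn_domain (E := E) (L := L) fun e he t _ => ?_
  refine ContinuousOn.congr ?_ fun y hy => inner_chart e hy φ ψ
  exact ((contDiffOn_coord he hφ).continuousOn.star.mul (contDiffOn_coord he hψ).continuousOn).mul
    (contDiffOn_ofReal (contDiffOn_frameNormSq he hh)).continuousOn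

omit [RiemannianBundle (fun x : M => TangentSpace 𝓘(ℝ, E) x)]
  [IsContMDiffRiemannianBundle 𝓘(ℝ, E) ∞ E (fun x : M => TangentSpace 𝓘(ℝ, E) x)] hD hh
  [FiniteDimensional ℂ E] in
lemma cov_eq_zero (D : CovariantDerivative 𝓘(ℝ, E) ℂ L) {x : M} (hx : x ∉ closure {x | ψ x ≠ 0}) :
    D ψ x = 0 := by
  have h : ∀ᶠ z in 𝓝 x, ψ z = (0 : Π x, L x) z := by
    filter_upwards [isClosed_closure.isOpen_compl.mem_nhds hx] with z hz
    by_contra h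
    exact hz (subset_closure h)
  rw [cov_congr (smoothSectionAt_zero x) h]
  exact congrFun D.zero x

omit hh hD [IsContMDiffRiemannianBundle 𝓘(ℝ, E) ∞ E (fun x : M => TangentSpace 𝓘(ℝ, E) x)] in
lemma bochnerDensity_eq_zero {x : M} (hx : x ∉ closure {x | ψ x ≠ 0}) :
    bochnerDensity D φ ψ x = 0 := by
  simp [bochnerDensity, cov_eq_zero D hx]

omit hh hD [IsContMDiffRiemannianBundle 𝓘(ℝ, E) ∞ E (fun x : M => TangentSpace 𝓘(ℝ, E) x)] in
lemma twistedDensity_eq_zero {x : M} (hx : x ∉ closure {x | ψ x ≠ 0}) :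
    twistedDensity D φ ψ x = 0 := by
  simp [twistedDensity, cov_eq_zero D hx]

omit hh hD in
lemma inner_eq_zero_of_notMem {x : M} (hx : x ∉ closure {x | ψ x ≠ 0}) :
    (inner ℂ (φ x) (ψ x) : ℂ) = 0 := by
  have : ψ x = 0 := by
    by_contra h
    exact hx (subset_closure h)
  rw [this, inner_zero_right]

variable [MeasurableSpace E] [BorelSpace E] [MeasurableSpace M] [BorelSpace M] [T2Space M]

lemma integrable_bochnerDensity (hφ : IsTestSection E φ) (hψ : IsTestSection E ψ) :
    Integrable (bochnerDensity D φ ψ) (vol E M) :=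
  (continuous_bochnerDensity hD hh hφ.1 hψ.1).integrable_of_hasCompactSupport
    (HasCompactSupport.intro hψ.2 fun _ hx => bochnerDensity_eq_zero hx)

lemma integrable_twistedDensity (hφ : IsTestSection E φ) (hψ : IsTestSection E ψ) :
    Integrable (twistedDensity D φ ψ) (vol E M) :=
  (continuous_twistedDensity hD hh hφ.1 hψ.1).integrable_of_hasCompactSupport
    (HasCompactSupport.intro hψ.2 fun _ hx => twistedDensity_eq_zero hx)

omit hD in
lemma integrable_inner (hφ : IsTestSection E φ) (hψ : IsTestSection E ψ) :
    Integrable (fun x => (inner ℂ (φ x) (ψ x) : ℂ)) (vol E M) :=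
  (continuous_inner hh hφ.1 hψ.1).integrable_of_hasCompactSupport
    (HasCompactSupport.intro hψ.2 fun _ hx => inner_eq_zero_of_notMem hx)

omit hD in
lemma isL2_of_isTestSection (hψ : IsTestSection E ψ) : IsL2 E ψ := by
  refine ⟨fun t _ => ?_, ?_⟩
  · have h : ContinuousOn (coord t ψ) t.baseSet := fun x hx =>
      ((smoothSectionAt_iff hx).1 (hψ.1 x)).continuousAt.continuousWithinAt
    exact h.aestronglyMeasurable t.open_baseSet.measurableSet
  · have h := (integrable_inner hh hψ hψ).2
    rw [hasFiniteIntegral_iff_enorm] at h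
    refine lt_of_eq_of_lt (lintegral_congr fun x => ?_) h
    rw [inner_self_eq_norm_sq_to_K, enorm_pow]
    congr 1
    rw [← ofReal_norm, ← ofReal_norm]
    simp

end Forms

/-! ### Integration by parts on the manifold -/

section LocalIdentities

variable {E : Type*} [NormedAddCommGroup E] [NormedSpace ℂ E] [FiniteDimensional ℂ E]
  {M : Type*} [TopologicalSpace M] [ChartedSpace E M]
  [RiemannianBundle (fun x : M => TangentSpace 𝓘(ℝ, E) x)]
  {L : M → Type*} [TopologicalSpace (TotalSpace ℂ L)]
  [∀ x, NormedAddCommGroup (L x)] [∀ x, InnerProductSpace ℂ (L x)]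
  [FiberBundle ℂ L] [IsManifold 𝓘(ℂ, E) ω M] [VectorBundle ℂ ℂ L]
  [ContMDiffVectorBundle ω ℂ L 𝓘(ℂ, E)]
  {e : OpenPartialHomeomorph M E} {t : Trivialization ℂ (π ℂ L)} [MemTrivializationAtlas t]

omit [FiniteDimensional ℂ E] [RiemannianBundle (fun x : M => TangentSpace 𝓘(ℝ, E) x)]
  [∀ x, InnerProductSpace ℂ (L x)] [VectorBundle ℂ ℂ L] [ContMDiffVectorBundle ω ℂ L 𝓘(ℂ, E)]
  [IsManifold 𝓘(ℂ, E) ω M] [MemTrivializationAtlas t] in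
lemma isCompact_image_chart {K : Set M} (hK : IsCompact K) (hKs : K ⊆ e.source ∩ t.baseSet) :
    IsCompact (e '' K) ∧ e '' K ⊆ domain e t :=
  ⟨hK.image_of_continuousOn (e.continuousOn.mono fun _ hx => (hKs hx).1), by
    rintro _ ⟨x, hx, rfl⟩
    exact map_mem_domain (hKs hx).1 (hKs hx).2⟩

omit [FiniteDimensional ℂ E] [RiemannianBundle (fun x : M => TangentSpace 𝓘(ℝ, E) x)]
  [ContMDiffVectorBundle ω ℂ L 𝓘(ℂ, E)] [IsManifold 𝓘(ℂ, E) ω M] in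
lemma coord_eq_zero {ψ : Π x, L x} {y : E} (hy : y ∈ domain e t)
    (hyK : y ∉ e '' closure {x | ψ x ≠ 0}) : (coord t ψ ∘ e.symm) y = 0 := by
  refine coord_eq_of_eq_smul hy.2 ?_
  rw [zero_smul]
  by_contra h
  exact hyK ⟨e.symm y, subset_closure h, e.right_inv hy.1⟩

/-- Local components with compact support define a test section. -/
lemma exists_isTestSection [T2Space M] (he : e ∈ atlas E M) {K : Set M} (hK : IsCompact K)
    (hKs : K ⊆ e.source ∩ t.baseSet) {G : E → ℂ} (hG : ContDiffOn ℝ ∞ G (domain e t))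
    (h0 : ∀ y ∈ domain e t, y ∉ e '' K → G y = 0) :
    ∃ η : Π x, L x, IsTestSection E η ∧ closure {x | η x ≠ 0} ⊆ e.source ∩ t.baseSet ∧
      ∀ y ∈ domain e t, (coord t η ∘ e.symm) y = G y := by
  classical
  let η : Π x, L x := fun x => if x ∈ e.source ∩ t.baseSet then G (e x) • frame t x else 0
  have hη0 : ∀ x ∉ K, η x = 0 := fun x hx => by
    by_cases h : x ∈ e.source ∩ t.baseSet
    · have h1 : e x ∉ e '' K := by
        rintro ⟨z, hz, hzx⟩
        exact hx (e.injOn (hKs hz).1 h.1 hzx ▸ hz)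
      simp only [η, if_pos h, h0 _ (map_mem_domain h.1 h.2) h1, zero_smul]
    · simp only [η, if_neg h]
  have hsupp : closure {x | η x ≠ 0} ⊆ K := by
    refine closure_minimal (fun x hx => ?_) hK.isClosed
    by_contra h
    exact hx (hη0 x h)
  refine ⟨η, ⟨fun x => ?_, hK.of_isClosed_subset isClosed_closure hsupp⟩, hsupp.trans hKs, ?_⟩
  · by_cases hx : x ∈ e.source ∩ t.baseSet
    · have h1 : ContMDiffAt 𝓘(ℝ, E) 𝓘(ℝ, ℂ) ∞ (G ∘ e) x :=
        ((hG.contDiffAt ((isOpen_domain e t).mem_nhds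
          (map_mem_domain hx.1 hx.2))).contMDiffAt).comp x
          (contMDiffAt_chart he hx.1)
      refine (SmoothSectionAt.smul h1 (smoothSectionAt_frame hx.2)).congr ?_
      filter_upwards [(e.open_source.inter t.open_baseSet).mem_nhds hx] with z hz
      simp only [η, if_pos hz, Function.comp_apply]
    · refine (smoothSectionAt_zero x).congr ?_
      filter_upwards [hK.isClosed.isOpen_compl.mem_nhds fun h => hx (hKs h)]
          with z hz using hη0 z hz
  · intro y hy
    refine coord_eq_of_eq_smul hy.2 ?_
    have hmem : e.symm y ∈ e.source ∩ t.baseSet := ⟨e.map_target hy.1, hy.2⟩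
    simp only [η, if_pos hmem, e.right_inv hy.1]

variable [IsContMDiffRiemannianBundle 𝓘(ℝ, E) ∞ E (fun x : M => TangentSpace 𝓘(ℝ, E) x)]
  [MeasurableSpace E] [BorelSpace E] [MeasurableSpace M] [BorelSpace M] [T2Space M]
  {φ ψ : Π x, L x} {D : CovariantDerivative 𝓘(ℝ, E) ℂ L}

lemma l2Inner_eq_integral_chart (he : e ∈ atlas E M) (hh : IsSmoothHermitian E L)
    (hφ : IsTestSection E φ) (hψ : IsTestSection E ψ)
    (hsupp : closure {x | ψ x ≠ 0} ⊆ e.source ∩ t.baseSet) :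
    l2Inner E φ ψ = ∫ y in domain e t, (chartDensity e y : ℂ) * (star ((coord t φ ∘ e.symm) y)
      * (coord t ψ ∘ e.symm) y * frameNormSq e t y) ∂(Module.finBasis ℝ E).addHaar := by
  rw [l2Inner, integral_eq_integral_chart he (continuous_inner hh hφ.1 hψ.1) (domain_subset e t)]
  · exact setIntegral_congr_fun (isOpen_domain e t).measurableSet fun y hy => by
      rw [inner_chart e hy]
  · intro x hx
    have h1 : x ∈ closure {x | ψ x ≠ 0} := by
      by_contra h
      exact hx (inner_eq_zero_of_notMem h)
    exact ⟨(hsupp h1).1, map_mem_domain (hsupp h1).1 (hsupp h1).2⟩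

/-- Integration by parts for a first order form with coefficients `a`. -/
lemma integral_localDensity (he : e ∈ atlas E M) (hh : IsSmoothHermitian E L)
    {a : E → Matrix (Fin (Module.finrank ℝ E)) (Fin (Module.finrank ℝ E)) ℝ}
    (ha : ∀ j k, ContDiffOn ℝ ∞ (fun y => a y j k) e.target) (hφ : IsTestSection E φ)
    (hψ : IsTestSection E ψ) (hsupp : closure {x | ψ x ≠ 0} ⊆ e.source ∩ t.baseSet) {F : M → ℂ}
    (hF : Continuous F) (hF0 : ∀ x ∉ closure {x | ψ x ≠ 0}, F x = 0)
    (hFa : ∀ y ∈ domain e t, F (e.symm y) = localDensity e t a φ ψ y) :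
    ∫ x, F x ∂(vol E M) = - ∫ y in domain e t, star ((coord t φ ∘ e.symm) y)
      * divGrad (connForm e t) (Module.finBasis ℝ E) (fun j k y => chartDensity e y * a y j k)
          (coord t ψ ∘ e.symm) y * frameNormSq e t y ∂(Module.finBasis ℝ E).addHaar := by
  have : FiniteDimensional ℝ E := FiniteDimensional.complexToReal E
  have hW := isOpen_domain e t
  obtain ⟨hK, hKW⟩ := isCompact_image_chart hψ.2 hsupp
  rw [integral_eq_integral_chart he hF (domain_subset e t) fun x hx => ?_]
  · rw [← setIntegral_covDeriv_mul_covDeriv hW hK hKW (contDiffOn_connForm he hh)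
      (fun j k => ((contDiffOn_chartDensity he).mul (ha j k)).mono (domain_subset e t))
      (contDiffOn_coord he hψ.1) (contDiffOn_coord he hφ.1) (contDiffOn_frameNormSq he hh)
      (fun y hy v => fderiv_frameNormSq he hh hy v) (fun y hy hyK => coord_eq_zero hy hyK)]
    refine setIntegral_congr_fun hW.measurableSet fun y hy => ?_
    simp only [hFa y hy, localDensity, ← mul_assoc, Finset.mul_sum]
    simp only [Complex.ofReal_mul, mul_assoc]
  · have h1 : x ∈ closure {x | ψ x ≠ 0} := by
      by_contra h
      exact hx (hF0 x h)
    exact ⟨(hsupp h1).1, map_mem_domain (hsupp h1).1 (hsupp h1).2⟩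

variable (hD : IsCompatible D) (hh : IsSmoothHermitian E L)
include hD hh

/-- The Bochner Laplacian of a test section with small support is a test section. -/
lemma exists_bochnerForm_eq_local (he : e ∈ atlas E M) (hψ : IsTestSection E ψ)
    (hsupp : closure {x | ψ x ≠ 0} ⊆ e.source ∩ t.baseSet) :
    ∃ η : Π x, L x, IsTestSection E η ∧
      ∀ φ, IsTestSection E φ → bochnerForm D φ ψ = - l2Inner E φ η := by
  have hW := isOpen_domain e t
  obtain ⟨hK, hKW⟩ := isCompact_image_chart hψ.2 hsupp
  have hdens := (contDiffOn_chartDensity he).mono (domain_subset e t)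
  have hdens0 : ∀ y ∈ domain e t, chartDensity e y ≠ 0 := fun y hy => (chartDensity_pos he hy.1).ne'
  set V : E → ℂ := divGrad (connForm e t) (Module.finBasis ℝ E)
    (fun j k y => chartDensity e y * (chartGram e y)⁻¹ j k) (coord t ψ ∘ e.symm)
  have hV : ContDiffOn ℝ ∞ V (domain e t) := contDiffOn_divGrad hW (contDiffOn_connForm he hh)
    (fun j k => hdens.mul ((contDiffOn_chartGram_inv he j k).mono (domain_subset e t)))
    (contDiffOn_coord he hψ.1)
  -- `η` is the Laplacian `(√det g)⁻¹ ∑ ∇_j (√det g g^jk ∇_k ψ)`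
  obtain ⟨η, hη, hηs, hηG⟩ := exists_isTestSection (t := t) he hψ.2 hsupp
    (G := fun y => ((chartDensity e y)⁻¹ : ℝ) * V y) ((contDiffOn_ofReal (hdens.inv hdens0)).mul hV)
    fun y hy hyK => by
      rw [show V y = 0 from divGrad_eq_zero hW hK (fun y hy hyK => coord_eq_zero hy hyK) y hy hyK,
        mul_zero]
  refine ⟨η, hη, fun φ hφ => ?_⟩
  have h1 := integral_localDensity (a := fun y => (chartGram e y)⁻¹) he hh
    (contDiffOn_chartGram_inv he) hφ hψ hsupp (continuous_bochnerDensity hD hh hφ.1 hψ.1)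
    (fun x hx => bochnerDensity_eq_zero hx) fun y hy => bochnerDensity_chart hD hh he hy hφ.1 hψ.1
  refine (h1 : bochnerForm D φ ψ = _).trans ?_
  rw [l2Inner_eq_integral_chart he hh hφ hη hηs]
  congr 1
  refine setIntegral_congr_fun hW.measurableSet fun y hy => ?_
  have h2 : (chartDensity e y : ℂ) ≠ 0 := Complex.ofReal_ne_zero.2 (hdens0 y hy)
  simp only [hηG y hy, Complex.ofReal_inv]
  change _ * V y * _ = _
  field_simp

/-- The twisted form is the multiplication by the curvature term, for sections with small support.
The reason is that the coefficients `√det g A` of the twisted form, in which `A` is the inverse of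
the fundamental two-form, are antisymmetric and divergence free. -/
lemma integral_twistedDensity_local (hg : IsKahler E M) (he : e ∈ atlas E M)
    (hφ : IsTestSection E φ)
    (hψ : IsTestSection E ψ) (hsupp : closure {x | ψ x ≠ 0} ⊆ e.source ∩ t.baseSet) :
    Complex.I * ∫ x, twistedDensity D φ ψ x ∂(vol E M)
      = l2Inner E φ fun x => (curvTrace E L x : ℂ) • ψ x := by
  have hW := isOpen_domain e t
  have hρψ : IsTestSection E fun x => (curvTrace E L x : ℂ) • ψ x :=
    hψ.smul ((Complex.ofRealCLM.contMDiff (n := ∞)).comp (contMDiff_curvTrace hD hh))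
  have hdens := (contDiffOn_chartDensity he).mono (domain_subset e t)
  have hρs : closure {x | (curvTrace E L x : ℂ) • ψ x ≠ 0} ⊆ e.source ∩ t.baseSet := by
    refine Set.Subset.trans (closure_mono fun x hx => ?_) hsupp
    exact right_ne_zero_of_smul hx
  rw [l2Inner_eq_integral_chart he hh hφ hρψ hρs, integral_localDensity (t := t) he hh
    (contDiffOn_chartBivector he) hφ hψ hsupp (continuous_twistedDensity hD hh hφ.1 hψ.1)
    (fun x hx => twistedDensity_eq_zero hx) fun y hy => twistedDensity_chart hD hh he hy hφ.1 hψ.1,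
    ← integral_neg, ← integral_const_mul]
  refine setIntegral_congr_fun hW.measurableSet fun y hy => ?_
  have h1 := divGrad_of_antisymm (a := fun j k y => chartDensity e y * chartBivector e y j k)
    (b := Module.finBasis ℝ E) hW (contDiffOn_connForm he hh)
    (fun j k => hdens.mul ((contDiffOn_chartBivector he j k).mono (domain_subset e t)))
    (contDiffOn_coord he hψ.1)
    (fun y hy j k => by simp only [chartBivector_antisymm he hg hy.1 j k]; ring)
    (fun y hy k => sum_fderiv_chartDensity_mul_chartBivector he hg hy.1 k) hy
  have h2 : (coord t (fun x => (curvTrace E L x : ℂ) • ψ x) ∘ e.symm) y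
      = (curvTrace E L (e.symm y) : ℂ) * (coord t ψ ∘ e.symm) y := coord_smul hy.2 _ _
  have h3 : ∑ j, ∑ k, ((chartDensity e y * chartBivector e y j k : ℝ) : ℂ)
        * (fderiv ℝ (connForm e t) y (Module.finBasis ℝ E j) (Module.finBasis ℝ E k)
          - fderiv ℝ (connForm e t) y (Module.finBasis ℝ E k) (Module.finBasis ℝ E j))
      = (chartDensity e y : ℂ) * ∑ j, ∑ k, (chartBivector e y j k : ℂ) *
        extDeriv (connForm e t) y (Module.finBasis ℝ E j) (Module.finBasis ℝ E k) := by
    simp only [Finset.mul_sum, extDeriv_apply, Complex.ofReal_mul, mul_assoc]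
  simp only [h1, h2, h3, curvTrace_chart hD hh he hy]
  ring

end LocalIdentities

/-! ### Square-integrable sections -/

section SquareIntegrable

variable {E : Type*} [NormedAddCommGroup E] [NormedSpace ℂ E] [FiniteDimensional ℂ E]
  [MeasurableSpace E] [BorelSpace E]
  {M : Type*} [TopologicalSpace M] [ChartedSpace E M] [MeasurableSpace M]
  [RiemannianBundle (fun x : M => TangentSpace 𝓘(ℝ, E) x)]
  {L : M → Type*} [TopologicalSpace (TotalSpace ℂ L)]
  [∀ x, NormedAddCommGroup (L x)] [∀ x, InnerProductSpace ℂ (L x)]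
  [FiberBundle ℂ L] [VectorBundle ℂ ℂ L] {φ ψ η : Π x, L x}

variable [BorelSpace M] [SecondCountableTopology M] (hh : IsSmoothHermitian E L)
include hh

lemma aestronglyMeasurable_inner (hφ : IsL2 E φ) (hψ : IsL2 E ψ) :
    AEStronglyMeasurable (fun x => (inner ℂ (φ x) (ψ x) : ℂ)) (vol E M) := by
  obtain ⟨s, hs, hcover⟩ := TopologicalSpace.countable_cover_nhds fun x : M =>
    (trivializationAt ℂ L x).open_baseSet.mem_nhds (FiberBundle.mem_baseSet_trivializationAt' x)
  have : Countable s := hs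
  have h1 : ∀ x : M, AEStronglyMeasurable (fun x => (inner ℂ (φ x) (ψ x) : ℂ))
      ((vol E M).restrict (trivializationAt ℂ L x).baseSet) := by
    intro x
    set t := trivializationAt ℂ L x
    have hcont : ContinuousOn (fun x => ((‖frame t x‖ ^ 2 : ℝ) : ℂ)) t.baseSet :=
      Complex.continuous_ofReal.comp_continuousOn (hh t).continuousOn
    have hm := t.open_baseSet.measurableSet
    refine AEStronglyMeasurable.congr
      (((hφ.1 t).star.mul (hψ.1 t)).mul (hcont.aestronglyMeasurable hm)) ?_
    filter_upwards [ae_restrict_mem hm] with x hx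
    exact (inner_eq_coord hx φ ψ).symm
  have h2 := AEStronglyMeasurable.iUnion (s := fun x : s => (trivializationAt ℂ L (x : M)).baseSet)
    fun x => h1 x
  rwa [← Set.biUnion_eq_iUnion s fun x _ => (trivializationAt ℂ L x).baseSet, hcover,
    Measure.restrict_univ] at h2

lemma aemeasurable_enorm (hφ : IsL2 E φ) : AEMeasurable (fun x => ‖φ x‖ₑ) (vol E M) := by
  have h1 : AEMeasurable (fun x => Real.sqrt (Complex.re (inner ℂ (φ x) (φ x)))) (vol E M) :=
    (Complex.continuous_re.comp_aestronglyMeasurable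
      (aestronglyMeasurable_inner hh hφ hφ)).aemeasurable.sqrt
  refine h1.ennreal_ofReal.congr (Eventually.of_forall fun x => ?_)
  have h2 : Real.sqrt (Complex.re (inner ℂ (φ x) (φ x))) = ‖φ x‖ :=
    (norm_eq_sqrt_re_inner (𝕜 := ℂ) (φ x)).symm
  simp only [h2, ofReal_norm]

lemma IsL2.smul_sub (hφ : IsL2 E φ) (hψ : IsL2 E ψ) {c : ℂ} (hc : ‖c‖ ≤ 1) :
    IsL2 E fun x => c • (φ x - ψ x) := by
  refine ⟨fun t _ => ?_, ?_⟩
  · refine AEStronglyMeasurable.congr (((hφ.1 t).sub (hψ.1 t)).const_mul c) ?_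
    filter_upwards [ae_restrict_mem t.open_baseSet.measurableSet] with x hx
    refine (coord_eq_of_eq_smul (ψ := fun x => c • (φ x - ψ x)) hx ?_).symm
    change c • (φ x - ψ x) = (c * (coord t φ x - coord t ψ x)) • frame t x
    rw [mul_smul, sub_smul, coord_smul_frame hx, coord_smul_frame hx]
  · have h1 : ∀ x, ‖c • (φ x - ψ x)‖ₑ ^ 2 ≤ 2 ^ 2 * (‖φ x‖ₑ ^ 2 + ‖ψ x‖ₑ ^ 2) := fun x => by
      have h2 : ‖c • (φ x - ψ x)‖ₑ ≤ 2 * max ‖φ x‖ₑ ‖ψ x‖ₑ := by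
        have hc' : ‖c‖ₑ ≤ 1 := by
          rw [← ofReal_norm]
          exact ENNReal.ofReal_le_one.2 hc
        calc ‖c • (φ x - ψ x)‖ₑ ≤ 1 * (‖φ x‖ₑ + ‖ψ x‖ₑ) := by
              rw [enorm_smul]
              exact mul_le_mul' hc' enorm_sub_le
          _ ≤ 2 * max ‖φ x‖ₑ ‖ψ x‖ₑ := by
              rw [one_mul, two_mul]
              exact add_le_add (le_max_left _ _) (le_max_right _ _)
      refine (pow_le_pow_left' h2 2).trans ?_
      rw [mul_pow]
      refine mul_le_mul_right ?_ _
      rcases max_choice ‖φ x‖ₑ ‖ψ x‖ₑ with h | h <;> rw [h]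
      · exact le_self_add
      · exact le_add_self
    refine (lintegral_mono h1).trans_lt ?_
    rw [lintegral_const_mul' _ _ (by finiteness),
      lintegral_add_left' ((aemeasurable_enorm hh hφ).pow_const 2)]
    exact ENNReal.mul_lt_top (by finiteness) (ENNReal.add_lt_top.2 ⟨hφ.2, hψ.2⟩)

lemma IsL2.sub (hφ : IsL2 E φ) (hψ : IsL2 E ψ) : IsL2 E fun x => φ x - ψ x := by
  simpa using hφ.smul_sub hh hψ (c := 1) (by simp)

/-- The Cauchy–Schwarz inequality. -/
lemma lintegral_enorm_inner_le (hφ : IsL2 E φ) (hψ : IsL2 E ψ) :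
    ∫⁻ x, ‖(inner ℂ (φ x) (ψ x) : ℂ)‖ₑ ∂(vol E M)
      ≤ (∫⁻ x, ‖φ x‖ₑ ^ 2 ∂(vol E M)) ^ (1 / 2 : ℝ)
        * (∫⁻ x, ‖ψ x‖ₑ ^ 2 ∂(vol E M)) ^ (1 / 2 : ℝ) := by
  have h1 := ENNReal.lintegral_mul_le_Lp_mul_Lq (vol E M) Real.HolderConjugate.two_two
    (aemeasurable_enorm hh hφ) (aemeasurable_enorm hh hψ)
  simp only [Pi.mul_apply, ENNReal.rpow_ofNat] at h1
  refine le_trans (lintegral_mono fun x => ?_) h1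
  rw [← ofReal_norm, ← ofReal_norm, ← ofReal_norm, ← ENNReal.ofReal_mul (norm_nonneg _)]
  exact ENNReal.ofReal_le_ofReal (norm_inner_le_norm _ _)

lemma IsL2.integrable_inner (hφ : IsL2 E φ) (hψ : IsL2 E ψ) :
    Integrable (fun x => (inner ℂ (φ x) (ψ x) : ℂ)) (vol E M) := by
  refine ⟨aestronglyMeasurable_inner hh hφ hψ, ?_⟩
  rw [hasFiniteIntegral_iff_enorm]
  exact (lintegral_enorm_inner_le hh hφ hψ).trans_lt (ENNReal.mul_lt_top
    (ENNReal.rpow_lt_top_of_nonneg (by norm_num) hφ.2.ne)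
    (ENNReal.rpow_lt_top_of_nonneg (by norm_num) hψ.2.ne))

/-- The inner product with a fixed square-integrable section is continuous in `L²`. -/
lemma tendsto_l2Inner (hφ : IsL2 E φ) (hψ : IsL2 E ψ) {u : ℕ → Π x, L x} (hu : ∀ n, IsL2 E (u n))
    (h : Tendsto (fun n => ∫⁻ x, ‖u n x - ψ x‖ₑ ^ 2 ∂(vol E M)) atTop (𝓝 0)) :
    Tendsto (fun n => l2Inner E φ (u n)) atTop (𝓝 (l2Inner E φ ψ)) := by
  rw [tendsto_iff_edist_tendsto_0]
  have h1 : Tendsto (fun n => (∫⁻ x, ‖φ x‖ₑ ^ 2 ∂(vol E M)) ^ (1 / 2 : ℝ)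
      * (∫⁻ x, ‖u n x - ψ x‖ₑ ^ 2 ∂(vol E M)) ^ (1 / 2 : ℝ)) atTop (𝓝 0) := by
    have h2 := (ENNReal.continuous_rpow_const (y := (1 / 2 : ℝ))).tendsto 0 |>.comp h
    rw [ENNReal.zero_rpow_of_pos (by norm_num)] at h2
    have h3 := ENNReal.Tendsto.const_mul (a := (∫⁻ x, ‖φ x‖ₑ ^ 2 ∂(vol E M)) ^ (1 / 2 : ℝ)) h2
      (Or.inr (ENNReal.rpow_lt_top_of_nonneg (by norm_num) hφ.2.ne).ne)
    rwa [mul_zero] at h3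
  refine tendsto_of_tendsto_of_tendsto_of_le_of_le tendsto_const_nhds h1 (fun _ => zero_le)
    fun n => ?_
  rw [edist_eq_enorm_sub, l2Inner, l2Inner, ← integral_sub (hφ.integrable_inner hh (hu n))
    (hφ.integrable_inner hh hψ)]
  simp only [← inner_sub_right]
  exact (enorm_integral_le_lintegral_enorm _).trans
    (lintegral_enorm_inner_le hh hφ ((hu n).sub hh hψ))

end SquareIntegrable

/-! ### The Bochner identity -/

section Global

variable {E : Type*} [NormedAddCommGroup E] [NormedSpace ℂ E] [FiniteDimensional ℂ E]
  [MeasurableSpace E] [BorelSpace E]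
  {M : Type*} [TopologicalSpace M] [ChartedSpace E M] [MeasurableSpace M]
  [RiemannianBundle (fun x : M => TangentSpace 𝓘(ℝ, E) x)]
  {L : M → Type*} [TopologicalSpace (TotalSpace ℂ L)]
  [∀ x, NormedAddCommGroup (L x)] [∀ x, InnerProductSpace ℂ (L x)]
  [FiberBundle ℂ L] [IsManifold 𝓘(ℂ, E) ω M] [VectorBundle ℂ ℂ L]
  [ContMDiffVectorBundle ω ℂ L 𝓘(ℂ, E)] {φ ψ η : Π x, L x}
  {D : CovariantDerivative 𝓘(ℝ, E) ℂ L}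

/-- The Laplacian of a form depends only on the values on test sections, which are a form core by
definition. -/
lemma isFormLaplacian_congr {Q Q' : (Π x, L x) → (Π x, L x) → ℂ}
    (h : ∀ φ ψ, IsTestSection E φ → IsTestSection E ψ → Q φ ψ = Q' φ ψ) :
    IsFormLaplacian (E := E) Q ψ η ↔ IsFormLaplacian (E := E) Q' ψ η := by
  have key : ∀ {Q Q' : (Π x, L x) → (Π x, L x) → ℂ},
      (∀ φ ψ, IsTestSection E φ → IsTestSection E ψ → Q φ ψ = Q' φ ψ) →
      IsFormLaplacian (E := E) Q ψ η → IsFormLaplacian (E := E) Q' ψ η := by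
    rintro Q Q' h ⟨hψ, hη, u, hu, hu1, hu2, hu3⟩
    refine ⟨hψ, hη, u, hu, hu1, hu2.congr fun p => ?_, fun φ hφ => (hu3 φ hφ).congr fun n => ?_⟩
    · exact h _ _ ((hu p.1).sub (hu p.2)) ((hu p.1).sub (hu p.2))
    · exact h _ _ hφ (hu n)
  exact ⟨key h, key fun φ ψ hφ hψ => (h φ ψ hφ hψ).symm⟩

lemma bochnerDensity_add (hφ : ∀ x, SmoothSectionAt E φ x) (hψ : ∀ x, SmoothSectionAt E ψ x)
    (χ : Π x, L x) (x : M) : bochnerDensity D χ (fun x => φ x + ψ x) x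
      = bochnerDensity D χ φ x + bochnerDensity D χ ψ x := by
  simp only [bochnerDensity, cov_add (hφ x) (hψ x), add_apply, inner_add_right,
      Finset.sum_add_distrib]

lemma twistedDensity_add (hφ : ∀ x, SmoothSectionAt E φ x) (hψ : ∀ x, SmoothSectionAt E ψ x)
    (χ : Π x, L x) (x : M) : twistedDensity D χ (fun x => φ x + ψ x) x
      = twistedDensity D χ φ x + twistedDensity D χ ψ x := by
  simp only [twistedDensity, cov_add (hφ x) (hψ x), add_apply, inner_add_right,
      Finset.sum_add_distrib]

lemma bochnerForm_zero_right (D : CovariantDerivative 𝓘(ℝ, E) ℂ L) (φ : Π x, L x) :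
    bochnerForm D φ 0 = 0 := by
  simp [bochnerForm, D.zero]

variable [BorelSpace M] [T2Space M]
  [IsContMDiffRiemannianBundle 𝓘(ℝ, E) ∞ E (fun x : M => TangentSpace 𝓘(ℝ, E) x)]
  (hD : IsCompatible D) (hh : IsSmoothHermitian E L)
include hh

omit hh in
lemma l2Inner_zero_right (φ : Π x, L x) : l2Inner E φ (fun _ => 0) = 0 := by
  simp [l2Inner]

lemma l2Inner_add (hφ : IsTestSection E φ) (hψ : IsTestSection E ψ) (hη : IsTestSection E η) :
    l2Inner E φ (fun x => ψ x + η x) = l2Inner E φ ψ + l2Inner E φ η := by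
  simp only [l2Inner, inner_add_right]
  exact integral_add (integrable_inner hh hφ hψ) (integrable_inner hh hφ hη)

include hD

variable [SecondCountableTopology M]

/-- The Bochner Laplacian maps test sections to test sections. -/
lemma exists_bochnerForm_eq (hψ : IsTestSection E ψ) :
    ∃ η : Π x, L x, IsTestSection E η ∧
      ∀ φ, IsTestSection E φ → bochnerForm D φ ψ = - l2Inner E φ η := by
  refine IsTestSection.induction (E := E) (P := fun ψ => ∃ η : Π x, L x, IsTestSection E η ∧
    ∀ φ, IsTestSection E φ → bochnerForm D φ ψ = - l2Inner E φ η) ?_ ?_ ?_ hψ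
  · exact ⟨fun _ => 0, isTestSection_zero, fun φ _ => by
      rw [l2Inner_zero_right, neg_zero]; exact bochnerForm_zero_right D φ⟩
  · rintro ψ₁ ψ₂ h₁ h₂ ⟨η₁, hη₁, hq₁⟩ ⟨η₂, hη₂, hq₂⟩
    refine ⟨_, hη₁.add hη₂, fun φ hφ => ?_⟩
    rw [l2Inner_add hh hφ hη₁ hη₂, neg_add, ← hq₁ φ hφ, ← hq₂ φ hφ]
    refine (integral_congr_ae (Eventually.of_forall
      fun x => bochnerDensity_add h₁.1 h₂.1 φ x)).trans ?_
    exact integral_add (integrable_bochnerDensity hD hh hφ h₁)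
        (integrable_bochnerDensity hD hh hφ h₂)
  · intro e he t _ ψ hψ hsupp
    exact exists_bochnerForm_eq_local hD hh he hψ hsupp

lemma isTestSection_curvTrace_smul (hψ : IsTestSection E ψ) :
    IsTestSection E fun x => (curvTrace E L x : ℂ) • ψ x :=
  hψ.smul ((Complex.ofRealCLM.contMDiff (n := ∞)).comp (contMDiff_curvTrace hD hh))

/-- The twisted form is the multiplication by the curvature term. -/
lemma integral_twistedDensity (hg : IsKahler E M) (hφ : IsTestSection E φ)
    (hψ : IsTestSection E ψ) :
    Complex.I * ∫ x, twistedDensity D φ ψ x ∂(vol E M)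
      = l2Inner E φ fun x => (curvTrace E L x : ℂ) • ψ x := by
  refine IsTestSection.induction (E := E) (P := fun ψ =>
    Complex.I * ∫ x, twistedDensity D φ ψ x ∂(vol E M)
      = l2Inner E φ fun x => (curvTrace E L x : ℂ) • ψ x) ?_ ?_ ?_ hψ
  · have h : ∀ x, twistedDensity D φ (fun x => (0 : L x)) x = 0 := fun x =>
      twistedDensity_eq_zero (by simp)
    simp [h, l2Inner]
  · intro ψ₁ ψ₂ h₁ h₂ ih₁ ih₂
    simp only [twistedDensity_add h₁.1 h₂.1, smul_add]
    rw [l2Inner_add hh hφ (isTestSection_curvTrace_smul hD hh h₁)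
      (isTestSection_curvTrace_smul hD hh h₂), ← ih₁, ← ih₂, ← mul_add,
      integral_add (integrable_twistedDensity hD hh hφ h₁) (integrable_twistedDensity hD hh hφ h₂)]
  · intro e he t _ ψ hψ hsupp
    exact integral_twistedDensity_local hD hh hg he hφ hψ hsupp

/-- The Bochner identity for the quadratic forms on test sections. -/
lemma holomorphicForm_eq_shiftedForm (hg : IsKahler E M) (hφ : IsTestSection E φ)
    (hψ : IsTestSection E ψ) :
    holomorphicForm D φ ψ = shiftedForm D (curvTrace E L) φ ψ := by
  rw [shiftedForm, ← integral_twistedDensity hD hh hg hφ hψ, ← integral_const_mul]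
  refine (integral_congr_ae (Eventually.of_forall fun x =>
      holomorphicDensity_eq hg D φ ψ x)).trans ?_
  rw [integral_const_mul]
  congr 1
  exact integral_add (integrable_bochnerDensity hD hh hφ hψ)
    ((integrable_twistedDensity hD hh hφ hψ).const_mul _)

/-- The holomorphic energy is dominated by the Bochner energy, with no condition on the curvature
term. -/
lemma norm_holomorphicForm_self_le (hg : IsKahler E M) (hψ : IsTestSection E ψ) :
    ‖holomorphicForm D ψ ψ‖ ≤ ‖bochnerForm D ψ ψ‖ := by
  have hint := integrable_bochnerDensity hD hh hψ hψ
  have h1 : ‖holomorphicForm D ψ ψ‖ ≤ ∫ x, (bochnerDensity D ψ ψ x).re ∂(vol E M) := by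
    refine norm_integral_le_of_norm_le hint.re (Eventually.of_forall fun x => ?_)
    obtain ⟨r, R, hr, hR, h0, hle⟩ := holomorphicDensity_self_le hg D ψ x
    change ‖holomorphicDensity D ψ ψ x‖ ≤ (bochnerDensity D ψ ψ x).re
    rw [hr, hR, Complex.norm_real, Real.norm_of_nonneg h0]
    exact hle
  refine h1.trans ?_
  have h2 : ∫ x, (bochnerDensity D ψ ψ x).re ∂(vol E M) = (bochnerForm D ψ ψ).re :=
    integral_re hint
  rw [h2]
  exact Complex.re_le_norm _

/-- The identity of the Laplacians on the natural domain: the approximating sequence of the Bochner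
form also approximates for the holomorphic form, which it dominates. -/
lemma isHolomorphicLaplacian_of_isBochnerLaplacian (hg : IsKahler E M)
    (h : IsBochnerLaplacian D ψ η) (hρ : IsL2 E fun x => (curvTrace E L x : ℂ) • ψ x) :
    IsHolomorphicLaplacian D ψ fun x => (1 / 2 : ℂ) • (η x - (curvTrace E L x : ℂ) • ψ x) := by
  obtain ⟨hψ, hη, u, hu, hu1, hu2, hu3⟩ := h
  refine ⟨hψ, hη.smul_sub hh hρ (by norm_num), u, hu, hu1, ?_, fun φ hφ => ?_⟩
  · refine squeeze_zero_norm (fun p => norm_holomorphicForm_self_le hD hh hg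
      ((hu p.1).sub (hu p.2))) (tendsto_zero_iff_norm_tendsto_zero.1 hu2)
  · -- `ρ` moves to the test section `φ`, where it is bounded on the support
    have hφL := isL2_of_isTestSection hh hφ
    have hρφ := isTestSection_curvTrace_smul hD hh hφ
    have hsymm : ∀ χ : Π x, L x, l2Inner E φ (fun x => (curvTrace E L x : ℂ) • χ x)
        = l2Inner E (fun x => (curvTrace E L x : ℂ) • φ x) χ := fun χ => by
      simp only [l2Inner, inner_smul_left, inner_smul_right, Complex.conj_ofReal]
    have h1 := tendsto_l2Inner hh (isL2_of_isTestSection hh hρφ) hψ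
      (fun n => isL2_of_isTestSection hh (hu n)) hu1
    simp only [← hsymm] at h1
    have h2 := ((hu3 φ hφ).add h1).const_mul (1 / 2 : ℂ)
    have h3 : (1 / 2 : ℂ) * (-l2Inner E φ η + l2Inner E φ fun x => (curvTrace E L x : ℂ) • ψ x)
        = -l2Inner E φ fun x => (1 / 2 : ℂ) • (η x - (curvTrace E L x : ℂ) • ψ x) := by
      have h4 := integral_sub (hφL.integrable_inner hh hη) (hφL.integrable_inner hh hρ)
      simp only [l2Inner, inner_smul_right _ _ (1 / 2 : ℂ), inner_sub_right]
      rw [integral_const_mul, h4]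
      ring
    rw [h3] at h2
    exact h2.congr fun n => (holomorphicForm_eq_shiftedForm hD hh hg hφ (hu n)).symm

/-- On test sections, the form identity gives the Bochner Laplacian. -/
lemma isBochnerLaplacian_of_isTestSection (hψ : IsTestSection E ψ) (hη : IsTestSection E η)
    (h : ∀ φ, IsTestSection E φ → bochnerForm D φ ψ = - l2Inner E φ η) :
    IsBochnerLaplacian D ψ η := by
  refine ⟨isL2_of_isTestSection hh hψ, isL2_of_isTestSection hh hη, fun _ => ψ, fun _ => hψ, ?_, ?_,
    fun φ hφ => ?_⟩
  · simp
  · simp only [sub_self, bochnerForm_zero_right]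
    exact tendsto_const_nhds
  · rw [← h φ hφ]
    exact tendsto_const_nhds

end Global

end KahlerBundle
end

theorem mainTheorem5
    {E : Type*} [NormedAddCommGroup E] [NormedSpace ℂ E] [FiniteDimensional ℂ E]
    [MeasurableSpace E] [BorelSpace E]
    {M : Type*} [TopologicalSpace M] [T2Space M] [SecondCountableTopology M]
    [ChartedSpace E M] [IsManifold 𝓘(ℂ, E) ω M]
    [MeasurableSpace M] [BorelSpace M]
    [RiemannianBundle (fun x : M => TangentSpace 𝓘(ℝ, E) x)]
    [IsContMDiffRiemannianBundle 𝓘(ℝ, E) ∞ E (fun x : M => TangentSpace 𝓘(ℝ, E) x)]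
    (hg : KahlerBundle.IsKahler E M)
    {L : M → Type*} [TopologicalSpace (TotalSpace ℂ L)]
    [∀ x, NormedAddCommGroup (L x)] [∀ x, InnerProductSpace ℂ (L x)]
    [FiberBundle ℂ L] [VectorBundle ℂ ℂ L] [ContMDiffVectorBundle ω ℂ L 𝓘(ℂ, E)]
    (hh : KahlerBundle.IsSmoothHermitian E L)
    (D : CovariantDerivative 𝓘(ℝ, E) ℂ L) (hD : KahlerBundle.IsCompatible D) :
    ∃ ρ : M → ℝ, ContMDiff 𝓘(ℝ, E) 𝓘(ℝ, ℝ) ∞ ρ ∧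
      -- `ρ` is the curvature term `∑ R_{Z̄_k, Z_k}` in every antiholomorphic orthonormal frame
      (∀ (U : Set M) (Zbar : Fin (Module.finrank ℂ E) → Π x : M, KahlerBundle.CTangent E x),
        IsOpen U →
        (∀ k, ∀ x ∈ U, KahlerBundle.SmoothFieldAt (fun y => (Zbar k y).re) x ∧
          KahlerBundle.SmoothFieldAt (fun y => (Zbar k y).im) x) →
        (∀ x ∈ U, KahlerBundle.IsAntiholomorphicONB x (fun k => Zbar k x)) →
        ∀ ψ : Π x, L x, (∀ x ∈ U, KahlerBundle.SmoothSectionAt E ψ x) → ∀ x ∈ U,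
          (ρ x : ℂ) • ψ x
            = ∑ k, KahlerBundle.curvature D (Zbar k) (fun y => (Zbar k y).conj) ψ x) ∧
      -- `Δ^(0,•) ψ = ½ (Δ^L ψ - ρ ψ)` as differential operators on test sections
      (∀ ψ : Π x, L x, KahlerBundle.IsTestSection E ψ →
        ∃ η : Π x, L x, KahlerBundle.IsTestSection E η ∧
          KahlerBundle.IsBochnerLaplacian D ψ η ∧
          KahlerBundle.IsHolomorphicLaplacian D ψ
            (fun x => (1 / 2 : ℂ) • (η x - (ρ x : ℂ) • ψ x))) ∧
      -- equality of the self-adjoint operators, the right-hand side being defined by its form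
      (∀ ψ η : Π x, L x, KahlerBundle.IsHolomorphicLaplacian D ψ η ↔
        KahlerBundle.IsFormLaplacian (E := E) (KahlerBundle.shiftedForm D ρ) ψ η) ∧
      -- the identity on the whole natural domain of the right-hand side
      (∀ ψ η : Π x, L x, KahlerBundle.IsBochnerLaplacian D ψ η →
        KahlerBundle.IsL2 E (fun x => (ρ x : ℂ) • ψ x) →
        KahlerBundle.IsHolomorphicLaplacian D ψ
          (fun x => (1 / 2 : ℂ) • (η x - (ρ x : ℂ) • ψ x))) := by
  refine ⟨KahlerBundle.curvTrace E L, KahlerBundle.contMDiff_curvTrace hD hh,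
    fun U Z hU hZ hZ' ψ hψ x hx => KahlerBundle.curvTrace_smul hD hh hg hU hZ hZ' hψ hx,
    fun ψ hψ => ?_, fun ψ η => KahlerBundle.isFormLaplacian_congr fun φ ψ hφ hψ =>
      KahlerBundle.holomorphicForm_eq_shiftedForm hD hh hg hφ hψ,
    fun ψ η h hρ => KahlerBundle.isHolomorphicLaplacian_of_isBochnerLaplacian hD hh hg h hρ⟩
  obtain ⟨η, hη, hq⟩ := KahlerBundle.exists_bochnerForm_eq hD hh hψ
  have h := KahlerBundle.isBochnerLaplacian_of_isTestSection hD hh hψ hη hq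
  exact ⟨η, hη, h, KahlerBundle.isHolomorphicLaplacian_of_isBochnerLaplacian hD hh hg h
    (KahlerBundle.isL2_of_isTestSection hh (KahlerBundle.isTestSection_curvTrace_smul hD hh hψ))⟩
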